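/- Notation. Let $\tau$ lie in the upper half-plane, $q=e^{2\pi i\tau}$, and $$\theta(\xi,\tau)=\sum_{\nu\in\mathbb Z+\frac12}(-1)^{\nu-\frac12}q^{\nu^2/2}e^{2\pi i\nu\xi},\qquad F(\xi,\alpha,\tau)=\frac{\theta'(0,\tau)\,\theta(\xi+\alpha,\tau)}{\theta(\xi,\tau)\,\theta(\alpha,\tau)}=\sum_{n\ge 0}f_n(\xi,\tau)(2\pi i\alpha)^{n-1},$$ where $\theta'=\partial\theta/\partial\xi$, and let $\omega_n(\xi,\tau)=\sum_{k=0}^n\frac{1}{k!}\Big(\frac{\Im\xi}{\Im\tau}\Big)^k f_{n-k}(\xi,\tau)$. For $n_1,\dots,n_r\ge 0$ the (regularized) A-elliptic multiple zeta value $A(n_1,\dots,n_r;\tau)$ is the constant term $A_0$ in the expansion, for $\varepsilon\to0^+$, $$\int_{1-\varepsilon\ge t_1\ge\cdots\ge t_r\ge\varepsilon}\omega_{n_1}(t_1,\tau)\cdots\omega_{n_r}(t_r,\tau)\,dt_1\cdots dt_r=\sum_{k=0}^rA_k\log(-2\pi i\varepsilon)^k+O(\varepsilon^{\kappa})\quad\text{for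 some }\kappa>0,$$ with the principal branch of the logarithm, and $A^\infty(n_1,\dots,n_r)$ is the constant term of the $q$-expansion of $A(n_1,\dots,n_r;\tau)$. The depth-one generating series are $$\mathcal A(X,Y;\tau)=\sum_{n\ge0,\;r\ge1}\frac{A(n,\overbrace{0,\dots,0}^{r-1};\tau)}{(2\pi i)^{r-1}}X^{n-1}Y^{r-1},\qquad \mathcal A^\infty(X,Y)=\sum_{n\ge0,\;r\ge1}\frac{A^\infty(n,\overbrace{0,\dots,0}^{r-1})}{(2\pi i)^{r-1}}X^{n-1}Y^{r-1}.$$ Work in the field $\mathbb C((X))((Y))$ of iterated formal Laurent series. There $\Re$ denotes the coefficientwise real part, and $\mathcal L^{-1}_{X,Y}$ is the operator that replaces $c\,X^aY^b$ by $(a+b)!\,c\,X^aY^b$ if $a+b\ge0$ and by $0$ if $a+b<0$ (in the formula below, terms of negative total degree come only from $n=0$, which contributes $2\pi i/(UV)$ to each quotient $\mathcal A(U,V)/(e^V-1)$). Let $\eta$ be the Dedekind eta function and let $$\mathcal R(X,Y;\tau)=\frac{\Im\tau}{4\pi}\sum_{\substack{i,j\ge1\\ i+j\ge4}}(i+j-2)!\sum_{(m,n)\in\mathbb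 Z^2\setminus\{(0,0)\}}\frac{(X-\tau Y)^{i-1}(X-\overline\tau Y)^{j-1}}{(m\tau+n)^i(m\overline\tau+n)^j}\in\mathbb C[[X,Y]]$$ be the generating series of real analytic Eisenstein series. Proposition. For every $\tau$ in the upper half-plane, $$\mathcal R(X,Y;\tau)=\frac12\mathcal L^{-1}_{X,Y}\,\Re\bigg(\frac{\mathcal A^\infty(2\pi iX,-2\pi iY)}{e^{-2\pi iY}-1}\bigg)+\log|\eta(\tau)|-\frac12\mathcal L^{-1}_{X,Y}\,\Re\bigg(\frac{\mathcal A(2\pi i(X-\tau Y),-2\pi iY;\tau)}{e^{-2\pi iY}-1}\bigg)+\sum_{k\ge2}\frac{(2k-2)!}{2}\,\zeta(2k-1)\,Y^{2k-2}.$$ -/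

import Mathlib

noncomputable section

namespace EllMZV

/-! ### The Kronecker function and its expansion coefficients -/

/-- The odd Jacobi theta function `θ(ξ, τ) = ∑_{ν ∈ ℤ + 1/2} (-1)^(ν - 1/2) q^(ν²/2) u^ν`,
with `q = exp (2πiτ)`, `u = exp (2πiξ)` and `ν = n + 1/2`. -/
def theta (ξ τ : ℂ) : ℂ :=
  ∑' n : ℤ, (-1 : ℂ) ^ n *
    Complex.exp (Real.pi * Complex.I * ((n : ℂ) + 1 / 2) ^ 2 * τ +
      2 * Real.pi * Complex.I * ((n : ℂ) + 1 / 2) * ξ)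

/-- The Kronecker function `F(ξ, α, τ) = θ'(0, τ) θ(ξ + α, τ) / (θ(ξ, τ) θ(α, τ))`. -/
def kronecker (ξ α τ : ℂ) : ℂ :=
  deriv (fun z => theta z τ) 0 * theta (ξ + α) τ / (theta ξ τ * theta α τ)

/-- `α F(ξ, α, τ)` as a function of `α`, with its removable singularity at `α = 0` filled in
(`F` has a simple pole with residue `1` there when `ξ` is not a lattice point). -/
def kroneckerReg (ξ τ : ℂ) : ℂ → ℂ :=
  Function.update (fun α => α * kronecker ξ α τ) 0 1

/-- The coefficients `f_n` in `F(ξ, α, τ) = ∑_{n ≥ 0} f_n(ξ, τ) (2πiα)^(n-1)`: the `n`-th Taylor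
coefficient of `α F(ξ, α, τ)` at `α = 0` is `(2πi)^(n-1) f_n(ξ, τ)`. -/
def kroneckerCoeff (n : ℕ) (ξ τ : ℂ) : ℂ :=
  iteratedDeriv n (kroneckerReg ξ τ) 0 / (n.factorial : ℂ) /
    (2 * Real.pi * Complex.I) ^ ((n : ℤ) - 1)

/-- `ω_n(ξ, τ) = ∑_{k=0}^n (r^k / k!) f_{n-k}(ξ, τ)` with `r = Im ξ / Im τ`. -/
def omega (n : ℕ) (ξ τ : ℂ) : ℂ :=
  ∑ k ∈ Finset.range (n + 1),
    ((ξ.im / τ.im : ℝ) : ℂ) ^ k / (k.factorial : ℂ) * kroneckerCoeff (n - k) ξ τ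

/-! ### A-elliptic multiple zeta values -/

/-- The iterated integral of `ω_{n₁} dt₁ ⋯ ω_{n_r} dt_r` over `x ≥ t₁ ≥ ⋯ ≥ t_r ≥ ε`. -/
def iterInt (τ : ℂ) (ε : ℝ) : List ℕ → ℝ → ℂ
  | [], _ => 1
  | n :: l, x => ∫ t in ε..x, omega n (t : ℂ) τ * iterInt τ ε l t

/-- `P` is the polynomial in `log (-2πiε)` that describes the behaviour of the iterated integral
over `[ε, 1 - ε]` as `ε → 0⁺`, up to `O(ε^ν)` with `ν > 0`. The principal branch of the logarithm
is the one with `2 log (±i) = ±πi`. -/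
def IsLogExpansion (l : List ℕ) (τ : ℂ) (P : Polynomial ℂ) : Prop :=
  P.natDegree ≤ l.length ∧ ∃ ν : ℝ, 0 < ν ∧
    (fun ε : ℝ => iterInt τ ε l (1 - ε) -
        P.eval (Complex.log (-2 * Real.pi * Complex.I * (ε : ℂ))))
      =O[nhdsWithin 0 (Set.Ioi 0)] (fun ε : ℝ => ε ^ ν)

open Classical in
/-- The regularized A-elliptic multiple zeta value `A(n₁, …, n_r; τ)`: the constant term of the
expansion in powers of `log (-2πiε)`. -/
def ellMZV (l : List ℕ) (τ : ℂ) : ℂ :=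
  if h : ∃ P : Polynomial ℂ, IsLogExpansion l τ P then h.choose.coeff 0 else 0

/-- The constant term `A^∞(n₁, …, n_r)` of the `q`-expansion of `A(n₁, …, n_r; τ)`. -/
def ellMZVInf (l : List ℕ) : ℂ :=
  (UpperHalfPlane.qExpansion 1 (fun τ : UpperHalfPlane => ellMZV l τ)).coeff 0

/-! ### Formal series in two variables

Power series in `X = X 0` and `Y = X 1` are `MvPowerSeries (Fin 2) ℂ`. They are embedded in the
field `ℂ((X))((Y))` of iterated Laurent series, where the quotients below live. -/

/-- The field `ℂ((X))((Y))`; the coefficient of `X^i Y^j` in `S` is `(S.coeff j).coeff i`. -/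
abbrev Laurent2 : Type := LaurentSeries (LaurentSeries ℂ)

/-- The power series `∑_{i,j ≥ 0} c i j X^i Y^j`. -/
def biSeries (c : ℕ → ℕ → ℂ) : MvPowerSeries (Fin 2) ℂ := fun e => c (e 0) (e 1)

/-- The embedding of `ℂ[[X, Y]]` in `ℂ((X))((Y))`. -/
def toLaurent (P : MvPowerSeries (Fin 2) ℂ) : Laurent2 :=
  HahnSeries.ofPowerSeries ℤ (LaurentSeries ℂ) (PowerSeries.mk fun j =>
    HahnSeries.ofPowerSeries ℤ ℂ (PowerSeries.mk fun i =>
      MvPowerSeries.coeff (Finsupp.single 0 i + Finsupp.single 1 j) P))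

/-- Apply to the coefficient of each `X^i Y^j` the map `φ i j`, which fixes `0`. -/
def mapCoeff (φ : ℤ → ℤ → ZeroHom ℂ ℂ) (S : Laurent2) : Laurent2 where
  coeff j :=
    { coeff := fun i => φ i j ((S.coeff j).coeff i)
      isPWO_support' := (S.coeff j).isPWO_support.mono fun i hi h0 => hi (by
        change φ i j ((S.coeff j).coeff i) = 0
        rw [h0]; exact map_zero (φ i j)) }
  isPWO_support' := S.isPWO_support.mono fun j hj h0 => hj (by
    ext i
    change φ i j ((S.coeff j).coeff i) = 0
    rw [h0]; exact map_zero (φ i j))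

/-- The coefficientwise real part of a formal series. -/
def rePart : Laurent2 → Laurent2 :=
  mapCoeff fun _ _ => { toFun := fun z => (z.re : ℂ), map_zero' := by simp }

/-- The inverse Laplace operator `L⁻¹`, which multiplies the coefficient of `X^i Y^j` by
`(i + j)!`; the terms of negative total degree `i + j` are dropped. -/
def laplaceInv : Laurent2 → Laurent2 :=
  mapCoeff fun i j =>
    { toFun := fun z => if 0 ≤ i + j then ((i + j).toNat.factorial : ℂ) * z else 0
      map_zero' := by simp }

/-! ### Generating series -/

/-- For a family `a l` indexed by tuples, the series
`𝒜(U, V) = ∑_{n ≥ 0, r ≥ 1} a(n, 0, …, 0) / (2πi)^(r-1) U^(n-1) V^(r-1)` (with `r - 1` zeros),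
evaluated at power series `U`, `V` without constant term; it is written as
`U⁻¹ ∑_{n, s ≥ 0} a(n, 0^s) / (2πi)^s U^n V^s`. -/
def genSeries (a : List ℕ → ℂ) (U V : MvPowerSeries (Fin 2) ℂ) : Laurent2 :=
  toLaurent (MvPowerSeries.subst ![U, V]
    (biSeries fun n s => a (n :: List.replicate s 0) / (2 * Real.pi * Complex.I) ^ s)) /
    toLaurent U

/-- The generating series `𝒜(U, V; τ)` of the A-elliptic multiple zeta values of depth one. -/
def genA (U V : MvPowerSeries (Fin 2) ℂ) (τ : UpperHalfPlane) : Laurent2 :=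
  genSeries (fun l => ellMZV l τ) U V

/-- The generating series `𝒜^∞(U, V)` of their constant terms. -/
def genAInf (U V : MvPowerSeries (Fin 2) ℂ) : Laurent2 :=
  genSeries ellMZVInf U V

/-- The series `e^V - 1`, for a power series `V` without constant term. -/
def expSubOne (V : MvPowerSeries (Fin 2) ℂ) : Laurent2 :=
  toLaurent (PowerSeries.subst V (PowerSeries.exp ℂ) - 1)

/-- The linear form `a X + b Y`. -/
def lin (a b : ℂ) : MvPowerSeries (Fin 2) ℂ :=
  MvPowerSeries.C a * MvPowerSeries.X 0 + MvPowerSeries.C b * MvPowerSeries.X 1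

/-- The lattice sum `∑_{(m,n) ≠ (0,0)} (mτ + n)^(-i) (m τ̄ + n)^(-j)`. -/
def latticeSum (i j : ℕ) (τ : UpperHalfPlane) : ℂ :=
  ∑' p : {p : ℤ × ℤ // p ≠ (0, 0)},
    1 / (((p.1.1 : ℂ) * (τ : ℂ) + (p.1.2 : ℂ)) ^ i *
      ((p.1.1 : ℂ) * (starRingEnd ℂ) (τ : ℂ) + (p.1.2 : ℂ)) ^ j)

/-- The generating series of real analytic Eisenstein series
`ℛ(X, Y; τ) = (Im τ / 4π) ∑_{i,j ≥ 1, i+j ≥ 4} (i+j-2)!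
  ∑_{(m,n) ≠ (0,0)} (X - τY)^(i-1) (X - τ̄Y)^(j-1) / ((mτ+n)^i (mτ̄+n)^j)`.
The coefficient at an exponent `e` of total degree `d` comes from the `(i, j) = (p.1+1, p.2+1)`
with `p.1 + p.2 = d`. -/
def eisR (τ : UpperHalfPlane) : MvPowerSeries (Fin 2) ℂ := fun e =>
  if 4 ≤ e 0 + e 1 + 2 then
    ((τ.im / (4 * Real.pi) : ℝ) : ℂ) * ∑ p ∈ Finset.HasAntidiagonal.antidiagonal (e 0 + e 1),
      ((p.1 + p.2).factorial : ℂ) * latticeSum (p.1 + 1) (p.2 + 1) τ *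
        MvPowerSeries.coeff e
          (lin 1 (-(τ : ℂ)) ^ p.1 * lin 1 (-(starRingEnd ℂ) (τ : ℂ)) ^ p.2)
  else 0

/-- The series `∑_{k ≥ 2} (2k-2)! / 2 · ζ(2k-1) Y^(2k-2)`. -/
def oddZetaSeries : MvPowerSeries (Fin 2) ℂ :=
  biSeries fun i j =>
    if i = 0 ∧ 2 ≤ j ∧ Even j then (j.factorial : ℂ) / 2 * riemannZeta ((j : ℂ) + 1) else 0

end EllMZV

end

/-! Both sides are reduced to explicit `q`-series and compared degree by degree.

For real `t` in `(0, 1)`, with `z = e^{2πit}` and `w = e^{2πiα}`, the Kronecker function is `π cot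
πt + π cot πα - 2πi ∑_{m,k≥1} q^{mk} (z^m w^k - z^{-m} w^{-k})`. This comes from the bilateral
series `∑ w^n / (1 - z q^n)`: its product with `θ(α)` has Laurent coefficients obeying the same
first-order recursion as those of `θ(t + α)` (`exists_appell_mul_theta`). The behaviour at `α = 0`
then fixes the constant (`kroneckerReg_eventuallyEq`).

Integrating the Taylor coefficients in `α` against `t^s / s!` gives the depth-one values
(`exists_ellMZV_succ_cons`). Only `π cot πt`, which occurs in `ω_1` alone, needs regularization, and
its contributions `c_s` do not depend on `τ`. At the cusp the same formulas hold without the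
`q`-series. Hence `𝒜(U, V) / (e^V - 1) = 2πi/(UV) + c(V)/(e^V - 1) + k(U)/V + B(U, V)`
(`genSeries_div_expSubOne`), with `k` from the Taylor coefficients of the cotangent and `B` a
Lambert series, zero at the cusp. In the difference of the two quotients the terms with `c`, never
computed, cancel. The terms `2πi/(UV)` have degree `-2` and are killed by `L⁻¹`. The two arguments
`U` differ by a multiple of `V`, so the `k`-terms combine into a divided difference. What remains is
the power series `quotientDiff`.

On the Eisenstein side, partial fractions (`latticeForm_eq_sum`) separate `mτ + n` from its
conjugate, and the sum over `n` is done by the Lipschitz formula. In even degree `d ≥ 2` the row `m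
= 0` gives `ζ(d+2) Im (x - τ)^{d+1}`, which is the cotangent part of `quotientDiff`. The other rows
give its Lambert part, together with `ζ(d+1)`, produced by the constant `-π` in the weight-one case
of Lipschitz. In odd degree everything vanishes by symmetry. In degree `0` there is no lattice sum,
and `log |η|` cancels `quotientDiff` because `ζ(2) = π²/6` and `log (1 - q^k)` expands into the same
Lambert series. -/

noncomputable section

namespace EllMZV

open Complex Filter Topology
open scoped Real

/-! ### Elementary properties of the theta function -/

/-- The coefficients `(-1)^n q^((n + 1/2)²/2)` of the theta function. -/
def thetaCoeff (τ : ℂ) (n : ℤ) : ℂ :=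
  (-1 : ℂ) ^ n * cexp (π * I * ((n : ℂ) + 1 / 2) ^ 2 * τ)

lemma theta_term_eq (ξ τ : ℂ) (n : ℤ) :
    (-1 : ℂ) ^ n * cexp (π * I * ((n : ℂ) + 1 / 2) ^ 2 * τ + 2 * π * I * ((n : ℂ) + 1 / 2) * ξ) =
      thetaCoeff τ n * cexp (2 * π * I * ((n : ℂ) + 1 / 2) * ξ) := by
  rw [thetaCoeff, Complex.exp_add]
  ring

lemma theta_eq_tsum (ξ τ : ℂ) :
    theta ξ τ = ∑' n : ℤ, thetaCoeff τ n * cexp (2 * π * I * ((n : ℂ) + 1 / 2) * ξ) := by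
  simp only [theta, theta_term_eq]

lemma neg_one_zpow_eq_cexp (n : ℤ) : (-1 : ℂ) ^ n = cexp (π * I * n) := by
  rw [mul_comm, Complex.exp_int_mul, Complex.exp_pi_mul_I]

lemma theta_term_eq_jacobi (ξ τ : ℂ) (n : ℤ) :
    thetaCoeff τ n * cexp (2 * π * I * ((n : ℂ) + 1 / 2) * ξ) =
      cexp (π * I * τ / 4 + π * I * ξ) * jacobiTheta₂_term n (ξ + τ / 2 + 1 / 2) τ := by
  rw [thetaCoeff, neg_one_zpow_eq_cexp, jacobiTheta₂_term, ← Complex.exp_add, ← Complex.exp_add,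
    ← Complex.exp_add]
  congr 1
  ring

lemma summable_theta_term {τ : ℂ} (hτ : 0 < τ.im) (ξ : ℂ) :
    Summable fun n : ℤ => thetaCoeff τ n * cexp (2 * π * I * ((n : ℂ) + 1 / 2) * ξ) := by
  simp only [theta_term_eq_jacobi]
  exact ((summable_jacobiTheta₂_term_iff _ τ).2 hτ).mul_left _

lemma summable_thetaCoeff {τ : ℂ} (hτ : 0 < τ.im) : Summable (thetaCoeff τ) := by
  simpa using summable_theta_term hτ 0

lemma theta_eq_jacobi (ξ τ : ℂ) :
    theta ξ τ = cexp (π * I * τ / 4 + π * I * ξ) * jacobiTheta₂ (ξ + τ / 2 + 1 / 2) τ := by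
  rw [theta_eq_tsum, jacobiTheta₂, ← tsum_mul_left]
  exact tsum_congr fun n => theta_term_eq_jacobi ξ τ n

lemma differentiable_theta {τ : ℂ} (hτ : 0 < τ.im) : Differentiable ℂ fun z => theta z τ := by
  intro z
  have h : (fun z => theta z τ) = fun z =>
      cexp (π * I * τ / 4 + π * I * z) * jacobiTheta₂ (z + τ / 2 + 1 / 2) τ :=
    funext fun z => theta_eq_jacobi z τ
  rw [h]
  refine DifferentiableAt.mul (by fun_prop) ?_
  exact DifferentiableAt.comp (g := fun x => jacobiTheta₂ x τ) z
    (differentiableAt_jacobiTheta₂_fst _ hτ) (by fun_prop)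

/-- The reflection `ν ↦ -ν` of half-integers is `n ↦ -1 - n`; it preserves `ν²` and reverses the
sign. This is the oddness of `θ`, responsible for `θ(0) = 0`. -/
lemma thetaCoeff_reflect (τ : ℂ) (n : ℤ) : thetaCoeff τ (-1 - n) = -thetaCoeff τ n := by
  have h : (-1 : ℂ) ^ (-1 - n : ℤ) = -(-1 : ℂ) ^ n := by
    rw [zpow_sub₀ (by norm_num), zpow_neg_one, div_eq_mul_inv, ← inv_zpow]
    norm_num
  rw [thetaCoeff, thetaCoeff, h, neg_mul]
  congr 3
  push_cast
  ring

lemma tsum_thetaCoeff (τ : ℂ) : ∑' n : ℤ, thetaCoeff τ n = 0 := by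
  have h : ∑' n : ℤ, thetaCoeff τ n = ∑' n : ℤ, thetaCoeff τ (-1 - n) :=
    ((Equiv.subLeft (-1 : ℤ)).tsum_eq (thetaCoeff τ)).symm
  simp only [thetaCoeff_reflect, tsum_neg] at h
  linear_combination (1 / 2 : ℂ) * h

lemma theta_zero (τ : ℂ) : theta 0 τ = 0 := by
  rw [theta_eq_tsum]
  simpa using tsum_thetaCoeff τ

lemma thetaCoeff_succ (τ : ℂ) (n : ℤ) :
    thetaCoeff τ (n + 1) = -(cexp (2 * π * I * τ)) ^ (n + 1) * thetaCoeff τ n := by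
  rw [thetaCoeff, thetaCoeff, zpow_add_one₀ (by norm_num), ← Complex.exp_int_mul]
  have : cexp (π * I * (((n + 1 : ℤ) : ℂ) + 1 / 2) ^ 2 * τ) =
      cexp (((n + 1 : ℤ) : ℂ) * (2 * π * I * τ)) * cexp (π * I * ((n : ℂ) + 1 / 2) ^ 2 * τ) := by
    rw [← Complex.exp_add]
    congr 1
    push_cast
    ring
  rw [this]
  ring

lemma integral_cexp_int (n : ℤ) (hn : n ≠ 0) :
    ∫ x in (0 : ℝ)..1, cexp (2 * π * I * n * x) = 0 := by
  have hc : (2 * π * I * n : ℂ) ≠ 0 :=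
    mul_ne_zero two_pi_I_ne_zero (by exact_mod_cast hn)
  rw [integral_exp_mul_complex hc]
  have : cexp (2 * π * I * n * (1 : ℝ)) = 1 := by
    rw [Complex.exp_eq_one_iff]
    exact ⟨n, by push_cast; ring⟩
  rw [this]
  simp

lemma norm_cexp_real_mul_I (x : ℝ) (n : ℤ) : ‖cexp (2 * π * I * n * x)‖ = 1 := by
  rw [show (2 * π * I * n * x : ℂ) = ((2 * π * n * x : ℝ) : ℂ) * I by push_cast; ring,
    Complex.norm_exp_ofReal_mul_I]

/-- On the real line `e^{-πix} θ(x)` is an absolutely convergent Fourier series. If it vanished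
identically, so would its zeroth coefficient, which is an exponential. -/
lemma exists_theta_ne_zero {τ : ℂ} (hτ : 0 < τ.im) : ∃ ξ, theta ξ τ ≠ 0 := by
  by_contra! h
  have hsum : HasSum (fun n : ℤ => ∫ x in (0 : ℝ)..1, thetaCoeff τ n * cexp (2 * π * I * n * x))
      (∫ x in (0 : ℝ)..1, ∑' n : ℤ, thetaCoeff τ n * cexp (2 * π * I * n * x)) := by
    refine intervalIntegral.hasSum_integral_of_dominated_convergence
      (fun n _ => ‖thetaCoeff τ n‖) (fun n => ?_) ?_ ?_ ?_ ?_
    · exact (Continuous.aestronglyMeasurable (by fun_prop))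
    · intro n
      refine Filter.Eventually.of_forall fun x _ => ?_
      rw [norm_mul, norm_cexp_real_mul_I, mul_one]
    · exact Filter.Eventually.of_forall fun x _ => (summable_thetaCoeff hτ).norm
    · exact intervalIntegrable_const
    · refine Filter.Eventually.of_forall fun x _ => ?_
      refine Summable.hasSum (Summable.of_norm ?_)
      simpa only [norm_mul, norm_cexp_real_mul_I, mul_one] using (summable_thetaCoeff hτ).norm
  have h0 : ∀ x : ℝ, ∑' n : ℤ, thetaCoeff τ n * cexp (2 * π * I * n * x) = 0 := by
    intro x
    have := h x
    rw [theta_eq_tsum] at this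
    have h2 : ∀ n : ℤ, thetaCoeff τ n * cexp (2 * π * I * ((n : ℂ) + 1 / 2) * x) =
        cexp (π * I * x) * (thetaCoeff τ n * cexp (2 * π * I * n * x)) := by
      intro n
      rw [mul_left_comm, ← Complex.exp_add]
      congr 2
      ring
    simp only [h2, tsum_mul_left] at this
    exact (mul_eq_zero.1 this).resolve_left (Complex.exp_ne_zero _)
  simp only [h0, intervalIntegral.integral_const_mul] at hsum
  have h1 := hsum.unique (hasSum_single (0 : ℤ) fun n hn => by rw [integral_cexp_int n hn, mul_zero])
  have h3 : thetaCoeff τ 0 ≠ 0 := by simp [thetaCoeff]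
  simp at h1
  exact h3 h1.symm

/-! ### The Appell-type series of the Kronecker function -/

/-- The bilateral series `∑ w^n / (1 - z q^n)` with `z = exp (2πit)` and `w = exp (2πiα)`. -/
def appell (t : ℝ) (τ α : ℂ) : ℂ :=
  ∑' n : ℤ, cexp (2 * π * I * n * α) / (1 - cexp (2 * π * I * t) * cexp (2 * π * I * τ) ^ n)

lemma norm_nome (τ : ℂ) : ‖cexp (2 * π * I * τ)‖ = Real.exp (-(2 * π * τ.im)) := by
  rw [Complex.norm_exp]
  congr 1
  simp

lemma norm_nome_lt_one {τ : ℂ} (hτ : 0 < τ.im) : ‖cexp (2 * π * I * τ)‖ < 1 := by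
  rw [norm_nome, Real.exp_lt_one_iff]
  have := Real.pi_pos
  have : 0 < 2 * π * τ.im := by positivity
  linarith

lemma norm_cexp_ofReal (t : ℝ) : ‖cexp (2 * π * I * t)‖ = 1 := by
  simpa using norm_cexp_real_mul_I t 1

lemma cexp_ne_one_of_mem_Ioo {t : ℝ} (ht : t ∈ Set.Ioo (0 : ℝ) 1) : cexp (2 * π * I * t) ≠ 1 := by
  intro h
  rw [Complex.exp_eq_one_iff] at h
  obtain ⟨n, hn⟩ := h
  have h1 : (t : ℂ) = n := by
    have := two_pi_I_ne_zero
    apply mul_left_cancel₀ this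
    rw [hn]; ring
  have h2 : t = n := by exact_mod_cast h1
  rw [h2] at ht
  have h3 : 0 < n := by exact_mod_cast ht.1
  have h4 : n < 1 := by exact_mod_cast ht.2
  omega

section

variable {t : ℝ} {τ : ℂ}

lemma exp_zpow (x : ℝ) (n : ℤ) : Real.exp x ^ n = Real.exp (n * x) := by
  rw [← Real.rpow_intCast, ← Real.exp_mul, mul_comm]

lemma one_sub_le_norm_of_pos (hτ : 0 < τ.im) (t : ℝ) {n : ℤ} (hn : 0 < n) :
    1 - ‖cexp (2 * π * I * τ)‖ ≤ ‖1 - cexp (2 * π * I * t) * cexp (2 * π * I * τ) ^ n‖ := by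
  have h1 := norm_sub_norm_le (1 : ℂ) (cexp (2 * π * I * t) * cexp (2 * π * I * τ) ^ n)
  rw [norm_mul, norm_cexp_ofReal, norm_zpow, one_mul, norm_one] at h1
  have h2 : ‖cexp (2 * π * I * τ)‖ ^ n ≤ ‖cexp (2 * π * I * τ)‖ := by
    lift n to ℕ using hn.le
    rw [zpow_natCast]
    exact pow_le_of_le_one (norm_nonneg _) (norm_nome_lt_one hτ).le (by omega)
  linarith

lemma one_sub_le_norm_of_neg (hτ : 0 < τ.im) (t : ℝ) {n : ℤ} (hn : n < 0) :
    ‖cexp (2 * π * I * τ)‖ ^ n * (1 - ‖cexp (2 * π * I * τ)‖) ≤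
      ‖1 - cexp (2 * π * I * t) * cexp (2 * π * I * τ) ^ n‖ := by
  have hq : cexp (2 * π * I * τ) ^ n ≠ 0 := zpow_ne_zero _ (Complex.exp_ne_zero _)
  have key : 1 - cexp (2 * π * I * t) * cexp (2 * π * I * τ) ^ n =
      -(cexp (2 * π * I * t) * cexp (2 * π * I * τ) ^ n *
        (1 - cexp (2 * π * I * (-t : ℝ)) * cexp (2 * π * I * τ) ^ (-n))) := by
    have h1 : cexp (2 * π * I * t) * cexp (2 * π * I * (-t : ℝ)) = 1 := by
      rw [← Complex.exp_add]; simp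
    rw [zpow_neg]
    have h2 := mul_inv_cancel₀ hq
    linear_combination -(cexp (2 * π * I * τ) ^ n * (cexp (2 * π * I * τ) ^ n)⁻¹) * h1 - h2
  rw [key, norm_neg, norm_mul, norm_mul, norm_cexp_ofReal, one_mul, norm_zpow]
  exact mul_le_mul_of_nonneg_left (one_sub_le_norm_of_pos hτ (-t) (by omega)) (by positivity)

/-- For `n ≠ 0` the modulus of `z q^n` stays away from `1` by at least `1 - |q|`, and for `n = 0`
the condition on `t` keeps `z` away from `1`. One bound for all `n` lets the theta coefficients
control every series below. -/
lemma exists_le_norm_one_sub (hτ : 0 < τ.im) (ht : t ∈ Set.Ioo (0 : ℝ) 1) :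
    ∃ δ : ℝ, 0 < δ ∧ ∀ n : ℤ, δ ≤ ‖1 - cexp (2 * π * I * t) * cexp (2 * π * I * τ) ^ n‖ := by
  have hq1 := norm_nome_lt_one hτ
  have hq0 : 0 < ‖cexp (2 * π * I * τ)‖ := norm_pos_iff.2 (Complex.exp_ne_zero _)
  have h0 : 0 < ‖1 - cexp (2 * π * I * t)‖ :=
    norm_pos_iff.2 (sub_ne_zero.2 (cexp_ne_one_of_mem_Ioo ht).symm)
  refine ⟨min (1 - ‖cexp (2 * π * I * τ)‖) ‖1 - cexp (2 * π * I * t)‖,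
    lt_min (by linarith) h0, fun n => ?_⟩
  rcases lt_trichotomy n 0 with hn | rfl | hn
  · refine (min_le_left _ _).trans (le_trans ?_ (one_sub_le_norm_of_neg hτ t hn))
    refine le_mul_of_one_le_left (by linarith) ?_
    have := one_le_zpow_of_nonpos₀ hq0 hq1.le hn.le
    exact this
  · simp
  · exact (min_le_left _ _).trans (one_sub_le_norm_of_pos hτ t hn)

lemma one_sub_ne_zero (hτ : 0 < τ.im) (ht : t ∈ Set.Ioo (0 : ℝ) 1) (n : ℤ) :
    1 - cexp (2 * π * I * t) * cexp (2 * π * I * τ) ^ n ≠ 0 := by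
  obtain ⟨δ, hδ, h⟩ := exists_le_norm_one_sub hτ ht
  exact norm_pos_iff.1 (hδ.trans_le (h n))

/-- Convergence at `+∞` is that of `∑ |w|^n`, which uses `Im α > 0`. At `-∞` the denominator grows
like `|q|^n`, which leaves a geometric series of ratio `|q / w|` and uses `Im α < Im τ`. -/
lemma summable_appell (hτ : 0 < τ.im) (ht : t ∈ Set.Ioo (0 : ℝ) 1) {α : ℂ} (h0 : 0 < α.im)
    (h1 : α.im < τ.im) :
    Summable fun n : ℤ => ‖cexp (2 * π * I * n * α) /
      (1 - cexp (2 * π * I * t) * cexp (2 * π * I * τ) ^ n)‖ := by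
  obtain ⟨δ, hδ, h⟩ := exists_le_norm_one_sub hτ ht
  have hw : ∀ n : ℤ, ‖cexp (2 * π * I * n * α)‖ = Real.exp (-(2 * π * α.im)) ^ n := by
    intro n
    rw [Complex.norm_exp, exp_zpow]
    congr 1
    simp
    ring
  have hpi := Real.pi_pos
  have hq := norm_nome_lt_one hτ
  refine Summable.of_nat_of_neg_add_one ?_ ?_
  · refine Summable.of_nonneg_of_le (fun _ => norm_nonneg _) (fun n => ?_)
      ((summable_geometric_of_lt_one (Real.exp_pos _).le (?_ : Real.exp (-(2 * π * α.im)) < 1)).mul_right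
        δ⁻¹)
    · rw [norm_div, hw, zpow_natCast, div_eq_mul_inv]
      gcongr
      exact h _
    · rw [Real.exp_lt_one_iff]
      have : 0 < 2 * π * α.im := by positivity
      linarith
  · have hr : Real.exp (-(2 * π * (τ.im - α.im))) < 1 := by
      rw [Real.exp_lt_one_iff]
      have : 0 < 2 * π * (τ.im - α.im) := by
        have : 0 < τ.im - α.im := by linarith
        positivity
      linarith
    refine Summable.of_nonneg_of_le (fun _ => norm_nonneg _) (fun n => ?_)
      (((summable_nat_add_iff 1).2
        (summable_geometric_of_lt_one (Real.exp_pos _).le hr)).mul_right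
          (1 - ‖cexp (2 * π * I * τ)‖)⁻¹)
    have h3 := one_sub_le_norm_of_neg hτ t (n := -((n : ℤ) + 1)) (by omega)
    rw [norm_div, hw]
    have h4 : Real.exp (-(2 * π * α.im)) ^ (-((n : ℤ) + 1)) =
        ‖cexp (2 * π * I * τ)‖ ^ (-((n : ℤ) + 1)) *
          Real.exp (-(2 * π * (τ.im - α.im))) ^ (n + 1) := by
      rw [norm_nome, exp_zpow, exp_zpow, ← Real.exp_nat_mul, ← Real.exp_add]
      congr 1
      push_cast
      ring
    have hpos : 0 < ‖cexp (2 * π * I * τ)‖ ^ (-((n : ℤ) + 1)) :=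
      zpow_pos (norm_pos_iff.2 (Complex.exp_ne_zero _)) _
    have h5 : 0 < 1 - ‖cexp (2 * π * I * τ)‖ := by linarith
    rw [h4, div_le_iff₀ (lt_of_lt_of_le (by positivity) h3)]
    calc _ = Real.exp (-(2 * π * (τ.im - α.im))) ^ (n + 1) * (1 - ‖cexp (2 * π * I * τ)‖)⁻¹ *
          (‖cexp (2 * π * I * τ)‖ ^ (-((n : ℤ) + 1)) * (1 - ‖cexp (2 * π * I * τ)‖)) := by
          field_simp
      _ ≤ _ := by gcongr

/-- The coefficient of `w^(N + 1/2)` in the product of the Appell series and the theta function. -/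
def appellTheta (t : ℝ) (τ : ℂ) (N : ℤ) : ℂ :=
  ∑' n : ℤ, thetaCoeff τ (N - n) / (1 - cexp (2 * π * I * t) * cexp (2 * π * I * τ) ^ n)

lemma summable_appellTheta (hτ : 0 < τ.im) (ht : t ∈ Set.Ioo (0 : ℝ) 1) (N : ℤ) :
    Summable fun n : ℤ =>
      thetaCoeff τ (N - n) / (1 - cexp (2 * π * I * t) * cexp (2 * π * I * τ) ^ n) := by
  obtain ⟨δ, hδ, h⟩ := exists_le_norm_one_sub hτ ht
  have hs : Summable fun n : ℤ => ‖thetaCoeff τ (N - n)‖ :=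
    (Equiv.subLeft N).summable_iff.2 (summable_thetaCoeff hτ).norm
  refine Summable.of_norm_bounded (hs.mul_right δ⁻¹) fun n => ?_
  rw [norm_div, div_eq_mul_inv]
  gcongr
  exact h n

lemma summable_comp_sub_left {f : ℤ → ℂ} (hf : Summable f) (N : ℤ) :
    Summable fun n => f (N - n) :=
  (Equiv.subLeft N).summable_iff.2 hf

lemma tsum_comp_sub_left (f : ℤ → ℂ) (N : ℤ) : ∑' n, f (N - n) = ∑' n, f n :=
  (Equiv.subLeft N).tsum_eq f

/-- Write `1 / (1 - y) = 1 + y / (1 - y)` with `y = z q^n`. The theta recursion turns `y` times the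
shifted coefficient into `-z q^{N+1}` times the unshifted one, while the contribution of the `1`
sums to `θ(0) = 0`. -/
lemma appellTheta_succ (hτ : 0 < τ.im) (ht : t ∈ Set.Ioo (0 : ℝ) 1) (N : ℤ) :
    appellTheta t τ (N + 1) =
      -(cexp (2 * π * I * t) * cexp (2 * π * I * τ) ^ (N + 1)) * appellTheta t τ N := by
  have hterm : ∀ n : ℤ,
      thetaCoeff τ (N + 1 - n) / (1 - cexp (2 * π * I * t) * cexp (2 * π * I * τ) ^ n) =
      thetaCoeff τ (N + 1 - n) + -(cexp (2 * π * I * t) * cexp (2 * π * I * τ) ^ (N + 1)) *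
        (thetaCoeff τ (N - n) / (1 - cexp (2 * π * I * t) * cexp (2 * π * I * τ) ^ n)) := by
    intro n
    have h1 := one_sub_ne_zero hτ ht n
    have h2 := thetaCoeff_succ τ (N - n)
    rw [show N - n + 1 = N + 1 - n by ring, zpow_sub₀ (Complex.exp_ne_zero _)] at h2
    rw [h2]
    have h3 : cexp (2 * π * I * τ) ^ n ≠ 0 := zpow_ne_zero _ (Complex.exp_ne_zero _)
    generalize cexp (2 * π * I * τ) ^ n = Q at *
    generalize cexp (2 * π * I * t) = z at *
    rw [div_eq_iff h1, add_mul, mul_assoc _ (_ / _), div_mul_cancel₀ _ h1]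
    field_simp
    ring
  have hs : Summable fun n : ℤ => thetaCoeff τ (N + 1 - n) :=
    summable_comp_sub_left (summable_thetaCoeff hτ) _
  have h0 : ∑' n : ℤ, thetaCoeff τ (N + 1 - n) = 0 :=
    (tsum_comp_sub_left _ _).trans (tsum_thetaCoeff τ)
  calc appellTheta t τ (N + 1) = ∑' n : ℤ, (thetaCoeff τ (N + 1 - n) +
        -(cexp (2 * π * I * t) * cexp (2 * π * I * τ) ^ (N + 1)) *
        (thetaCoeff τ (N - n) / (1 - cexp (2 * π * I * t) * cexp (2 * π * I * τ) ^ n))) :=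
        tsum_congr hterm
    _ = _ := by
      rw [hs.tsum_add ((summable_appellTheta hτ ht N).mul_left _), h0, zero_add, tsum_mul_left]
      rfl

/-- Both sequences solve the same first-order recursion in `N`, hence are proportional; the
exponential factor is the inverse of `thetaCoeff τ 0`. -/
lemma appellTheta_eq (hτ : 0 < τ.im) (ht : t ∈ Set.Ioo (0 : ℝ) 1) (N : ℤ) :
    appellTheta t τ N = appellTheta t τ 0 * cexp (-(π * I * τ / 4)) *
      (thetaCoeff τ N * cexp (2 * π * I * N * t)) := by
  have hstep : ∀ N : ℤ, thetaCoeff τ (N + 1) * cexp (2 * π * I * (N + 1 : ℤ) * t) =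
      -(cexp (2 * π * I * t) * cexp (2 * π * I * τ) ^ (N + 1)) *
        (thetaCoeff τ N * cexp (2 * π * I * N * t)) := by
    intro N
    rw [thetaCoeff_succ, show (2 * π * I * (N + 1 : ℤ) * t : ℂ) =
      2 * π * I * N * t + 2 * π * I * t by push_cast; ring, Complex.exp_add]
    ring
  induction N using Int.induction_on with
  | zero =>
    have : cexp (-(π * I * τ / 4)) * thetaCoeff τ 0 = 1 := by
      rw [thetaCoeff, zpow_zero, one_mul, ← Complex.exp_add, Complex.exp_eq_one_iff]
      exact ⟨0, by push_cast; ring⟩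
    simp only [Int.cast_zero, mul_zero, zero_mul, Complex.exp_zero, mul_one]
    rw [mul_assoc, this, mul_one]
  | succ i ih =>
    rw [appellTheta_succ hτ ht, ih, hstep]
    ring
  | pred i ih =>
    have h1 := appellTheta_succ hτ ht (-(i : ℤ) - 1)
    have h2 := hstep (-(i : ℤ) - 1)
    have hne : -(cexp (2 * π * I * t) * cexp (2 * π * I * τ) ^ (-(i : ℤ) - 1 + 1)) ≠ 0 :=
      neg_ne_zero.2 (mul_ne_zero (Complex.exp_ne_zero _)
        (zpow_ne_zero _ (Complex.exp_ne_zero _)))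
    apply mul_left_cancel₀ hne
    rw [← h1]
    rw [show -(i : ℤ) - 1 + 1 = -i by ring] at h2 ⊢
    rw [ih, h2]
    ring

/-- The product of the Appell series with the theta function is a multiple of a translate of the
theta function. -/
lemma exists_appell_mul_theta (hτ : 0 < τ.im) (ht : t ∈ Set.Ioo (0 : ℝ) 1) :
    ∃ c : ℂ, ∀ α : ℂ, 0 < α.im → α.im < τ.im →
      appell t τ α * theta α τ = c * theta (t + α) τ := by
  -- The last factor converts `e^{2πiNt}` into the `e^{2πi(N + 1/2)t}` of the theta series.
  refine ⟨appellTheta t τ 0 * cexp (-(π * I * τ / 4)) * cexp (-(π * I * t)), fun α h0 h1 => ?_⟩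
  have hs1 := summable_appell hτ ht h0 h1
  have hs2 := (summable_theta_term hτ α).norm
  rw [appell, theta_eq_tsum α, tsum_mul_tsum_of_summable_norm hs1 hs2]
  have hs := summable_mul_of_summable_norm hs1 hs2
  -- Reindexing of the double sum by total exponent: `(N, n)` corresponds to the `n`-th Appell term
  -- times the `(N - n)`-th theta term.
  let e : ℤ × ℤ ≃ ℤ × ℤ :=
    { toFun := fun p => (p.2, p.1 - p.2)
      invFun := fun p => (p.1 + p.2, p.1)
      left_inv := fun p => by ext <;> simp
      right_inv := fun p => by ext <;> simp }
  rw [← e.tsum_eq]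
  refine ((e.summable_iff.2 hs).tsum_prod).trans ?_
  rw [ theta_eq_tsum, ← tsum_mul_left]
  refine tsum_congr fun N => ?_
  have : ∀ n : ℤ, (cexp (2 * π * I * n * α) /
        (1 - cexp (2 * π * I * t) * cexp (2 * π * I * τ) ^ n)) *
      (thetaCoeff τ (N - n) * cexp (2 * π * I * (((N - n : ℤ) : ℂ) + 1 / 2) * α)) =
      cexp (2 * π * I * ((N : ℂ) + 1 / 2) * α) *
      (thetaCoeff τ (N - n) / (1 - cexp (2 * π * I * t) * cexp (2 * π * I * τ) ^ n)) := by
    intro n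
    rw [show (2 * π * I * ((N : ℂ) + 1 / 2) * α : ℂ) =
      2 * π * I * n * α + 2 * π * I * (((N - n : ℤ) : ℂ) + 1 / 2) * α by push_cast; ring,
      Complex.exp_add]
    ring
  simp only [e, Equiv.coe_fn_mk, Function.comp_apply, this, tsum_mul_left]
  have h3 := appellTheta_eq hτ ht N
  rw [appellTheta] at h3
  rw [h3, show (2 * π * I * ((N : ℂ) + 1 / 2) * (t + α) : ℂ) =
    2 * π * I * ((N : ℂ) + 1 / 2) * α + 2 * π * I * N * t + π * I * t by ring,
    Complex.exp_add, Complex.exp_add, Complex.exp_neg (π * I * t)]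
  have := Complex.exp_ne_zero (π * I * t)
  field_simp

end

end EllMZV

end

noncomputable section

namespace EllMZV

open Complex Filter Topology
open scoped Real

/-! ### Double series in powers of the nome -/

/-- Since `(m+1)(k+1) ≥ m + (k+1)`, the terms are dominated by a product of two geometric series of
ratios `r` and `rρ`. -/
lemma summable_lambert {r ρ : ℝ} (hr0 : 0 ≤ r) (hr : r < 1) (hρ0 : 0 ≤ ρ) (hρ : r * ρ < 1) :
    Summable fun p : ℕ × ℕ => r ^ ((p.1 + 1) * (p.2 + 1)) * ρ ^ (p.2 + 1) := by
  have h := (summable_geometric_of_lt_one hr0 hr).mul_of_nonneg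
    ((summable_nat_add_iff 1).2 (summable_geometric_of_lt_one (mul_nonneg hr0 hρ0) hρ))
    (fun _ => pow_nonneg hr0 _) (fun _ => pow_nonneg (mul_nonneg hr0 hρ0) _)
  refine Summable.of_nonneg_of_le (fun p => by positivity) (fun p => ?_) h
  rw [mul_pow, ← mul_assoc, ← pow_add]
  gcongr ?_ * _
  exact pow_le_pow_of_le_one hr0 hr.le (by nlinarith [Nat.zero_le (p.1 * p.2)])

lemma hasSum_tsum_comm {β : Type*} {f : β → ℕ → ℂ}
    (h : Summable fun x : β × ℕ => ‖f x.1 x.2‖) :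
    HasSum (fun j => ∑' b, f b j) (∑' b, ∑' j, f b j) := by
  have hf : Summable fun x : β × ℕ => f x.1 x.2 := h.of_norm
  have h1 : Summable fun x : ℕ × β => f x.2 x.1 := hf.prod_symm
  have h2 : Summable (Function.uncurry f) := hf
  rw [← h2.tsum_comm]
  exact h1.prod.hasSum

lemma hasSum_pow_div_factorial (x : ℂ) : HasSum (fun j : ℕ => x ^ j / j.factorial) (cexp x) := by
  rw [Complex.exp_eq_exp_ℂ]
  exact NormedSpace.expSeries_div_hasSum_exp x

lemma hasSum_pow_div_factorial_real (x : ℝ) :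
    HasSum (fun j : ℕ => x ^ j / j.factorial) (Real.exp x) := by
  rw [Real.exp_eq_exp_ℝ]
  exact NormedSpace.expSeries_div_hasSum_exp x

lemma summable_lambert_exp {r x : ℝ} (hr0 : 0 ≤ r) (hr : r < 1) (hx0 : 0 ≤ x)
    (hx : r * Real.exp x < 1) :
    Summable fun y : (ℕ × ℕ) × ℕ => r ^ ((y.1.1 + 1) * (y.1.2 + 1)) *
      ((((y.1.2 + 1 : ℕ) : ℝ) * x) ^ y.2 / y.2.factorial) := by
  rw [summable_prod_of_nonneg]
  · have h : ∀ p : ℕ × ℕ, HasSum (fun j : ℕ => r ^ ((p.1 + 1) * (p.2 + 1)) *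
        ((((p.2 + 1 : ℕ) : ℝ) * x) ^ j / j.factorial))
        (r ^ ((p.1 + 1) * (p.2 + 1)) * Real.exp x ^ (p.2 + 1)) := fun p => by
      rw [← Real.exp_nat_mul]
      exact (hasSum_pow_div_factorial_real _).mul_left _
    exact ⟨fun p => (h p).summable, (summable_lambert hr0 hr (Real.exp_pos x).le hx).congr
      fun p => (h p).tsum_eq.symm⟩
  · intro y
    exact mul_nonneg (pow_nonneg hr0 _)
      (div_nonneg (pow_nonneg (mul_nonneg (Nat.cast_nonneg _) hx0) _) (Nat.cast_nonneg _))

lemma norm_lambert_exp_term_le {Q x : ℂ} {a : ℕ × ℕ → ℂ} (ha : ∀ p, ‖a p‖ ≤ 1) (p : ℕ × ℕ)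
    (j : ℕ) :
    ‖Q ^ ((p.1 + 1) * (p.2 + 1)) * (a p * ((((p.2 + 1 : ℕ) : ℂ) * x) ^ j / j.factorial))‖ ≤
      ‖Q‖ ^ ((p.1 + 1) * (p.2 + 1)) * ((((p.2 + 1 : ℕ) : ℝ) * ‖x‖) ^ j / j.factorial) := by
  rw [norm_mul, norm_pow, norm_mul, norm_div, norm_pow, norm_mul, Complex.norm_natCast,
    Complex.norm_natCast]
  exact mul_le_mul_of_nonneg_left (mul_le_of_le_one_left (by positivity) (ha p)) (by positivity)

lemma summable_lambert_exp_complex {Q x : ℂ} {a : ℕ × ℕ → ℂ} (ha : ∀ p, ‖a p‖ ≤ 1) (hQ : ‖Q‖ < 1)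
    (hx : ‖Q‖ * Real.exp ‖x‖ < 1) :
    Summable fun y : (ℕ × ℕ) × ℕ => ‖Q ^ ((y.1.1 + 1) * (y.1.2 + 1)) *
      (a y.1 * ((((y.1.2 + 1 : ℕ) : ℂ) * x) ^ y.2 / y.2.factorial))‖ :=
  Summable.of_nonneg_of_le (fun _ => norm_nonneg _)
    (fun y => norm_lambert_exp_term_le ha y.1 y.2)
    (summable_lambert_exp (norm_nonneg Q) hQ (norm_nonneg x) hx)

lemma hasSum_lambert_exp {Q x : ℂ} {a : ℕ × ℕ → ℂ} (ha : ∀ p, ‖a p‖ ≤ 1) (hQ : ‖Q‖ < 1)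
    (hx : ‖Q‖ * Real.exp ‖x‖ < 1) :
    HasSum (fun j : ℕ => ∑' p : ℕ × ℕ, Q ^ ((p.1 + 1) * (p.2 + 1)) *
        (a p * ((((p.2 + 1 : ℕ) : ℂ) * x) ^ j / j.factorial)))
      (∑' p : ℕ × ℕ, Q ^ ((p.1 + 1) * (p.2 + 1)) * (a p * cexp x ^ (p.2 + 1))) := by
  have h := hasSum_tsum_comm (f := fun (p : ℕ × ℕ) j => Q ^ ((p.1 + 1) * (p.2 + 1)) *
        (a p * ((((p.2 + 1 : ℕ) : ℂ) * x) ^ j / j.factorial)))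
    (summable_lambert_exp_complex ha hQ hx)
  have h2 : ∀ p : ℕ × ℕ, ∑' j : ℕ, Q ^ ((p.1 + 1) * (p.2 + 1)) *
        (a p * ((((p.2 + 1 : ℕ) : ℂ) * x) ^ j / j.factorial)) =
      Q ^ ((p.1 + 1) * (p.2 + 1)) * (a p * cexp x ^ (p.2 + 1)) := by
    intro p
    rw [(((hasSum_pow_div_factorial _).mul_left _).mul_left _).tsum_eq, Complex.exp_nat_mul]
  simpa only [h2] using h

/-- The factor `(k+1)^j` is absorbed by an exponential: choose `x > 0` with `|Q| e^x < 1` and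
compare with the single term `((k+1)x)^j / j!` of the series of `e^{(k+1)x}`. -/
lemma summable_nome_pow {Q : ℂ} (hQ : ‖Q‖ < 1) {a : ℕ × ℕ → ℂ} {C : ℝ} (ha : ∀ p, ‖a p‖ ≤ C)
    (j : ℕ) :
    Summable fun p : ℕ × ℕ => Q ^ ((p.1 + 1) * (p.2 + 1)) * (((p.2 + 1 : ℕ) : ℂ) ^ j * a p) := by
  have hr : 0 < (1 + ‖Q‖) / 2 := by have := norm_nonneg Q; linarith
  have hx : ∃ x : ℝ, 0 < x ∧ ‖Q‖ * Real.exp x < 1 := by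
    have : Tendsto (fun x => ‖Q‖ * Real.exp x) (𝓝[>] 0) (𝓝 (‖Q‖ * Real.exp 0)) :=
      ((continuous_const.mul Real.continuous_exp).tendsto 0).mono_left nhdsWithin_le_nhds
    rw [Real.exp_zero, mul_one] at this
    obtain ⟨x, hx1, hx2⟩ := ((this.eventually (gt_mem_nhds hQ)).and self_mem_nhdsWithin).exists
    exact ⟨x, hx2, hx1⟩
  obtain ⟨x, hx0, hx⟩ := hx
  have h := (summable_lambert_exp (norm_nonneg Q) hQ hx0.le hx).comp_injective
    (i := fun p : ℕ × ℕ => (p, j)) (fun a b h => (Prod.mk.inj h).1)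
  refine Summable.of_norm_bounded (h.mul_left (C * j.factorial / x ^ j)) fun p => ?_
  have hC : 0 ≤ C := (norm_nonneg _).trans (ha p)
  rw [norm_mul, norm_mul, norm_pow, norm_pow, Complex.norm_natCast]
  simp only [Function.comp_apply]
  calc _ ≤ ‖Q‖ ^ ((p.1 + 1) * (p.2 + 1)) * (((p.2 + 1 : ℕ) : ℝ) ^ j * C) := by
        gcongr; exact ha p
    _ = _ := by
        have : ((j.factorial : ℕ) : ℝ) ≠ 0 := by positivity
        rw [mul_pow]
        field_simp

/-- The coefficient of `(2πiα)^j` in the part of the Kronecker function given by the double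
series in powers of `q`. -/
def trigCoeff (τ : ℂ) (j : ℕ) (t : ℝ) : ℂ :=
  -(2 * π * I) * ∑' p : ℕ × ℕ, cexp (2 * π * I * τ) ^ ((p.1 + 1) * (p.2 + 1)) *
    (((p.2 + 1 : ℕ) : ℂ) ^ j * ((cexp (2 * π * I * t) ^ (p.1 + 1) -
      (-1) ^ j * (cexp (2 * π * I * t))⁻¹ ^ (p.1 + 1)) / j.factorial))

/-- The double series `∑ q^(mk) (z^m w^k - z^(-m) w^(-k))` over `m, k ≥ 1`. -/
def lambert (q z w : ℂ) : ℂ :=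
  ∑' p : ℕ × ℕ, q ^ ((p.1 + 1) * (p.2 + 1)) *
    (z ^ (p.1 + 1) * w ^ (p.2 + 1) - z⁻¹ ^ (p.1 + 1) * w⁻¹ ^ (p.2 + 1))

lemma norm_nome_mul_exp_lt_one {τ : ℂ} {x : ℝ} (hx : x < τ.im) :
    ‖cexp (2 * π * I * τ)‖ * Real.exp (2 * π * x) < 1 := by
  rw [norm_nome, ← Real.exp_add, Real.exp_lt_one_iff]
  nlinarith [Real.pi_pos]

lemma norm_two_pi_I_mul (α : ℂ) : ‖2 * π * I * α‖ = 2 * π * ‖α‖ := by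
  simp [abs_of_pos Real.pi_pos]

lemma summable_lambert_pos {q z w : ℂ} (hq : ‖q‖ < 1) (hz : ‖z‖ = 1) (hw : ‖q‖ * ‖w‖ < 1) :
    Summable fun p : ℕ × ℕ => q ^ ((p.1 + 1) * (p.2 + 1)) * (z ^ (p.1 + 1) * w ^ (p.2 + 1)) := by
  refine Summable.of_norm_bounded (summable_lambert (norm_nonneg _) hq (norm_nonneg w) hw)
    fun p => ?_
  rw [norm_mul, norm_pow, norm_mul, norm_pow, hz, one_pow, one_mul, norm_pow]

/-- Expand `w^k` and `w^{-k}` in powers of `α` and interchange the sums. The interchange is absolute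
because `|q| e^{2π|α|} < 1` when `|α| < Im τ`. -/
lemma hasSum_trigCoeff {τ : ℂ} (hτ : 0 < τ.im) (t : ℝ) {α : ℂ} (hα : ‖α‖ < τ.im) :
    HasSum (fun j => (2 * π * I * α) ^ j * trigCoeff τ j t)
      (-(2 * π * I) * lambert (cexp (2 * π * I * τ)) (cexp (2 * π * I * t))
        (cexp (2 * π * I * α))) := by
  have hQ := norm_nome_lt_one hτ
  have hx : ‖cexp (2 * π * I * τ)‖ * Real.exp ‖2 * π * I * α‖ < 1 := by
    rw [norm_two_pi_I_mul]; exact norm_nome_mul_exp_lt_one hα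
  have hx' : ‖cexp (2 * π * I * τ)‖ * Real.exp ‖-(2 * π * I * α)‖ < 1 := by
    rwa [norm_neg]
  rw [lambert, ← Complex.exp_neg (2 * π * I * α)]
  have hz : ‖cexp (2 * π * I * t)‖ = 1 := norm_cexp_ofReal t
  have ha : ∀ p : ℕ × ℕ, ‖cexp (2 * π * I * t) ^ (p.1 + 1)‖ ≤ 1 := fun p => by
    rw [norm_pow, hz, one_pow]
  have ha' : ∀ p : ℕ × ℕ, ‖(cexp (2 * π * I * t))⁻¹ ^ (p.1 + 1)‖ ≤ 1 := fun p => by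
    rw [norm_pow, norm_inv, hz, inv_one, one_pow]
  have h1 := hasSum_lambert_exp ha hQ hx
  have h2 := hasSum_lambert_exp ha' hQ hx'
  have s1 : ∀ j : ℕ, Summable fun p : ℕ × ℕ => cexp (2 * π * I * τ) ^ ((p.1 + 1) * (p.2 + 1)) *
      (cexp (2 * π * I * t) ^ (p.1 + 1) *
        ((((p.2 + 1 : ℕ) : ℂ) * (2 * π * I * α)) ^ j / j.factorial)) := fun j =>
    (summable_lambert_exp_complex ha hQ hx).of_norm.comp_injective
      (i := fun p : ℕ × ℕ => (p, j)) (fun a b h => (Prod.mk.inj h).1)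
  have s2 : ∀ j : ℕ, Summable fun p : ℕ × ℕ => cexp (2 * π * I * τ) ^ ((p.1 + 1) * (p.2 + 1)) *
      ((cexp (2 * π * I * t))⁻¹ ^ (p.1 + 1) *
        ((((p.2 + 1 : ℕ) : ℂ) * -(2 * π * I * α)) ^ j / j.factorial)) := fun j =>
    (summable_lambert_exp_complex ha' hQ hx').of_norm.comp_injective
      (i := fun p : ℕ × ℕ => (p, j)) (fun a b h => (Prod.mk.inj h).1)
  have t1 := summable_lambert_pos (w := cexp (2 * π * I * α)) hQ hz
    (lt_of_le_of_lt (by gcongr; exact Complex.norm_exp_le_exp_norm _) hx)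
  have t2 := summable_lambert_pos (z := (cexp (2 * π * I * t))⁻¹) (w := cexp (-(2 * π * I * α))) hQ
    (by rw [norm_inv, hz, inv_one])
    (lt_of_le_of_lt (by gcongr; exact Complex.norm_exp_le_exp_norm _) hx')
  have h3 := (h1.sub h2).mul_left (-(2 * π * I))
  rw [← t1.tsum_sub t2] at h3
  simp only [← mul_sub] at h3
  refine h3.congr_fun fun j => ?_
  rw [trigCoeff, mul_left_comm, ← tsum_mul_left, ← (s1 j).tsum_sub (s2 j)]
  congr 1
  refine tsum_congr fun p => ?_
  rw [mul_pow _ (2 * π * I * α) j, mul_pow _ (-(2 * π * I * α)) j, neg_pow (2 * π * I * α)]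
  ring

/-! ### The Lambert expansion of the Appell-type series -/

lemma hasSum_geometric_shift {x : ℂ} (hx : ‖x‖ < 1) :
    HasSum (fun m : ℕ => x ^ (m + 1)) (x / (1 - x)) := by
  simpa [pow_succ', div_eq_mul_inv] using (hasSum_geometric_of_norm_lt_one hx).mul_left x

lemma lambert_pos (q z w : ℂ) (n : ℕ) (h : ‖z * q ^ (n + 1)‖ < 1) :
    w ^ (n + 1) / (1 - z * q ^ (n + 1)) = w ^ (n + 1) +
      ∑' m : ℕ, q ^ ((m + 1) * (n + 1)) * (z ^ (m + 1) * w ^ (n + 1)) := by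
  have e : ∀ m : ℕ, q ^ ((m + 1) * (n + 1)) * (z ^ (m + 1) * w ^ (n + 1)) =
      w ^ (n + 1) * (z * q ^ (n + 1)) ^ (m + 1) := by
    intro m
    rw [mul_pow, ← pow_mul, mul_comm (n + 1)]
    ring
  have hne : 1 - z * q ^ (n + 1) ≠ 0 := by
    intro h0
    rw [← sub_eq_zero.1 h0, norm_one] at h
    exact lt_irrefl _ h
  simp only [e, tsum_mul_left, (hasSum_geometric_shift h).tsum_eq]
  generalize z * q ^ (n + 1) = x at *
  rw [div_eq_iff hne, add_mul, mul_assoc, div_mul_cancel₀ _ hne]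
  ring

/-- For negative index `z q^n` is large, so the geometric series is taken in its inverse `y`, using
`1 / (1 - y⁻¹) = -y / (1 - y)`. In contrast with positive indices, no leading term is left over. -/
lemma lambert_neg {q z : ℂ} (hq : q ≠ 0) (hz : z ≠ 0) (w : ℂ) (n : ℕ)
    (h : ‖z⁻¹ * q ^ (n + 1)‖ < 1) :
    w⁻¹ ^ (n + 1) / (1 - z * q ^ (-((n : ℤ) + 1))) =
      -∑' m : ℕ, q ^ ((m + 1) * (n + 1)) * (z⁻¹ ^ (m + 1) * w⁻¹ ^ (n + 1)) := by
  have e : ∀ m : ℕ, q ^ ((m + 1) * (n + 1)) * (z⁻¹ ^ (m + 1) * w⁻¹ ^ (n + 1)) =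
      w⁻¹ ^ (n + 1) * (z⁻¹ * q ^ (n + 1)) ^ (m + 1) := by
    intro m
    rw [mul_pow, ← pow_mul, mul_comm (n + 1)]
    ring
  have hne : 1 - z⁻¹ * q ^ (n + 1) ≠ 0 := by
    intro h0
    rw [← sub_eq_zero.1 h0, norm_one] at h
    exact lt_irrefl _ h
  have hx0 : z⁻¹ * q ^ (n + 1) ≠ 0 := mul_ne_zero (inv_ne_zero hz) (pow_ne_zero _ hq)
  have e2 : z * q ^ (-((n : ℤ) + 1)) = (z⁻¹ * q ^ (n + 1))⁻¹ := by
    rw [mul_inv, inv_inv, zpow_neg]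
    norm_cast
  simp only [e, tsum_mul_left, (hasSum_geometric_shift h).tsum_eq]
  rw [e2]
  generalize z⁻¹ * q ^ (n + 1) = x at *
  have : 1 - x⁻¹ ≠ 0 := by
    intro h0
    apply hne
    field_simp at h0
    linear_combination -h0
  rw [div_eq_iff this, ← mul_neg, mul_assoc]
  have : -(x / (1 - x)) * (1 - x⁻¹) = 1 := by
    rw [← neg_div, div_mul_eq_mul_div, div_eq_iff hne]
    field_simp
    ring
  rw [this, mul_one]

lemma tsum_prod_swap {f : ℕ × ℕ → ℂ} (h : Summable f) :
    ∑' p, f p = ∑' n : ℕ, ∑' m : ℕ, f (m, n) :=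
  ((Equiv.prodComm ℕ ℕ).tsum_eq f).symm.trans h.prod_symm.tsum_prod

/-- The index `0` gives `1 / (1 - z)`, the leading terms of the positive indices add up to `w / (1 -
w)`, and the remaining geometric tails form the double series. -/
lemma tsum_appell_eq_lambert {q z w : ℂ} (hq : ‖q‖ < 1) (hq0 : q ≠ 0) (hz : ‖z‖ = 1)
    (hw1 : ‖w‖ < 1) (hqw' : ‖q‖ * ‖w⁻¹‖ < 1)
    (hs : Summable fun n : ℤ => w ^ n / (1 - z * q ^ n)) :
    ∑' n : ℤ, w ^ n / (1 - z * q ^ n) = 1 / (1 - z) + w / (1 - w) + lambert q z w := by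
  have hqw : ‖q‖ * ‖w‖ < 1 := mul_lt_one_of_nonneg_of_lt_one_left (norm_nonneg _) hq hw1.le
  have hz0 : z ≠ 0 := norm_pos_iff.1 (by rw [hz]; exact one_pos)
  have hP := summable_lambert_pos hq hz hqw
  have hN := summable_lambert_pos hq (z := z⁻¹) (by rw [norm_inv, hz, inv_one]) hqw'
  have hqn : ∀ n : ℕ, ‖q ^ (n + 1)‖ < 1 := fun n => by
    rw [norm_pow]; exact pow_lt_one₀ (norm_nonneg _) hq (by omega)
  have hpos : ∀ n : ℕ, w ^ (((n + 1 : ℕ) : ℤ)) / (1 - z * q ^ (((n + 1 : ℕ) : ℤ))) = w ^ (n + 1) +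
      ∑' m : ℕ, q ^ ((m + 1) * (n + 1)) * (z ^ (m + 1) * w ^ (n + 1)) := fun n => by
    rw [zpow_natCast, zpow_natCast]
    exact lambert_pos q z w n (by rw [norm_mul, hz, one_mul]; exact hqn n)
  have hneg : ∀ n : ℕ, w ^ (-((n : ℤ) + 1)) / (1 - z * q ^ (-((n : ℤ) + 1))) =
      -∑' m : ℕ, q ^ ((m + 1) * (n + 1)) * (z⁻¹ ^ (m + 1) * w⁻¹ ^ (n + 1)) := fun n => by
    rw [← lambert_neg hq0 hz0 w n (by rw [norm_mul, norm_inv, hz, inv_one, one_mul]; exact hqn n)]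
    congr 1
    rw [zpow_neg, inv_pow]
    norm_cast
  have hs1 : Summable fun n : ℕ => w ^ (n : ℤ) / (1 - z * q ^ (n : ℤ)) :=
    hs.comp_injective Nat.cast_injective
  have hinj : Function.Injective fun n : ℕ => -((n : ℤ) + 1) := fun a b h => by
    simpa using h
  have hs2 : Summable fun n : ℕ => w ^ (-((n : ℤ) + 1)) / (1 - z * q ^ (-((n : ℤ) + 1))) :=
    hs.comp_injective hinj
  have hP' : Summable fun n : ℕ => ∑' m : ℕ,
      q ^ ((m + 1) * (n + 1)) * (z ^ (m + 1) * w ^ (n + 1)) := hP.prod_symm.prod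
  have e3 : ∑' p : ℕ × ℕ, q ^ ((p.1 + 1) * (p.2 + 1)) * (z ^ (p.1 + 1) * w ^ (p.2 + 1)) =
      ∑' n : ℕ, ∑' m : ℕ, q ^ ((m + 1) * (n + 1)) * (z ^ (m + 1) * w ^ (n + 1)) :=
    tsum_prod_swap hP
  have e4 : ∑' p : ℕ × ℕ, q ^ ((p.1 + 1) * (p.2 + 1)) * (z⁻¹ ^ (p.1 + 1) * w⁻¹ ^ (p.2 + 1)) =
      ∑' n : ℕ, ∑' m : ℕ, q ^ ((m + 1) * (n + 1)) * (z⁻¹ ^ (m + 1) * w⁻¹ ^ (n + 1)) :=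
    tsum_prod_swap hN
  have e5 := tsum_of_nat_of_neg_add_one (f := fun n : ℤ => w ^ n / (1 - z * q ^ n)) hs1 hs2
  have e6 := Summable.tsum_eq_zero_add (f := fun n : ℕ => w ^ (n : ℤ) / (1 - z * q ^ (n : ℤ))) hs1
  beta_reduce at e5 e6
  rw [e5, e6]
  simp only [hpos, hneg]
  rw [Summable.tsum_add (hasSum_geometric_shift hw1).summable hP',
    (hasSum_geometric_shift hw1).tsum_eq, tsum_neg, lambert]
  simp only [mul_sub]
  rw [hP.tsum_sub hN, e3, e4]
  simp only [Nat.cast_zero, zpow_zero, mul_one]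
  ring

lemma appell_eq_lambert {t : ℝ} {τ : ℂ} (hτ : 0 < τ.im) (ht : t ∈ Set.Ioo (0 : ℝ) 1) {α : ℂ}
    (h0 : 0 < α.im) (h1 : α.im < τ.im) :
    appell t τ α = 1 / (1 - cexp (2 * π * I * t)) +
      cexp (2 * π * I * α) / (1 - cexp (2 * π * I * α)) +
      lambert (cexp (2 * π * I * τ)) (cexp (2 * π * I * t)) (cexp (2 * π * I * α)) := by
  have hs := (summable_appell hτ ht h0 h1).of_norm
  have hw : ∀ n : ℤ, cexp (2 * π * I * n * α) = cexp (2 * π * I * α) ^ n := by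
    intro n
    rw [← Complex.exp_int_mul]; congr 1; ring
  have hqw' : ‖cexp (2 * π * I * τ)‖ * ‖(cexp (2 * π * I * α))⁻¹‖ < 1 := by
    have := norm_nome_mul_exp_lt_one h1
    rwa [norm_inv, norm_nome α, ← Real.exp_neg, neg_neg]
  rw [appell]
  simp only [hw] at hs ⊢
  exact tsum_appell_eq_lambert (norm_nome_lt_one hτ) (Complex.exp_ne_zero _) (norm_cexp_ofReal t)
    (norm_nome_lt_one h0) hqw' hs

end EllMZV

end

noncomputable section

namespace EllMZV

open Complex Filter Topology
open scoped Real

/-! ### The Taylor expansion of the Kronecker function -/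

/-- The coefficients in `π cot (πα) = 1/α + ∑ κ_j α^j`. -/
def cotCoeff (j : ℕ) : ℂ := if Odd j then -2 * riemannZeta (j + 1) else 0

lemma cotCoeff_eq_tsum {j : ℕ} :
    cotCoeff j = ∑' n : ℕ, ((-1) ^ j - 1) / ((n + 1 : ℕ) : ℂ) ^ (j + 1) := by
  rw [cotCoeff]
  split_ifs with h
  · have h1 : 1 < j + 1 := by have := h.pos; omega
    have h2 := zeta_nat_eq_tsum_of_gt_one h1
    have hs : Summable fun n : ℕ => 1 / (n : ℂ) ^ (j + 1) := by
      have h3 := (Complex.summable_one_div_nat_cpow (p := ((j + 1 : ℕ) : ℂ))).2 (by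
        rw [Complex.natCast_re]; exact_mod_cast h1)
      simpa only [Complex.cpow_natCast] using h3
    rw [hs.tsum_eq_zero_add] at h2
    push_cast at h2 ⊢
    rw [h2, h.neg_one_pow]
    simp only [div_eq_mul_inv, one_mul]
    rw [tsum_mul_left]
    simp
    norm_num
  · rw [(Nat.not_odd_iff_even.1 h).neg_one_pow]
    simp

lemma hasSum_cotTerm {x : ℂ} (hx : ‖x‖ < 1) (n : ℕ) :
    HasSum (fun j : ℕ => x ^ j * (((-1) ^ j - 1) / ((n + 1 : ℕ) : ℂ) ^ (j + 1)))
      (1 / (x - (n + 1)) + 1 / (x + (n + 1))) := by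
  have hN : ((n : ℂ) + 1) ≠ 0 := by exact_mod_cast Nat.succ_ne_zero n
  have hy : ‖x / (n + 1)‖ < 1 := by
    rw [norm_div]
    have : (1 : ℝ) ≤ ‖(n : ℂ) + 1‖ := by
      rw [show (n : ℂ) + 1 = ((n + 1 : ℕ) : ℂ) by push_cast; ring, Complex.norm_natCast]
      exact_mod_cast Nat.succ_le_succ (Nat.zero_le n)
    rw [div_lt_one (by linarith)]
    linarith
  have h1 := (hasSum_geometric_of_norm_lt_one hy).mul_left (1 / ((n : ℂ) + 1))
  have h2 := (hasSum_geometric_of_norm_lt_one (ξ := -(x / (n + 1))) (by rwa [norm_neg])).mul_left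
    (1 / ((n : ℂ) + 1))
  have hne : ∀ y : ℂ, ‖y‖ < 1 → 1 - y ≠ 0 := fun y hy h => by
    rw [← sub_eq_zero.1 h, norm_one] at hy; exact lt_irrefl _ hy
  have e1 := hne _ hy
  have e2 := hne (-(x / (n + 1))) (by rwa [norm_neg])
  have e3 : x - (n + 1) ≠ 0 := by
    intro h; apply e1; rw [sub_eq_zero.1 h, div_self hN, sub_self]
  have e4 : x + (n + 1) ≠ 0 := by
    intro h; apply e2
    rw [eq_neg_of_add_eq_zero_left h, neg_div, div_self hN]; ring
  have hval : 1 / (x - (n + 1)) + 1 / (x + (n + 1)) = 1 / ((n : ℂ) + 1) * (1 - -(x / (n + 1)))⁻¹ -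
      1 / ((n : ℂ) + 1) * (1 - x / (n + 1))⁻¹ := by
    have e5 : (1 - x / ((n : ℂ) + 1))⁻¹ = (n + 1) / ((n + 1) - x) := by
      rw [one_sub_div hN, inv_div]
    have e6 : (1 - -(x / ((n : ℂ) + 1)))⁻¹ = (n + 1) / ((n + 1) + x) := by
      rw [sub_neg_eq_add, one_add_div hN, inv_div]
    rw [e5, e6]
    have e7 : (n + 1 : ℂ) - x ≠ 0 := by
      intro h; apply e3; linear_combination -h
    have e8 : (n + 1 : ℂ) + x ≠ 0 := by rwa [add_comm] at e4
    field_simp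
    ring
  rw [hval]
  refine (h2.sub h1).congr_fun fun j => ?_
  push_cast
  rw [neg_pow (x / _), div_pow]
  field_simp
  ring

lemma hasSum_cotCoeff {x : ℂ} (hx0 : x ≠ 0) (hx : ‖x‖ < 1) :
    HasSum (fun j : ℕ => x ^ j * cotCoeff j) (π * Complex.cot (π * x) - 1 / x) := by
  have hmem : x ∈ Complex.integerComplement := by
    rw [Complex.mem_integerComplement_iff]
    rintro ⟨n, rfl⟩
    rw [Complex.norm_intCast] at hx
    have h1 : |n| < 1 := by exact_mod_cast hx
    have h2 : n ≠ 0 := by exact_mod_cast hx0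
    have := abs_pos.2 h2
    omega
  rw [cot_series_rep' hmem]
  have hs : Summable fun y : ℕ × ℕ => ‖x ^ y.2 * (((-1) ^ y.2 - 1) / ((y.1 + 1 : ℕ) : ℂ) ^ (y.2 + 1))‖ := by
    have hg : Summable fun n : ℕ => 1 / ((n + 1 : ℕ) : ℝ) ^ 2 :=
      (summable_nat_add_iff 1).2 (Real.summable_one_div_nat_pow.2 one_lt_two)
    have h := (hg.mul_of_nonneg (summable_geometric_of_lt_one (norm_nonneg x) hx)
      (fun _ => by positivity) (fun _ => by positivity)).mul_left 2
    refine Summable.of_nonneg_of_le (fun _ => norm_nonneg _) (fun y => ?_) h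
    obtain ⟨n, j⟩ := y
    rw [norm_mul, norm_div, norm_pow, norm_pow, Complex.norm_natCast]
    rcases Nat.even_or_odd j with hj | hj
    -- Even `j` contributes zero. For odd `j` the exponent `j + 1` is at least `2`, which is what
    -- makes the sum over `n` converge.
    · rw [hj.neg_one_pow]; simp; positivity
    · rw [hj.neg_one_pow, show ‖(-1 : ℂ) - 1‖ = 2 by norm_num]
      have : ((n + 1 : ℕ) : ℝ) ^ 2 ≤ ((n + 1 : ℕ) : ℝ) ^ (j + 1) := by
        apply pow_le_pow_right₀
        · exact_mod_cast Nat.succ_le_succ (Nat.zero_le n)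
        · have := hj.pos; omega
      calc ‖x‖ ^ j * (2 / ((n + 1 : ℕ) : ℝ) ^ (j + 1)) ≤ ‖x‖ ^ j * (2 / ((n + 1 : ℕ) : ℝ) ^ 2) := by
            gcongr
        _ = _ := by ring
  have h := hasSum_tsum_comm
    (f := fun (n j : ℕ) => x ^ j * (((-1) ^ j - 1) / ((n + 1 : ℕ) : ℂ) ^ (j + 1))) hs
  simp only [(hasSum_cotTerm hx _).tsum_eq] at h
  convert h using 1
  ext j
  rw [cotCoeff_eq_tsum, tsum_mul_left]

/-- The coefficient of `α^j` in `F(t, α, τ) - 1/α`. -/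
def kroneckerTaylor (τ : ℂ) (t : ℝ) (j : ℕ) : ℂ :=
  (if j = 0 then (π * Complex.cot (π * t) : ℂ) else 0) + cotCoeff j +
    (2 * π * I) ^ j * trigCoeff τ j t

lemma hasSum_kroneckerTaylor {τ : ℂ} (hτ : 0 < τ.im) (t : ℝ) {α : ℂ} (h0 : α ≠ 0) (h1 : ‖α‖ < 1)
    (h2 : ‖α‖ < τ.im) :
    HasSum (fun j => α ^ j * kroneckerTaylor τ t j)
      (π * Complex.cot (π * t) + (π * Complex.cot (π * α) - 1 / α) -
        2 * π * I * lambert (cexp (2 * π * I * τ)) (cexp (2 * π * I * t))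
          (cexp (2 * π * I * α))) := by
  have h := ((hasSum_ite_eq 0 (π * Complex.cot (π * t) : ℂ)).add (hasSum_cotCoeff h0 h1)).add
    (hasSum_trigCoeff hτ t h2)
  convert h using 1
  · ext j
    rw [kroneckerTaylor, mul_pow _ α]
    split_ifs with hj
    · subst hj; ring
    · ring
  · ring

lemma pi_mul_cot_eq {x : ℂ} (hx : cexp (2 * π * I * x) ≠ 1) :
    π * Complex.cot (π * x) = π * I - 2 * π * I / (1 - cexp (2 * π * I * x)) := by
  rw [Complex.cot_pi_eq_exp_ratio]
  have : 1 - cexp (2 * π * I * x) ≠ 0 := sub_ne_zero.2 hx.symm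
  have hI := Complex.I_ne_zero
  generalize cexp (2 * π * I * x) = E at *
  field_simp
  linear_combination (E + 1) * Complex.I_sq

lemma cexp_ne_one_of_im_pos {α : ℂ} (h : 0 < α.im) : cexp (2 * π * I * α) ≠ 1 := by
  intro h1
  have := norm_nome_lt_one h
  rw [h1, norm_one] at this
  exact lt_irrefl _ this

/-- Since `π cot πx = πi - 2πi / (1 - e^{2πix})`, the two rational terms multiplied by `-2πi` become
`π cot πt + π cot πα` with no constant left over. The pole of the second cotangent is the subtracted
`1/α`. -/
lemma hasSum_appell {τ : ℂ} (hτ : 0 < τ.im) {t : ℝ} (ht : t ∈ Set.Ioo (0 : ℝ) 1) {α : ℂ}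
    (h0 : 0 < α.im) (h1 : ‖α‖ < 1) (h2 : ‖α‖ < τ.im) :
    HasSum (fun j => α ^ j * kroneckerTaylor τ t j) (-(2 * π * I) * appell t τ α - 1 / α) := by
  have hα : α ≠ 0 := by rintro rfl; simp at h0
  convert hasSum_kroneckerTaylor hτ t hα h1 h2 using 1
  rw [appell_eq_lambert hτ ht h0 ((le_abs_self _).trans_lt ((Complex.abs_im_le_norm α).trans_lt h2)),
    pi_mul_cot_eq (cexp_ne_one_of_mem_Ioo ht), pi_mul_cot_eq (cexp_ne_one_of_im_pos h0)]
  have : 1 - cexp (2 * π * I * α) ≠ 0 := sub_ne_zero.2 (cexp_ne_one_of_im_pos h0).symm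
  have e : cexp (2 * π * I * α) / (1 - cexp (2 * π * I * α)) =
      1 / (1 - cexp (2 * π * I * α)) - 1 := by
    field_simp
    ring
  rw [e]
  ring

/-- The Taylor coefficients of `α F(t, α, τ)` at `α = 0`. -/
def kroneckerRegTaylor (τ : ℂ) (t : ℝ) : ℕ → ℂ
  | 0 => 1
  | j + 1 => kroneckerTaylor τ t j

/-- The sum of the Taylor series of `α F(t, α, τ)` at `α = 0`. -/
def kroneckerSeries (τ : ℂ) (t : ℝ) (α : ℂ) : ℂ := ∑' n, α ^ n * kroneckerRegTaylor τ t n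

lemma summable_kroneckerRegTaylor {τ : ℂ} (hτ : 0 < τ.im) (t : ℝ) {α : ℂ} (h1 : ‖α‖ < 1)
    (h2 : ‖α‖ < τ.im) : Summable fun n => α ^ n * kroneckerRegTaylor τ t n := by
  by_cases h0 : α = 0
  · subst h0
    exact summable_of_ne_finset_zero (s := {0}) fun n hn => by
      rw [zero_pow (by simpa using hn), zero_mul]
  · rw [← summable_nat_add_iff 1]
    refine ((hasSum_kroneckerTaylor hτ t h0 h1 h2).summable.mul_left α).congr fun n => ?_
    rw [kroneckerRegTaylor, pow_succ']
    ring

lemma eventually_small {τ : ℂ} (hτ : 0 < τ.im) : ∀ᶠ α : ℂ in 𝓝 0, ‖α‖ < 1 ∧ ‖α‖ < τ.im :=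
  ((continuous_norm.tendsto' (0 : ℂ) 0 norm_zero).eventually (gt_mem_nhds one_pos)).and
    ((continuous_norm.tendsto' (0 : ℂ) 0 norm_zero).eventually (gt_mem_nhds hτ))

lemma hasFPowerSeriesAt_kroneckerSeries {τ : ℂ} (hτ : 0 < τ.im) (t : ℝ) :
    HasFPowerSeriesAt (kroneckerSeries τ t)
      (FormalMultilinearSeries.ofScalars ℂ (kroneckerRegTaylor τ t)) 0 := by
  rw [hasFPowerSeriesAt_iff]
  filter_upwards [eventually_small hτ] with α hα
  rw [zero_add]
  simpa [FormalMultilinearSeries.coeff_ofScalars, kroneckerSeries] using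
    (summable_kroneckerRegTaylor hτ t hα.1 hα.2).hasSum

lemma kroneckerSeries_zero (τ : ℂ) (t : ℝ) : kroneckerSeries τ t 0 = 1 := by
  rw [kroneckerSeries, tsum_eq_single 0 fun n hn => by rw [zero_pow hn, zero_mul]]
  simp [kroneckerRegTaylor]

lemma kroneckerSeries_eq_appell {τ : ℂ} (hτ : 0 < τ.im) {t : ℝ} (ht : t ∈ Set.Ioo (0 : ℝ) 1)
    {α : ℂ} (h0 : 0 < α.im) (h1 : ‖α‖ < 1) (h2 : ‖α‖ < τ.im) :
    kroneckerSeries τ t α = α * (-(2 * π * I) * appell t τ α) := by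
  have hα : α ≠ 0 := by rintro rfl; simp at h0
  have h := (hasSum_appell hτ ht h0 h1 h2).mul_left α
  rw [kroneckerSeries, (summable_kroneckerRegTaylor hτ t h1 h2).tsum_eq_zero_add]
  have e : ∀ n, α ^ (n + 1) * kroneckerRegTaylor τ t (n + 1) =
      α * (α ^ n * kroneckerTaylor τ t n) := fun n => by
    rw [kroneckerRegTaylor, pow_succ']; ring
  simp only [e, h.tsum_eq]
  simp only [kroneckerRegTaylor, pow_zero]
  field_simp
  ring

/-- The Appell series converges only in a strip above the real axis, so `α = 0` lies on its
boundary. Accumulation at `0` is enough for the identity theorem to carry relations across. -/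
lemma frequently_im_pos : ∃ᶠ α : ℂ in 𝓝[≠] 0, 0 < α.im := by
  have h : Tendsto (fun x : ℝ => (x : ℂ) * I) (𝓝[>] 0) (𝓝[≠] 0) := by
    refine tendsto_nhdsWithin_iff.2 ⟨?_, ?_⟩
    · have : Tendsto (fun x : ℝ => (x : ℂ) * I) (𝓝 0) (𝓝 0) :=
        Continuous.tendsto' (by fun_prop) _ _ (by simp)
      exact this.mono_left nhdsWithin_le_nhds
    · filter_upwards [self_mem_nhdsWithin] with x hx
      have : x ≠ 0 := ne_of_gt hx
      simpa using this
  refine h.frequently (Eventually.frequently ?_)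
  filter_upwards [self_mem_nhdsWithin] with x hx
  simpa using hx

/-- Near `α = 0`, the series is a multiple of the quotient of theta functions. -/
lemma exists_kroneckerSeries_mul_theta {τ : ℂ} (hτ : 0 < τ.im) {t : ℝ}
    (ht : t ∈ Set.Ioo (0 : ℝ) 1) :
    ∃ c : ℂ, ∀ᶠ α in 𝓝 0, kroneckerSeries τ t α * theta α τ = α * (c * theta (t + α) τ) := by
  obtain ⟨c, hc⟩ := exists_appell_mul_theta hτ ht
  refine ⟨-(2 * π * I) * c, ?_⟩
  have ha : ∀ f : ℂ → ℂ, Differentiable ℂ f → AnalyticAt ℂ f 0 := fun f hf => hf.analyticAt 0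
  have hth := differentiable_theta hτ
  have hA1 : AnalyticAt ℂ (fun α => kroneckerSeries τ t α * theta α τ) 0 :=
    (hasFPowerSeriesAt_kroneckerSeries hτ t).analyticAt.mul (ha _ hth)
  have hth2 : Differentiable ℂ fun α : ℂ => theta (t + α) τ :=
    hth.comp (differentiable_id.const_add (t : ℂ))
  have hA2 : AnalyticAt ℂ (fun α : ℂ => α * (-(2 * π * I) * c * theta (t + α) τ)) 0 :=
    ha _ (differentiable_id.mul (hth2.const_mul _))
  refine (hA1.frequently_eq_iff_eventually_eq hA2).1 ?_
  refine (frequently_im_pos.and_eventually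
    ((eventually_small hτ).filter_mono nhdsWithin_le_nhds)).mono ?_
  rintro α ⟨h0, h1, h2⟩
  have h3 := hc α h0 ((le_abs_self _).trans_lt ((Complex.abs_im_le_norm α).trans_lt h2))
  rw [kroneckerSeries_eq_appell hτ ht h0 h1 h2]
  linear_combination (-(2 * π * I) * α) * h3

lemma eq_zero_of_eventually_theta {τ : ℂ} (hτ : 0 < τ.im) {z₀ : ℂ}
    (h : ∀ᶠ z in 𝓝 z₀, theta z τ = 0) : False := by
  obtain ⟨ξ, hξ⟩ := exists_theta_ne_zero hτ
  have h1 := AnalyticOnNhd.eq_of_eventuallyEq (f := fun z => theta z τ) (g := fun _ => 0)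
    (fun z _ => (differentiable_theta hτ).analyticAt z) (fun z _ => analyticAt_const) h
  exact hξ (congrFun h1 ξ)

lemma exists_real_theta_ne_zero {τ : ℂ} (hτ : 0 < τ.im) :
    ∃ t ∈ Set.Ioo (0 : ℝ) 1, theta t τ ≠ 0 := by
  by_contra! h
  have hf : ∃ᶠ z : ℂ in 𝓝[≠] (1 / 2 : ℝ), theta z τ = 0 := by
    have ht : Tendsto (fun x : ℝ => (x : ℂ)) (𝓝[≠] (1 / 2)) (𝓝[≠] (((1 / 2 : ℝ)) : ℂ)) := by
      refine tendsto_nhdsWithin_iff.2 ⟨?_, ?_⟩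
      · exact (Complex.continuous_ofReal.tendsto _).mono_left nhdsWithin_le_nhds
      · filter_upwards [self_mem_nhdsWithin] with x hx
        exact fun h => hx (Complex.ofReal_injective h)
    refine ht.frequently (Eventually.frequently ?_)
    have : Set.Ioo (0 : ℝ) 1 ∈ 𝓝 (1 / 2 : ℝ) := Ioo_mem_nhds (by norm_num) (by norm_num)
    filter_upwards [nhdsWithin_le_nhds this] with x hx using h x hx
  exact eq_zero_of_eventually_theta hτ
    ((((differentiable_theta hτ).analyticAt _).frequently_eq_iff_eventually_eq
      analyticAt_const).1 hf)

/-- Differentiate both sides at `α = 0`: the series takes the value `1` and `θ` vanishes there, so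
only `θ'(0)` survives on the left and `c θ(t)` on the right. -/
lemma deriv_theta_eq {τ : ℂ} (hτ : 0 < τ.im) {t : ℝ} {c : ℂ}
    (hc : ∀ᶠ α in 𝓝 0, kroneckerSeries τ t α * theta α τ = α * (c * theta (t + α) τ)) :
    deriv (fun z => theta z τ) 0 = c * theta t τ := by
  have h1 : HasDerivAt (fun α => kroneckerSeries τ t α * theta α τ)
      (deriv (fun z => theta z τ) 0) 0 := by
    have ha := (hasFPowerSeriesAt_kroneckerSeries hτ t).analyticAt.differentiableAt.hasDerivAt.fun_mul
      ((differentiable_theta hτ) 0).hasDerivAt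
    simpa [theta_zero, kroneckerSeries_zero] using ha
  have h2 : HasDerivAt (fun α : ℂ => α * (c * theta (t + α) τ)) (c * theta t τ) 0 := by
    have hth2 : Differentiable ℂ fun α : ℂ => c * theta (t + α) τ :=
      ((differentiable_theta hτ).comp (differentiable_id.const_add (t : ℂ))).const_mul c
    have hb := (hasDerivAt_id' (0 : ℂ)).fun_mul (hth2 0).hasDerivAt
    simpa using hb
  exact h1.unique (h2.congr_of_eventuallyEq hc)

/-- If `θ'(0) = 0`, choose `t` with `θ(t) ≠ 0`; then `c = 0`, so the series times `θ` vanishes near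
`0`. The series is close to `1` there, which would force `θ` to vanish identically. -/
lemma deriv_theta_ne_zero {τ : ℂ} (hτ : 0 < τ.im) : deriv (fun z => theta z τ) 0 ≠ 0 := by
  intro h0
  obtain ⟨t, ht, hth⟩ := exists_real_theta_ne_zero hτ
  obtain ⟨c, hc⟩ := exists_kroneckerSeries_mul_theta hτ ht
  have h1 := deriv_theta_eq hτ hc
  rw [h0] at h1
  have hc0 : c = 0 := (mul_eq_zero.1 h1.symm).resolve_right hth
  have hne : ∀ᶠ α in 𝓝 0, kroneckerSeries τ t α ≠ 0 := by
    refine (hasFPowerSeriesAt_kroneckerSeries hτ t).analyticAt.continuousAt.eventually_ne ?_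
    rw [kroneckerSeries_zero]
    exact one_ne_zero
  refine eq_zero_of_eventually_theta hτ (z₀ := 0) ?_
  filter_upwards [hc, hne] with α h2 h3
  rw [hc0, zero_mul, mul_zero] at h2
  exact (mul_eq_zero.1 h2).resolve_left h3

/-- As `c θ(t) = θ'(0)` is nonzero, `θ(t)` is nonzero and `c` is exactly the normalizing factor of
the Kronecker function. Since `0` is a simple zero of `θ`, division by `θ(α)` is legitimate in a
punctured neighbourhood. -/
lemma kroneckerReg_eventuallyEq {τ : ℂ} (hτ : 0 < τ.im) {t : ℝ} (ht : t ∈ Set.Ioo (0 : ℝ) 1) :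
    kroneckerReg t τ =ᶠ[𝓝 0] kroneckerSeries τ t := by
  obtain ⟨c, hc⟩ := exists_kroneckerSeries_mul_theta hτ ht
  have hd := deriv_theta_eq hτ hc
  have hd0 := deriv_theta_ne_zero hτ
  have hne : ∀ᶠ α in 𝓝[≠] (0 : ℂ), theta α τ ≠ 0 :=
    ((differentiable_theta hτ) 0).hasDerivAt.eventually_ne hd0
  rw [eventually_nhdsWithin_iff] at hne
  filter_upwards [hc, hne] with α h1 h2
  by_cases h0 : α = 0
  · subst h0
    rw [kroneckerSeries_zero, kroneckerReg, Function.update_self]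
  · have h3 := h2 h0
    have h4 : theta t τ ≠ 0 := fun h => hd0 (by rw [hd, h, mul_zero])
    rw [kroneckerReg, Function.update_of_ne h0, kronecker, hd]
    field_simp
    linear_combination -h1

lemma kroneckerCoeff_eq {τ : ℂ} (hτ : 0 < τ.im) {t : ℝ} (ht : t ∈ Set.Ioo (0 : ℝ) 1) (n : ℕ) :
    kroneckerCoeff n t τ = kroneckerRegTaylor τ t n / (2 * π * I) ^ ((n : ℤ) - 1) := by
  have hp := hasFPowerSeriesAt_kroneckerSeries hτ t
  have hq := hp.analyticAt.hasFPowerSeriesAt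
  have h := congrArg (fun p => p.coeff n) (hq.eq_formalMultilinearSeries hp)
  simp only [FormalMultilinearSeries.coeff_ofScalars] at h
  rw [kroneckerCoeff, (kroneckerReg_eventuallyEq hτ ht).iteratedDeriv_eq, h]

lemma omega_ofReal (n : ℕ) (t : ℝ) (τ : ℂ) : omega n t τ = kroneckerCoeff n t τ := by
  rw [omega, Finset.sum_eq_single 0]
  · simp
  · intro k _ hk
    simp [hk]
  · simp

lemma omega_zero {τ : ℂ} (hτ : 0 < τ.im) {t : ℝ} (ht : t ∈ Set.Ioo (0 : ℝ) 1) :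
    omega 0 t τ = 2 * π * I := by
  rw [omega_ofReal, kroneckerCoeff_eq hτ ht]
  simp [kroneckerRegTaylor]

lemma omega_succ {τ : ℂ} (hτ : 0 < τ.im) {t : ℝ} (ht : t ∈ Set.Ioo (0 : ℝ) 1) (j : ℕ) :
    omega (j + 1) t τ = (if j = 0 then (π * Complex.cot (π * t) : ℂ) else 0) +
      cotCoeff j / (2 * π * I) ^ j + trigCoeff τ j t := by
  have h2 : (2 * π * I : ℂ) ≠ 0 := two_pi_I_ne_zero
  rw [omega_ofReal, kroneckerCoeff_eq hτ ht, kroneckerRegTaylor, kroneckerTaylor]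
  have : (2 * π * I : ℂ) ^ (((j + 1 : ℕ) : ℤ) - 1) = (2 * π * I) ^ j := by
    push_cast; rw [add_sub_cancel_right, zpow_natCast]
  rw [this]
  have h3 : (2 * π * I : ℂ) ^ j ≠ 0 := pow_ne_zero _ h2
  split_ifs with hj
  · subst hj; simp
  · rw [add_div, add_div, mul_div_cancel_left₀ _ h3]; simp

end EllMZV

end

noncomputable section

namespace EllMZV

open Complex Filter Topology MeasureTheory
open scoped Real

/-! ### Truncated integrals -/

/-- Integrability on `[0, 1]` with `∫_a^b ‖g‖ ≤ M √(b - a)`. -/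
def HalfHolder (g : ℝ → ℂ) (M : ℝ) : Prop :=
  IntervalIntegrable g volume 0 1 ∧
    ∀ a b : ℝ, 0 ≤ a → a ≤ b → b ≤ 1 → ∫ t in a..b, ‖g t‖ ≤ M * √(b - a)

lemma HalfHolder.intervalIntegrable {g : ℝ → ℂ} {M : ℝ} (hg : HalfHolder g M) {a b : ℝ}
    (ha : 0 ≤ a) (hab : a ≤ b) (hb : b ≤ 1) : IntervalIntegrable g volume a b := by
  refine hg.1.mono_set ?_
  rw [Set.uIcc_of_le hab, Set.uIcc_of_le zero_le_one]
  exact Set.Icc_subset_Icc ha hb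

lemma HalfHolder.norm_integral_mul_le {g : ℝ → ℂ} {M : ℝ} (hg : HalfHolder g M) {a b H : ℝ}
    (ha : 0 ≤ a) (hab : a ≤ b) (hb : b ≤ 1) (hH : 0 ≤ H) {h : ℝ → ℂ}
    (hh : ∀ t ∈ Set.Icc a b, ‖h t‖ ≤ H) :
    ‖∫ t in a..b, g t * h t‖ ≤ H * (M * √(b - a)) := by
  have h1 : ‖∫ t in a..b, g t * h t‖ ≤ ∫ t in a..b, H * ‖g t‖ := by
    refine intervalIntegral.norm_integral_le_of_norm_le hab (Eventually.of_forall fun t ht => ?_)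
      ((hg.intervalIntegrable ha hab hb).norm.const_mul H)
    rw [norm_mul, mul_comm]
    gcongr
    exact hh t ⟨ht.1.le, ht.2⟩
  rw [intervalIntegral.integral_const_mul] at h1
  exact h1.trans (mul_le_mul_of_nonneg_left (hg.2 a b ha hab hb) hH)

lemma norm_sub_pow_sub_pow_le {ε t : ℝ} (h0 : 0 ≤ ε) (h1 : ε ≤ t) (h2 : t ≤ 1) (k : ℕ) :
    ‖((t : ℂ) - ε) ^ k - (t : ℂ) ^ k‖ ≤ k * ε := by
  rw [← Complex.ofReal_sub, ← Complex.ofReal_pow, ← Complex.ofReal_pow, ← Complex.ofReal_sub,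
    Complex.norm_real, Real.norm_eq_abs]
  refine (abs_pow_sub_pow_le _ _ _).trans ?_
  have e1 : |t - ε - t| = ε := by rw [sub_right_comm, sub_self, zero_sub, abs_neg, abs_of_nonneg h0]
  have e2 : max |t - ε| |t| ≤ 1 :=
    max_le (by rw [abs_le]; constructor <;> linarith) (by rw [abs_le]; constructor <;> linarith)
  have e3 : max |t - ε| |t| ^ (k - 1) ≤ 1 := pow_le_one₀ (le_max_of_le_left (abs_nonneg _)) e2
  rw [e1]
  have : (0 : ℝ) ≤ ε * k := by positivity
  nlinarith

/-- Each discarded end interval costs at most `M √ε`, and replacing `t - ε` by `t` in the power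
costs at most `kε` times the integral of `‖g‖`. The square root is the common rate for continuous
integrands and for the logarithmic singularities of `log sin πt`. -/
lemma HalfHolder.isBigO_truncated {g : ℝ → ℂ} {M : ℝ} (hg : HalfHolder g M) (hM : 0 ≤ M) (k : ℕ) :
    (fun ε : ℝ => (∫ t in ε..(1 - ε), g t * ((t : ℂ) - ε) ^ k) - ∫ t in (0 : ℝ)..1, g t * (t : ℂ) ^ k)
      =O[𝓝[>] 0] fun ε : ℝ => √ε := by
  refine Asymptotics.IsBigO.of_bound (k * M + 2 * M) ?_
  filter_upwards [Ioo_mem_nhdsGT (show (0 : ℝ) < 1 / 2 by norm_num)] with ε hε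
  obtain ⟨h0, h1⟩ := hε
  have hle : ε ≤ 1 - ε := by linarith
  have hc : ∀ a b : ℝ, 0 ≤ a → a ≤ b → b ≤ 1 → ∀ f : ℝ → ℂ, Continuous f →
      IntervalIntegrable (fun t => g t * f t) volume a b := fun a b ha hab hb f hf =>
    (hg.intervalIntegrable ha hab hb).mul_continuousOn hf.continuousOn
  have i1 := hc 0 ε le_rfl h0.le (by linarith) (fun t => (t : ℂ) ^ k) (by fun_prop)
  have i2 := hc ε (1 - ε) h0.le hle (by linarith) (fun t => (t : ℂ) ^ k) (by fun_prop)
  have i3 := hc (1 - ε) 1 (by linarith) (by linarith) le_rfl (fun t => (t : ℂ) ^ k) (by fun_prop)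
  have i4 := hc ε (1 - ε) h0.le hle (by linarith) (fun t => ((t : ℂ) - ε) ^ k) (by fun_prop)
  have hsplit : ∫ t in (0 : ℝ)..1, g t * (t : ℂ) ^ k = (∫ t in (0 : ℝ)..ε, g t * (t : ℂ) ^ k) +
      (∫ t in ε..(1 - ε), g t * (t : ℂ) ^ k) + ∫ t in (1 - ε)..1, g t * (t : ℂ) ^ k := by
    rw [intervalIntegral.integral_add_adjacent_intervals i1 i2,
      intervalIntegral.integral_add_adjacent_intervals (i1.trans i2) i3]
  have hdiff : (∫ t in ε..(1 - ε), g t * ((t : ℂ) - ε) ^ k) -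
      ∫ t in ε..(1 - ε), g t * (t : ℂ) ^ k =
      ∫ t in ε..(1 - ε), g t * (((t : ℂ) - ε) ^ k - (t : ℂ) ^ k) := by
    rw [← intervalIntegral.integral_sub i4 i2]
    simp only [mul_sub]
  have hp : ∀ t : ℝ, 0 ≤ t → t ≤ 1 → ‖(t : ℂ) ^ k‖ ≤ 1 := fun t h0 h1 => by
    rw [norm_pow, Complex.norm_real, Real.norm_of_nonneg h0]
    exact pow_le_one₀ h0 h1
  have b1 := hg.norm_integral_mul_le le_rfl h0.le (by linarith) zero_le_one
    (h := fun t => (t : ℂ) ^ k) (fun t ht => hp t ht.1 (by linarith [ht.2]))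
  have b3 := hg.norm_integral_mul_le (by linarith) (by linarith : 1 - ε ≤ 1) le_rfl zero_le_one
    (h := fun t => (t : ℂ) ^ k) (fun t ht => hp t (by linarith [ht.1]) ht.2)
  have b2 := hg.norm_integral_mul_le h0.le hle (by linarith) (by positivity : (0 : ℝ) ≤ k * ε)
    (h := fun t => ((t : ℂ) - ε) ^ k - (t : ℂ) ^ k)
    (fun t ht => norm_sub_pow_sub_pow_le h0.le ht.1 (by linarith [ht.2]) k)
  have hε1 : ε ≤ √ε := Real.le_sqrt_of_sq_le (by nlinarith)
  have hs1 : √(1 - ε - ε) ≤ 1 := Real.sqrt_le_one.2 (by linarith)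
  rw [sub_zero] at b1
  rw [show 1 - (1 - ε) = ε by ring] at b3
  rw [Real.norm_of_nonneg (Real.sqrt_nonneg ε), hsplit]
  calc _ = ‖(∫ t in ε..(1 - ε), g t * (((t : ℂ) - ε) ^ k - (t : ℂ) ^ k)) +
        (-(∫ t in (0 : ℝ)..ε, g t * (t : ℂ) ^ k) + -∫ t in (1 - ε)..1, g t * (t : ℂ) ^ k)‖ := by
        rw [← hdiff]; congr 1; ring
    _ ≤ k * ε * (M * √(1 - ε - ε)) + (1 * (M * √ε) + 1 * (M * √ε)) := by
        refine (norm_add_le _ _).trans (add_le_add b2 ((norm_add_le _ _).trans ?_))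
        rw [norm_neg, norm_neg]
        exact add_le_add b1 b3
    _ ≤ k * √ε * (M * 1) + (1 * (M * √ε) + 1 * (M * √ε)) := by gcongr
    _ = _ := by ring

lemma Continuous.halfHolder {g : ℝ → ℂ} (hg : Continuous g) : ∃ M, 0 ≤ M ∧ HalfHolder g M := by
  obtain ⟨M, hM⟩ := (isCompact_Icc (a := (0 : ℝ)) (b := 1)).exists_bound_of_continuousOn
    hg.continuousOn
  have hM0 : 0 ≤ M := (norm_nonneg _).trans (hM 0 (by simp))
  refine ⟨M, hM0, hg.intervalIntegrable _ _, fun a b ha hab hb => ?_⟩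
  have h1 : ∫ t in a..b, ‖g t‖ ≤ ∫ _ in a..b, M :=
    intervalIntegral.integral_mono_on hab (hg.norm.intervalIntegrable _ _)
      intervalIntegrable_const fun t ht => hM t ⟨ha.trans ht.1, ht.2.trans hb⟩
  rw [intervalIntegral.integral_const, smul_eq_mul] at h1
  have h2 : b - a ≤ √(b - a) := Real.le_sqrt_of_sq_le (by nlinarith)
  nlinarith

/-- This is `log y ≤ y - 1` at `y = t^{-1/2}`. -/
lemma neg_log_le {t : ℝ} (ht : 0 < t) : -Real.log t ≤ 2 * t ^ (-(1 / 2) : ℝ) := by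
  have h := Real.log_le_sub_one_of_pos (Real.rpow_pos_of_pos ht (-(1 / 2)))
  rw [Real.log_rpow ht] at h
  linarith

lemma two_mul_mul_le_sin {t : ℝ} (h0 : 0 ≤ t) (h1 : t ≤ 1) : 2 * t * (1 - t) ≤ Real.sin (π * t) := by
  have hpi := Real.pi_pos
  rcases le_total t (1 / 2) with h | h
  · have := Real.mul_le_sin (x := π * t) (by positivity) (by nlinarith)
    rw [← mul_assoc, div_mul_cancel₀ _ hpi.ne'] at this
    nlinarith
  · have := Real.mul_le_sin (x := π * (1 - t)) (mul_nonneg hpi.le (by linarith)) (by nlinarith)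
    rw [← mul_assoc, div_mul_cancel₀ _ hpi.ne', show π * (1 - t) = π - π * t by ring,
      Real.sin_pi_sub] at this
    nlinarith

lemma abs_log_sin_le {t : ℝ} (h0 : 0 < t) (h1 : t < 1) :
    |Real.log (Real.sin (π * t))| ≤ 2 * t ^ (-(1 / 2) : ℝ) + 2 * (1 - t) ^ (-(1 / 2) : ℝ) := by
  have h2 := two_mul_mul_le_sin h0.le h1.le
  have h3 : 0 < 2 * t * (1 - t) := mul_pos (by linarith) (by linarith)
  have h4 := Real.log_le_log h3 h2
  rw [Real.log_mul (by positivity) (by linarith), Real.log_mul two_ne_zero h0.ne'] at h4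
  have h5 := Real.log_nonpos (h3.le.trans h2) (Real.sin_le_one _)
  have h6 : 0 < Real.log 2 := Real.log_pos one_lt_two
  rw [abs_of_nonpos h5]
  linarith [neg_log_le h0, neg_log_le (sub_pos.2 h1)]

lemma sqrt_sub_sqrt_le {a b : ℝ} (ha : 0 ≤ a) (hab : a ≤ b) : √b - √a ≤ √(b - a) := by
  have h1 := Real.sq_sqrt ha
  have h2 := Real.sq_sqrt (ha.trans hab)
  have h3 := Real.sqrt_le_sqrt hab
  apply Real.le_sqrt_of_sq_le
  nlinarith [Real.sqrt_nonneg a, Real.sqrt_nonneg b]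

lemma integral_rpow_neg_half (a b : ℝ) :
    ∫ t in a..b, t ^ (-(1 / 2) : ℝ) = 2 * (√b - √a) := by
  rw [integral_rpow (Or.inl (by norm_num)), Real.sqrt_eq_rpow, Real.sqrt_eq_rpow]
  norm_num
  ring

lemma intervalIntegrable_log_sin_pi (a b : ℝ) :
    IntervalIntegrable (fun t => Real.log (Real.sin (π * t))) volume a b := by
  have := (intervalIntegrable_log_sin (a := π * a) (b := π * b)).comp_mul_left (c := π)
  simpa [mul_div_cancel_left₀ _ Real.pi_ne_zero] using this

lemma intervalIntegrable_ofReal {f : ℝ → ℝ} {a b : ℝ} (hf : IntervalIntegrable f volume a b) :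
    IntervalIntegrable (fun t => (f t : ℂ)) volume a b :=
  ⟨MeasureTheory.Integrable.ofReal hf.1, MeasureTheory.Integrable.ofReal hf.2⟩

/-- Jordan's inequality bounds `|log sin πt|` by inverse square roots of `t` and `1 - t`, whose
integrals are differences of square roots. -/
lemma halfHolder_log_sin :
    HalfHolder (fun t => ((Real.log (Real.sin (π * t)) : ℝ) : ℂ)) 8 := by
  refine ⟨intervalIntegrable_ofReal (intervalIntegrable_log_sin_pi 0 1), fun a b ha hab hb => ?_⟩
  have hr : IntervalIntegrable (fun t : ℝ => t ^ (-(1 / 2) : ℝ)) volume a b :=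
    intervalIntegral.intervalIntegrable_rpow' (by norm_num)
  have hr' : IntervalIntegrable (fun t : ℝ => (1 - t) ^ (-(1 / 2) : ℝ)) volume a b := by
    have := (intervalIntegral.intervalIntegrable_rpow' (a := 1 - a) (b := 1 - b)
      (r := (-(1 / 2) : ℝ)) (by norm_num)).comp_sub_left 1
    simpa using this
  have h1 : ∫ t in a..b, ‖((Real.log (Real.sin (π * t)) : ℝ) : ℂ)‖ ≤
      ∫ t in a..b, (2 * t ^ (-(1 / 2) : ℝ) + 2 * (1 - t) ^ (-(1 / 2) : ℝ)) := by
    refine intervalIntegral.integral_mono_on hab (intervalIntegrable_ofReal (intervalIntegrable_log_sin_pi a b)).norm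
      ((hr.const_mul 2).add (hr'.const_mul 2)) fun t ht => ?_
    have ht0 := ha.trans ht.1
    have ht1 := ht.2.trans hb
    rw [Complex.norm_real, Real.norm_eq_abs]
    -- At the endpoints the sine vanishes and `Real.log 0 = 0`, so the bound holds trivially.
    rcases ht0.eq_or_lt with rfl | h0
    · simp
    rcases ht1.eq_or_lt with rfl | h1
    · simp
    exact abs_log_sin_le h0 h1
  rw [intervalIntegral.integral_add (hr.const_mul 2) (hr'.const_mul 2),
    intervalIntegral.integral_const_mul, intervalIntegral.integral_const_mul,
    intervalIntegral.integral_comp_sub_left (fun t : ℝ => t ^ (-(1 / 2) : ℝ)) 1,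
    integral_rpow_neg_half, integral_rpow_neg_half] at h1
  have h2 := sqrt_sub_sqrt_le ha hab
  have h3 := sqrt_sub_sqrt_le (a := 1 - b) (b := 1 - a) (by linarith) (by linarith)
  rw [show 1 - a - (1 - b) = b - a by ring] at h3
  linarith

/-! ### The regularized integral of the cotangent -/

lemma isBigO_id_sqrt : (fun ε : ℝ => ε) =O[𝓝[>] 0] fun ε : ℝ => √ε := by
  refine Asymptotics.IsBigO.of_bound 1 ?_
  filter_upwards [Ioo_mem_nhdsGT (show (0 : ℝ) < 1 by norm_num)] with ε hε
  rw [Real.norm_of_nonneg hε.1.le, Real.norm_of_nonneg (Real.sqrt_nonneg ε), one_mul]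
  exact Real.le_sqrt_of_sq_le (by nlinarith [hε.1, hε.2])

/-- From `1 - 1/y ≤ log y` with `y = sin(πε)/(πε)` and the cubic lower bound for the sine, the
difference is even `O(ε²)`. -/
lemma isBigO_log_sin_sub_log :
    (fun ε : ℝ => Real.log (Real.sin (π * ε)) - Real.log (π * ε)) =O[𝓝[>] 0] fun ε : ℝ => √ε := by
  refine Asymptotics.IsBigO.trans (Asymptotics.IsBigO.of_bound (π ^ 2) ?_) isBigO_id_sqrt
  have hpi := Real.pi_pos
  have hpi3 := Real.pi_gt_three
  filter_upwards [Ioo_mem_nhdsGT (show (0 : ℝ) < 1 / π by positivity)] with ε hε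
  have h0 : 0 < π * ε := mul_pos hpi hε.1
  have h1 : π * ε < 1 := by have := hε.2; rwa [lt_div_iff₀ hpi, mul_comm] at this
  have hsin : 0 < Real.sin (π * ε) := Real.sin_pos_of_pos_of_lt_pi h0 (by linarith)
  have h2 := Real.log_le_log hsin (Real.sin_lt h0).le
  rw [Real.norm_eq_abs, abs_of_nonpos (by linarith), Real.norm_of_nonneg hε.1.le,
    ← Real.log_div hsin.ne' h0.ne']
  have h3 := Real.one_sub_inv_le_log_of_pos (div_pos hsin h0)
  rw [inv_div] at h3
  have h4 := Real.sin_gt_sub_cube h0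
  have h5 : π * ε / Real.sin (π * ε) - 1 ≤ (π * ε) ^ 2 := by
    rw [div_sub_one hsin.ne', div_le_iff₀ hsin]
    have : (π * ε) ^ 2 * (π * ε - (π * ε) ^ 3 / 6) ≤ (π * ε) ^ 2 * Real.sin (π * ε) :=
      mul_le_mul_of_nonneg_left h4.le (by positivity)
    have h6 : (π * ε) ^ 2 ≤ 1 := by nlinarith
    have h7 : 0 < (π * ε) ^ 3 := by positivity
    nlinarith
  have hε1 : ε ^ 2 ≤ ε := by
    have : ε < 1 := by nlinarith [hε.1]
    nlinarith [hε.1]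
  calc _ ≤ (π * ε) ^ 2 := by linarith
    _ = π ^ 2 * ε ^ 2 := by ring
    _ ≤ _ := by gcongr

lemma isBigO_mul_log_sin :
    (fun ε : ℝ => ε * Real.log (Real.sin (π * ε))) =O[𝓝[>] 0] fun ε : ℝ => √ε := by
  refine Asymptotics.IsBigO.of_bound 6 ?_
  filter_upwards [Ioo_mem_nhdsGT (show (0 : ℝ) < 1 / 2 by norm_num)] with ε hε
  obtain ⟨h0, h1⟩ := hε
  have h2 := abs_log_sin_le h0 (by linarith)
  have h3 : (1 - ε) ^ (-(1 / 2) : ℝ) ≤ ε ^ (-(1 / 2) : ℝ) :=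
    Real.rpow_le_rpow_of_nonpos h0 (by linarith) (by norm_num)
  have h4 : ε * ε ^ (-(1 / 2) : ℝ) = √ε := by
    rw [Real.sqrt_eq_rpow]
    nth_rewrite 1 [← Real.rpow_one ε]
    rw [← Real.rpow_add h0]
    norm_num
  rw [Real.norm_of_nonneg (Real.sqrt_nonneg ε), norm_mul, Real.norm_of_nonneg h0.le,
    Real.norm_eq_abs]
  have h5 : ε * |Real.log (Real.sin (π * ε))| ≤ ε * (4 * ε ^ (-(1 / 2) : ℝ)) := by
    gcongr; linarith
  have h6 := Real.sqrt_nonneg ε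
  nlinarith

lemma isBigO_pow_mul_log_sin (k : ℕ) :
    (fun ε : ℝ => (1 - 2 * ε) ^ k * Real.log (Real.sin (π * ε)) - Real.log (π * ε))
      =O[𝓝[>] 0] fun ε : ℝ => √ε := by
  have h1 : (fun ε : ℝ => ((1 - 2 * ε) ^ k - 1) * Real.log (Real.sin (π * ε)))
      =O[𝓝[>] 0] fun ε : ℝ => √ε := by
    refine Asymptotics.IsBigO.trans (Asymptotics.IsBigO.of_bound (2 * k) ?_) isBigO_mul_log_sin
    filter_upwards [Ioo_mem_nhdsGT (show (0 : ℝ) < 1 / 2 by norm_num)] with ε hε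
    have h2 := norm_sub_pow_sub_pow_le (t := 1) (ε := 2 * ε) (by linarith [hε.1])
      (by linarith [hε.2]) le_rfl k
    have h3 : ‖(1 - 2 * ε) ^ k - 1‖ ≤ k * (2 * ε) := by
      rw [← Complex.norm_real]; push_cast; simpa using h2
    rw [norm_mul, norm_mul, Real.norm_of_nonneg hε.1.le, ← mul_assoc]
    refine mul_le_mul_of_nonneg_right (h3.trans (le_of_eq (by ring))) (norm_nonneg _)
  refine (h1.add isBigO_log_sin_sub_log).congr_left fun ε => by ring

lemma hasDerivAt_log_sin_pi {t : ℝ} (h0 : 0 < t) (h1 : t < 1) :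
    HasDerivAt (fun t => Real.log (Real.sin (π * t))) (π * Real.cot (π * t)) t := by
  have hs : Real.sin (π * t) ≠ 0 :=
    (Real.sin_pos_of_pos_of_lt_pi (mul_pos Real.pi_pos h0) (by nlinarith [Real.pi_pos])).ne'
  have h := (((hasDerivAt_id' t).const_mul π).sin).log hs
  rw [Real.cot_eq_cos_div_sin]
  refine h.congr_deriv ?_
  ring

lemma continuousOn_cot {ε : ℝ} (h0 : 0 < ε) :
    ContinuousOn (fun t => π * Real.cot (π * t)) (Set.Icc ε (1 - ε)) := by
  simp only [Real.cot_eq_cos_div_sin]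
  refine continuousOn_const.mul (ContinuousOn.div (by fun_prop) (by fun_prop) fun t ht => ?_)
  exact (Real.sin_pos_of_pos_of_lt_pi (mul_pos Real.pi_pos (h0.trans_le ht.1))
    (by nlinarith [Real.pi_pos, ht.2])).ne'

/-- Integration by parts with antiderivative `log sin πt`, which has equal values at `ε` and `1 -
ε`. The lower boundary term survives only for `k = 0`, whence `0 ^ k`. -/
lemma integral_cot_mul_pow {ε : ℝ} (h0 : 0 < ε) (h1 : ε < 1 / 2) (k : ℕ) :
    ∫ t in ε..(1 - ε), (t - ε) ^ k * (π * Real.cot (π * t)) =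
      (1 - 2 * ε) ^ k * Real.log (Real.sin (π * ε)) - 0 ^ k * Real.log (Real.sin (π * ε)) -
        ∫ t in ε..(1 - ε), (k * (t - ε) ^ (k - 1)) * Real.log (Real.sin (π * t)) := by
  have hle : ε ≤ 1 - ε := by linarith
  rw [intervalIntegral.integral_mul_deriv_eq_deriv_mul
    (u := fun t => (t - ε) ^ k) (v := fun t => Real.log (Real.sin (π * t)))
    (u' := fun t => k * (t - ε) ^ (k - 1)) (v' := fun t => π * Real.cot (π * t))]
  · have : Real.sin (π * (1 - ε)) = Real.sin (π * ε) := by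
      rw [mul_sub, mul_one, Real.sin_pi_sub]
    rw [this, sub_self]
    ring
  · intro t _
    simpa using ((hasDerivAt_id' t).sub_const ε).fun_pow k
  · intro t ht
    rw [Set.uIcc_of_le hle] at ht
    exact hasDerivAt_log_sin_pi (h0.trans_le ht.1) (by linarith [ht.2])
  · exact Continuous.intervalIntegrable (by fun_prop) _ _
  · refine ContinuousOn.intervalIntegrable ?_
    rw [Set.uIcc_of_le hle]
    exact continuousOn_cot h0

lemma log_neg_two_pi_I_mul {ε : ℝ} (h0 : 0 < ε) :
    Complex.log (-2 * π * I * (ε : ℂ)) = (Real.log (2 * π * ε) : ℝ) - π / 2 * I := by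
  have hpi := Real.pi_pos
  rw [show (-2 * π * I * (ε : ℂ)) = ((2 * π * ε : ℝ) : ℂ) * (-I) by push_cast; ring,
    Complex.log_ofReal_mul (by positivity) (by simp), Complex.log_neg_I]
  ring

/-- The integral of `π cot (πt)` against a power has a logarithmic expansion. -/
lemma exists_cot_expansion (k : ℕ) : ∃ c d : ℂ,
    (fun ε : ℝ => (∫ t in ε..(1 - ε), (π * Complex.cot (π * t)) * ((t : ℂ) - ε) ^ k) -
      (c + d * Complex.log (-2 * π * I * (ε : ℂ)))) =O[𝓝[>] 0] fun ε : ℝ => √ε := by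
  have hpi := Real.pi_pos
  have hcast : ∀ ε : ℝ, ∫ t in ε..(1 - ε), (π * Complex.cot (π * t)) * ((t : ℂ) - ε) ^ k =
      ((∫ t in ε..(1 - ε), (t - ε) ^ k * (π * Real.cot (π * t)) : ℝ) : ℂ) := by
    intro ε
    rw [← intervalIntegral.integral_ofReal]
    congr 1
    ext t
    push_cast
    ring
  rcases k with _ | k
  -- Without a power the two boundary terms cancel exactly, so the integral is `0`.
  · refine ⟨0, 0, Asymptotics.IsBigO.of_bound 0 ?_⟩
    filter_upwards [Ioo_mem_nhdsGT (show (0 : ℝ) < 1 / 2 by norm_num)] with ε hε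
    rw [hcast, integral_cot_mul_pow hε.1 hε.2]
    simp
  · have hL := halfHolder_log_sin.isBigO_truncated (by norm_num) k
    have hB := isBigO_pow_mul_log_sin (k + 1)
    have hB' : (fun ε : ℝ => (((1 - 2 * ε) ^ (k + 1) * Real.log (Real.sin (π * ε)) -
        Real.log (π * ε) : ℝ) : ℂ)) =O[𝓝[>] 0] fun ε : ℝ => √ε :=
      Asymptotics.IsBigO.trans (Asymptotics.IsBigO.of_bound 1
        (Eventually.of_forall fun ε => by rw [Complex.norm_real, one_mul])) hB
    -- The boundary term is asymptotic to `log (πε) = log (-2πiε) + πi/2 - log 2`; the integral in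
    -- the constant is the limit of the one left by integration by parts.
    refine ⟨π / 2 * I - (Real.log 2 : ℝ) - (k + 1) * ∫ t in (0 : ℝ)..1,
      ((Real.log (Real.sin (π * t)) : ℝ) : ℂ) * (t : ℂ) ^ k, 1, ?_⟩
    refine (hB'.sub (hL.const_mul_left ((k : ℂ) + 1))).congr' ?_ EventuallyEq.rfl
    filter_upwards [Ioo_mem_nhdsGT (show (0 : ℝ) < 1 / 2 by norm_num)] with ε hε
    have h2 : Real.log (2 * π * ε) = Real.log 2 + Real.log (π * ε) := by
      rw [mul_assoc, Real.log_mul two_ne_zero (mul_pos hpi hε.1).ne']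
    have h3 : ((∫ t in ε..(1 - ε), (((k + 1 : ℕ) : ℝ) * (t - ε) ^ (k + 1 - 1)) *
        Real.log (Real.sin (π * t)) : ℝ) : ℂ) = (k + 1) * ∫ t in ε..(1 - ε),
        ((Real.log (Real.sin (π * t)) : ℝ) : ℂ) * ((t : ℂ) - ε) ^ k := by
      rw [← intervalIntegral.integral_ofReal, ← intervalIntegral.integral_const_mul]
      congr 1
      ext t
      rw [Nat.add_sub_cancel]
      push_cast
      ring
    rw [hcast, integral_cot_mul_pow hε.1 hε.2, log_neg_two_pi_I_mul hε.1, h2]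
    push_cast at h3 ⊢
    rw [h3]
    simp
    ring

end EllMZV

end

noncomputable section

namespace EllMZV

open Complex Filter Topology MeasureTheory
open scoped Real

/-! ### Uniqueness of logarithmic expansions -/

lemma tendsto_norm_log_atTop :
    Tendsto (fun ε : ℝ => ‖Complex.log (-2 * π * I * (ε : ℂ))‖) (𝓝[>] 0) atTop := by
  have hpi := Real.pi_pos
  have h1 : Tendsto (fun ε : ℝ => Real.log (2 * π * ε)) (𝓝[>] 0) atBot := by
    have h2 : Tendsto (fun ε : ℝ => 2 * π * ε) (𝓝[>] 0) (𝓝[>] 0) := by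
      refine tendsto_nhdsWithin_iff.2 ⟨?_, ?_⟩
      · have : Tendsto (fun ε : ℝ => 2 * π * ε) (𝓝 0) (𝓝 (0 : ℝ)) :=
          Continuous.tendsto' (by fun_prop) _ _ (by simp)
        exact this.mono_left nhdsWithin_le_nhds
      · filter_upwards [self_mem_nhdsWithin] with ε hε
        exact mul_pos (show (0 : ℝ) < 2 * π by positivity) hε
    exact Real.tendsto_log_nhdsGT_zero.comp h2
  refine tendsto_atTop_mono' _ ?_ (tendsto_neg_atBot_atTop.comp h1)
  filter_upwards [self_mem_nhdsWithin] with ε hε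
  rw [log_neg_two_pi_I_mul hε]
  refine le_trans ?_ (Complex.abs_re_le_norm _)
  simpa using neg_le_abs (Real.log (2 * π * ε))

/-- A nonconstant polynomial is unbounded along an argument tending to infinity, and `log (-2πiε)`
does so; a constant with limit `0` is `0`. -/
lemma eq_zero_of_eval_log_tendsto {P : Polynomial ℂ}
    (h : Tendsto (fun ε : ℝ => P.eval (Complex.log (-2 * π * I * (ε : ℂ)))) (𝓝[>] 0) (𝓝 0)) :
    P = 0 := by
  by_cases hd : 0 < P.degree
  · have h1 := P.tendsto_norm_atTop hd tendsto_norm_log_atTop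
    exact absurd (h.norm) (not_tendsto_nhds_of_tendsto_atTop h1 _)
  · rw [Polynomial.eq_C_of_degree_le_zero (not_lt.1 hd)] at h ⊢
    simp only [Polynomial.eval_C] at h
    rw [tendsto_nhds_unique tendsto_const_nhds h, Polynomial.C_0]

lemma tendsto_rpow_zero {ν : ℝ} (hν : 0 < ν) : Tendsto (fun ε : ℝ => ε ^ ν) (𝓝[>] 0) (𝓝 0) := by
  have := (Real.continuousAt_rpow_const 0 ν (Or.inr hν.le)).tendsto
  rw [Real.zero_rpow hν.ne'] at this
  exact this.mono_left nhdsWithin_le_nhds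

lemma IsLogExpansion.unique {l : List ℕ} {τ : ℂ} {P Q : Polynomial ℂ} (hP : IsLogExpansion l τ P)
    (hQ : IsLogExpansion l τ Q) : P = Q := by
  obtain ⟨-, ν, hν, h1⟩ := hP
  obtain ⟨-, μ, hμ, h2⟩ := hQ
  have h3 := (h2.trans_tendsto (tendsto_rpow_zero hμ)).sub (h1.trans_tendsto (tendsto_rpow_zero hν))
  rw [← sub_eq_zero]
  apply eq_zero_of_eval_log_tendsto
  simp only [Polynomial.eval_sub]
  simpa using h3

/-- By uniqueness of the expansion, the choice in the definition of `ellMZV` is immaterial and any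
exhibited expansion computes it. -/
lemma IsLogExpansion.ellMZV_eq {l : List ℕ} {τ : ℂ} {P : Polynomial ℂ}
    (hP : IsLogExpansion l τ P) : ellMZV l τ = P.coeff 0 := by
  have h : ∃ P : Polynomial ℂ, IsLogExpansion l τ P := ⟨P, hP⟩
  rw [ellMZV, dif_pos h, h.choose_spec.unique hP]

/-! ### The iterated integrals of depth one -/

lemma integral_sub_pow (ε x : ℝ) (s : ℕ) :
    ∫ t in ε..x, ((t : ℂ) - ε) ^ s / s.factorial = ((x : ℂ) - ε) ^ (s + 1) / (s + 1).factorial := by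
  have h : ∀ t : ℝ, HasDerivAt (fun t : ℝ => ((t : ℂ) - ε) ^ (s + 1) / (s + 1).factorial)
      (((t : ℂ) - ε) ^ s / s.factorial) t := by
    intro t
    have h1 := ((((hasDerivAt_id' (t : ℂ)).sub_const (ε : ℂ)).fun_pow (s + 1)).div_const
      ((s + 1).factorial : ℂ)).comp_ofReal
    refine h1.congr_deriv ?_
    have h2 : ((s + 1 : ℕ) : ℂ) ≠ 0 := by exact_mod_cast Nat.succ_ne_zero s
    have h3 : (s.factorial : ℂ) ≠ 0 := by exact_mod_cast s.factorial_ne_zero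
    rw [Nat.add_sub_cancel, Nat.factorial_succ, Nat.cast_mul]
    field_simp
  rw [intervalIntegral.integral_eq_sub_of_hasDerivAt (fun t _ => h t)
    (Continuous.intervalIntegrable (by fun_prop) _ _)]
  simp

lemma iterInt_replicate_zero {τ : ℂ} (hτ : 0 < τ.im) {ε : ℝ} (h0 : 0 < ε) (s : ℕ) {x : ℝ}
    (h1 : ε ≤ x) (h2 : x < 1) :
    iterInt τ ε (List.replicate s 0) x = (2 * π * I) ^ s * (((x : ℂ) - ε) ^ s / s.factorial) := by
  induction s generalizing x with
  | zero => simp [iterInt]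
  | succ s ih =>
    rw [List.replicate_succ, iterInt, ← integral_sub_pow, ← intervalIntegral.integral_const_mul]
    refine intervalIntegral.integral_congr fun t ht => ?_
    rw [Set.uIcc_of_le h1] at ht
    rw [omega_zero hτ ⟨h0.trans_le ht.1, ht.2.trans_lt h2⟩, ih ht.1 (ht.2.trans_lt h2)]
    ring

/-- Because `ω_0` is the constant `2πi`, the inner integrations only produce `(2πi)^s (t - ε)^s /
s!`, and a single integral remains. -/
lemma iterInt_cons_replicate_zero {τ : ℂ} (hτ : 0 < τ.im) {ε : ℝ} (h0 : 0 < ε) (h1 : ε < 1 / 2)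
    (n s : ℕ) {f : ℝ → ℂ} (hf : ∀ t ∈ Set.Ioo (0 : ℝ) 1, omega n t τ = f t) :
    iterInt τ ε (n :: List.replicate s 0) (1 - ε) = (2 * π * I) ^ s / s.factorial *
      ∫ t in ε..(1 - ε), f t * ((t : ℂ) - ε) ^ s := by
  rw [iterInt, ← intervalIntegral.integral_const_mul]
  refine intervalIntegral.integral_congr fun t ht => ?_
  rw [Set.uIcc_of_le (by linarith)] at ht
  rw [hf t ⟨h0.trans_le ht.1, by linarith [ht.2]⟩,
    iterInt_replicate_zero hτ h0 s ht.1 (by linarith [ht.2])]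
  ring

lemma isLogExpansion_of_isBigO {τ : ℂ} (hτ : 0 < τ.im) (n s : ℕ) {f : ℝ → ℂ}
    (hf : ∀ t ∈ Set.Ioo (0 : ℝ) 1, omega n t τ = f t) {c d : ℂ}
    (h : (fun ε : ℝ => (∫ t in ε..(1 - ε), f t * ((t : ℂ) - ε) ^ s) -
      (c + d * Complex.log (-2 * π * I * (ε : ℂ)))) =O[𝓝[>] 0] fun ε : ℝ => √ε) :
    IsLogExpansion (n :: List.replicate s 0) τ
      (Polynomial.C ((2 * π * I) ^ s / s.factorial) *
        (Polynomial.C d * Polynomial.X + Polynomial.C c)) := by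
  refine ⟨?_, 1 / 2, by norm_num, ?_⟩
  · refine (Polynomial.natDegree_C_mul_le _ _).trans (Polynomial.natDegree_linear_le.trans ?_)
    simp
  · simp only [← Real.sqrt_eq_rpow]
    refine (h.const_mul_left ((2 * π * I) ^ s / s.factorial)).congr' ?_ EventuallyEq.rfl
    filter_upwards [Ioo_mem_nhdsGT (show (0 : ℝ) < 1 / 2 by norm_num)] with ε hε
    rw [iterInt_cons_replicate_zero hτ hε.1 hε.2 n s hf]
    simp only [Polynomial.eval_mul, Polynomial.eval_add, Polynomial.eval_C, Polynomial.eval_X]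
    ring

lemma ellMZV_of_isBigO {τ : ℂ} (hτ : 0 < τ.im) (n s : ℕ) {f : ℝ → ℂ}
    (hf : ∀ t ∈ Set.Ioo (0 : ℝ) 1, omega n t τ = f t) {c d : ℂ}
    (h : (fun ε : ℝ => (∫ t in ε..(1 - ε), f t * ((t : ℂ) - ε) ^ s) -
      (c + d * Complex.log (-2 * π * I * (ε : ℂ)))) =O[𝓝[>] 0] fun ε : ℝ => √ε) :
    ellMZV (n :: List.replicate s 0) τ / (2 * π * I) ^ s = c / s.factorial := by
  rw [(isLogExpansion_of_isBigO hτ n s hf h).ellMZV_eq]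
  have h2 : (2 * π * I : ℂ) ^ s ≠ 0 := pow_ne_zero _ two_pi_I_ne_zero
  simp only [Polynomial.coeff_C_mul, Polynomial.coeff_add, Polynomial.coeff_X_zero, mul_zero,
    Polynomial.coeff_C_zero, zero_add]
  field_simp

/-! ### Integrals of exponentials against powers -/

/-- Repeated integration by parts: `e^a = 1` leaves `1 / (a (s+1)!)` at the upper end, the power
kills the lower end, and for `s = 0` the integral over full periods is `0`. This is why `l = s` is
missing from the sum. -/
lemma integral_cexp_mul_pow {a : ℂ} (ha : a ≠ 0) (h1 : cexp a = 1) (s : ℕ) :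
    ∫ t in (0 : ℝ)..1, cexp (a * t) * (t : ℂ) ^ s / s.factorial =
      ∑ l ∈ Finset.range s, (-1) ^ l / a ^ (l + 1) / (s - l).factorial := by
  induction s with
  | zero =>
    simp only [pow_zero, mul_one, Nat.factorial_zero, Nat.cast_one, div_one]
    rw [integral_exp_mul_complex ha]
    simp [h1]
  | succ s ih =>
    have h3 : (s.factorial : ℂ) ≠ 0 := by exact_mod_cast s.factorial_ne_zero
    have h2 : ((s + 1 : ℕ) : ℂ) ≠ 0 := by exact_mod_cast Nat.succ_ne_zero s
    have hd : ∀ t : ℝ, HasDerivAt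
        (fun t : ℝ => cexp (a * t) / a * ((t : ℂ) ^ (s + 1) / (s + 1).factorial))
        (cexp (a * t) * ((t : ℂ) ^ (s + 1) / (s + 1).factorial) +
          cexp (a * t) / a * ((t : ℂ) ^ s / s.factorial)) t := by
      intro t
      have e1 : HasDerivAt (fun t : ℝ => cexp (a * t) / a) (cexp (a * t)) t := by
        refine ((((hasDerivAt_id' (t : ℂ)).const_mul a).cexp.div_const a).comp_ofReal).congr_deriv ?_
        field_simp
      have e2 : HasDerivAt (fun t : ℝ => (t : ℂ) ^ (s + 1) / (s + 1).factorial)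
          ((t : ℂ) ^ s / s.factorial) t := by
        refine ((hasDerivAt_pow (s + 1) (t : ℂ)).div_const
          ((s + 1).factorial : ℂ)).comp_ofReal.congr_deriv ?_
        rw [Nat.add_sub_cancel, Nat.factorial_succ, Nat.cast_mul]
        field_simp
      exact e1.fun_mul e2
    have hI := intervalIntegral.integral_eq_sub_of_hasDerivAt (a := 0) (b := 1) (fun t _ => hd t)
      (Continuous.intervalIntegrable (by fun_prop) _ _)
    rw [intervalIntegral.integral_add (Continuous.intervalIntegrable (by fun_prop) _ _)
      (Continuous.intervalIntegrable (by fun_prop) _ _)] at hI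
    have e3 : ∫ t in (0 : ℝ)..1, cexp (a * t) / a * ((t : ℂ) ^ s / s.factorial) =
        a⁻¹ * ∫ t in (0 : ℝ)..1, cexp (a * t) * (t : ℂ) ^ s / s.factorial := by
      rw [← intervalIntegral.integral_const_mul]
      congr 1
      ext t
      ring
    rw [e3, ih] at hI
    simp only [mul_div_assoc]
    rw [eq_sub_of_add_eq hI, Finset.sum_range_succ', Finset.mul_sum, ← sub_eq_zero]
    have e4 : ∀ l ∈ Finset.range s, (-1 : ℂ) ^ (l + 1) / a ^ (l + 1 + 1) / (s + 1 - (l + 1)).factorial =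
        -(a⁻¹ * ((-1) ^ l / a ^ (l + 1) / (s - l).factorial)) := by
      intro l _
      rw [Nat.add_sub_add_right]
      field_simp
      ring
    rw [Finset.sum_congr rfl e4, Finset.sum_neg_distrib]
    simp [h1]
    ring

/-- The coefficients of the series in `(2πiα)^j` and `Y^l` of the convergent part of the
generating series of A-elliptic multiple zeta values. -/
def lambertCoeff (τ : ℂ) (j l : ℕ) : ℂ :=
  -∑' p : ℕ × ℕ, cexp (2 * π * I * τ) ^ ((p.1 + 1) * (p.2 + 1)) *
    (((p.2 + 1 : ℕ) : ℂ) ^ j * (((-1) ^ l + (-1) ^ j) /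
      (j.factorial * ((p.1 + 1 : ℕ) * (2 * π * I * (p.1 + 1 : ℕ)) ^ l))))

lemma norm_trig_factor_le (t : ℝ) (j : ℕ) (p : ℕ × ℕ) :
    ‖(cexp (2 * π * I * t) ^ (p.1 + 1) -
      (-1) ^ j * (cexp (2 * π * I * t))⁻¹ ^ (p.1 + 1)) / (j.factorial : ℂ)‖ ≤ 2 := by
  rw [norm_div, Complex.norm_natCast]
  have h1 : ‖cexp (2 * π * I * t) ^ (p.1 + 1) -
      (-1) ^ j * (cexp (2 * π * I * t))⁻¹ ^ (p.1 + 1)‖ ≤ 2 := by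
    refine (norm_sub_le _ _).trans (le_of_eq ?_)
    rw [norm_mul, norm_pow, norm_pow, norm_pow, norm_inv, norm_cexp_ofReal]
    norm_num
  have h2 : (1 : ℝ) ≤ j.factorial := by exact_mod_cast j.factorial_pos
  exact (div_le_self (norm_nonneg _) h2).trans h1

lemma norm_trig_term_le (τ : ℂ) (t : ℝ) (j : ℕ) (p : ℕ × ℕ) :
    ‖cexp (2 * π * I * τ) ^ ((p.1 + 1) * (p.2 + 1)) *
      (((p.2 + 1 : ℕ) : ℂ) ^ j * ((cexp (2 * π * I * t) ^ (p.1 + 1) -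
      (-1) ^ j * (cexp (2 * π * I * t))⁻¹ ^ (p.1 + 1)) / j.factorial))‖ ≤
    ‖cexp (2 * π * I * τ) ^ ((p.1 + 1) * (p.2 + 1)) * (((p.2 + 1 : ℕ) : ℂ) ^ j * 2)‖ := by
  rw [norm_mul, norm_mul, norm_mul, norm_mul, Complex.norm_ofNat]
  gcongr
  exact norm_trig_factor_le t j p

lemma summable_trig_bound {τ : ℂ} (hτ : 0 < τ.im) (j : ℕ) :
    Summable fun p : ℕ × ℕ =>
      ‖cexp (2 * π * I * τ) ^ ((p.1 + 1) * (p.2 + 1)) * (((p.2 + 1 : ℕ) : ℂ) ^ j * 2)‖ :=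
  (summable_nome_pow (norm_nome_lt_one hτ) (a := fun _ => 2) (C := 2) (fun _ => by simp) j).norm

lemma continuous_trigCoeff {τ : ℂ} (hτ : 0 < τ.im) (j : ℕ) : Continuous (trigCoeff τ j) := by
  refine continuous_const.mul (continuous_tsum (fun p => ?_) (summable_trig_bound hτ j)
    fun p t => norm_trig_term_le τ t j p)
  have h : ∀ t : ℝ, cexp (2 * π * I * t) ≠ 0 := fun t => Complex.exp_ne_zero _
  fun_prop (disch := exact h _)

/-- Integrate the double series term by term. The frequencies `m` and `-m` yield the same power of
`2πim` up to sign and combine to the factor `(-1)^l + (-1)^j`. The result is a convolution with `1 /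
n!`, `n ≥ 1`, that is, a multiple of `e^Y - 1` in generating-series form. -/
lemma integral_trigCoeff {τ : ℂ} (hτ : 0 < τ.im) (j s : ℕ) :
    ∫ t in (0 : ℝ)..1, trigCoeff τ j t * (t : ℂ) ^ s / s.factorial =
      ∑ l ∈ Finset.range s, lambertCoeff τ j l / (s - l).factorial := by
  have h0 : ∀ t : ℝ, cexp (2 * π * I * t) ≠ 0 := fun t => Complex.exp_ne_zero _
  let c : ℕ × ℕ → ℂ := fun p => cexp (2 * π * I * τ) ^ ((p.1 + 1) * (p.2 + 1)) *
    (((p.2 + 1 : ℕ) : ℂ) ^ j / j.factorial)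
  let F : ℕ × ℕ → ℝ → ℂ := fun p t => (cexp (2 * π * I * τ) ^ ((p.1 + 1) * (p.2 + 1)) *
    (((p.2 + 1 : ℕ) : ℂ) ^ j * ((cexp (2 * π * I * t) ^ (p.1 + 1) -
      (-1) ^ j * (cexp (2 * π * I * t))⁻¹ ^ (p.1 + 1)) / j.factorial))) *
        ((t : ℂ) ^ s / s.factorial)
  have hsum : HasSum (fun p => ∫ t in (0 : ℝ)..1, F p t)
      (∫ t in (0 : ℝ)..1, ∑' p, F p t) := by
    refine intervalIntegral.hasSum_integral_of_dominated_convergence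
      (fun p _ => ‖cexp (2 * π * I * τ) ^ ((p.1 + 1) * (p.2 + 1)) *
        (((p.2 + 1 : ℕ) : ℂ) ^ j * 2)‖) (fun p => ?_) (fun p => ?_) ?_ ?_ ?_
    · exact Continuous.aestronglyMeasurable (by fun_prop (disch := exact h0 _))
    · refine Eventually.of_forall fun t ht => ?_
      rw [Set.uIoc_of_le zero_le_one] at ht
      simp only [F]
      rw [norm_mul]
      refine (mul_le_of_le_one_right (norm_nonneg _) ?_).trans (norm_trig_term_le τ t j p)
      rw [norm_div, norm_pow, Complex.norm_natCast, Complex.norm_real,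
        Real.norm_of_nonneg ht.1.le]
      have h2 : (1 : ℝ) ≤ s.factorial := by exact_mod_cast s.factorial_pos
      exact (div_le_self (pow_nonneg ht.1.le _) h2).trans (pow_le_one₀ ht.1.le ht.2)
    · exact Eventually.of_forall fun t _ => summable_trig_bound hτ j
    · exact intervalIntegrable_const
    · refine Eventually.of_forall fun t _ => Summable.hasSum ?_
      exact (Summable.of_norm_bounded (summable_trig_bound hτ j)
        fun p => norm_trig_term_le τ t j p).mul_right _
  have hF : ∀ t : ℝ, trigCoeff τ j t * (t : ℂ) ^ s / s.factorial =
      -(2 * π * I) * ∑' p, F p t := by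
    intro t
    simp only [F]
    rw [tsum_mul_right, trigCoeff]
    ring
  have hFint : ∀ p : ℕ × ℕ, ∫ t in (0 : ℝ)..1, F p t = c p * ∑ l ∈ Finset.range s,
      (1 / (2 * π * I * (p.1 + 1 : ℕ)) ^ (l + 1) * ((-1) ^ l + (-1) ^ j)) /
        (s - l).factorial := by
    intro p
    have hm : ((p.1 + 1 : ℕ) : ℂ) ≠ 0 := by exact_mod_cast Nat.succ_ne_zero p.1
    have ha : (2 * π * I * (p.1 + 1 : ℕ) : ℂ) ≠ 0 := mul_ne_zero two_pi_I_ne_zero hm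
    have he1 : cexp (2 * π * I * (p.1 + 1 : ℕ)) = 1 := by
      rw [mul_comm, Complex.exp_nat_mul, Complex.exp_two_pi_mul_I, one_pow]
    have he2 : cexp (-(2 * π * I * (p.1 + 1 : ℕ))) = 1 := by rw [Complex.exp_neg, he1, inv_one]
    have h1 := integral_cexp_mul_pow ha he1 s
    have h2 := integral_cexp_mul_pow (neg_ne_zero.2 ha) he2 s
    have hFe : ∀ t : ℝ, F p t = c p * (cexp (2 * π * I * (p.1 + 1 : ℕ) * t) * (t : ℂ) ^ s /
        s.factorial - (-1) ^ j * (cexp (-(2 * π * I * (p.1 + 1 : ℕ)) * t) * (t : ℂ) ^ s /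
        s.factorial)) := by
      intro t
      have g1 : cexp (2 * π * I * (p.1 + 1 : ℕ) * t) = cexp (2 * π * I * t) ^ (p.1 + 1) := by
        rw [← Complex.exp_nat_mul]; congr 1; ring
      have g2 : cexp (-(2 * π * I * (p.1 + 1 : ℕ)) * t) = (cexp (2 * π * I * t))⁻¹ ^ (p.1 + 1) := by
        rw [← Complex.exp_neg, ← Complex.exp_nat_mul]; congr 1; ring
      rw [g1, g2]
      simp only [F, c]
      ring
    simp only [hFe]
    rw [intervalIntegral.integral_const_mul, intervalIntegral.integral_sub
      (Continuous.intervalIntegrable (by fun_prop) _ _)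
      (Continuous.intervalIntegrable (by fun_prop) _ _), intervalIntegral.integral_const_mul,
      h1, h2, Finset.mul_sum, ← Finset.sum_sub_distrib]
    congr 1
    refine Finset.sum_congr rfl fun l _ => ?_
    have hsq : ((-1 : ℂ) ^ l) * (-1) ^ l = 1 := by rw [← mul_pow]; norm_num
    rw [neg_pow (2 * π * I * (p.1 + 1 : ℕ) : ℂ) (l + 1), pow_succ (-1 : ℂ) l]
    have hl : ((-1 : ℂ) ^ l) ≠ 0 := pow_ne_zero _ (by norm_num)
    field_simp
    ring
  have hS : ∀ l ∈ Finset.range s, Summable fun p : ℕ × ℕ => c p *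
      ((1 / (2 * π * I * (p.1 + 1 : ℕ)) ^ (l + 1) * ((-1) ^ l + (-1) ^ j)) /
        (s - l).factorial) := by
    intro l _
    have hle : ∀ p : ℕ × ℕ, ‖(1 / j.factorial * ((1 / (2 * π * I * (p.1 + 1 : ℕ)) ^ (l + 1) *
        ((-1) ^ l + (-1) ^ j)) / (s - l).factorial) : ℂ)‖ ≤ 2 := by
      intro p
      have g1 : ‖(1 / (2 * π * I * (p.1 + 1 : ℕ)) ^ (l + 1) : ℂ)‖ ≤ 1 := by
        rw [norm_div, norm_one, norm_pow]
        refine div_le_one_of_le₀ (one_le_pow₀ ?_) (by positivity)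
        rw [norm_two_pi_I_mul, Complex.norm_natCast]
        have : (1 : ℝ) ≤ (p.1 + 1 : ℕ) := by exact_mod_cast Nat.succ_le_succ (Nat.zero_le _)
        nlinarith [Real.pi_gt_three]
      have g2 : ‖((-1) ^ l + (-1) ^ j : ℂ)‖ ≤ 2 := by
        refine (norm_add_le _ _).trans (le_of_eq ?_)
        rw [norm_pow, norm_pow]; norm_num
      have g3 : ‖(1 / j.factorial : ℂ)‖ ≤ 1 := by
        rw [norm_div, norm_one, Complex.norm_natCast]
        exact div_le_one_of_le₀ (by exact_mod_cast j.factorial_pos) (by positivity)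
      have g4 : (1 : ℝ) ≤ (s - l).factorial := by exact_mod_cast (s - l).factorial_pos
      rw [norm_mul, norm_div (_ * _), norm_mul (1 / _), Complex.norm_natCast]
      refine le_trans (b := (1 : ℝ) * (1 * 2 / 1)) ?_ (by norm_num)
      gcongr
    refine (summable_nome_pow (norm_nome_lt_one hτ) hle j).congr fun p => ?_
    simp only [c]
    ring
  simp only [hF]
  rw [intervalIntegral.integral_const_mul, ← hsum.tsum_eq]
  simp only [hFint, Finset.mul_sum]
  rw [Summable.tsum_finsetSum hS, Finset.mul_sum]
  refine Finset.sum_congr rfl fun l _ => ?_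
  rw [lambertCoeff, ← tsum_neg, ← tsum_mul_left, ← tsum_div_const]
  refine tsum_congr fun p => ?_
  have hm : ((p.1 + 1 : ℕ) : ℂ) ≠ 0 := by exact_mod_cast Nat.succ_ne_zero p.1
  have h2 : (2 * π * I : ℂ) ≠ 0 := two_pi_I_ne_zero
  simp only [c]
  rw [pow_succ (2 * π * I * (p.1 + 1 : ℕ) : ℂ) l]
  generalize (2 * π * I : ℂ) = A at *
  field_simp

/-! ### The values -/

lemma ellMZV_zero_cons {τ : ℂ} (hτ : 0 < τ.im) (s : ℕ) :
    ellMZV (0 :: List.replicate s 0) τ / (2 * π * I) ^ s = 2 * π * I / (s + 1).factorial := by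
  obtain ⟨M, hM0, hM⟩ := Continuous.halfHolder (continuous_const (y := (2 * π * I : ℂ)))
  have h := ellMZV_of_isBigO hτ 0 s (f := fun _ => 2 * π * I) (d := 0)
    (c := ∫ t in (0 : ℝ)..1, (2 * π * I : ℂ) * (t : ℂ) ^ s)
    (fun t ht => omega_zero hτ ht) (by simpa using hM.isBigO_truncated hM0 s)
  rw [h]
  have h2 := integral_sub_pow 0 1 s
  simp only [Complex.ofReal_zero, sub_zero, Complex.ofReal_one, one_pow] at h2
  rw [intervalIntegral.integral_div] at h2
  rw [intervalIntegral.integral_const_mul, mul_div_assoc, h2, mul_one_div]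

/-- The sequence `c` collects the regularized integrals of `π cot πt` against `t^s / s!`. It is
quantified before `τ`: its independence of `τ` is all that is used later, and its values never
matter. -/
lemma exists_ellMZV_succ_cons : ∃ c : ℕ → ℂ, ∀ {τ : ℂ}, 0 < τ.im → ∀ j s : ℕ,
    ellMZV ((j + 1) :: List.replicate s 0) τ / (2 * π * I) ^ s =
      (if j = 0 then c s else 0) + cotCoeff j / (2 * π * I) ^ j / (s + 1).factorial +
        ∑ l ∈ Finset.range s, lambertCoeff τ j l / (s - l).factorial := by
  choose c d hcd using exists_cot_expansion
  refine ⟨fun s => c s / s.factorial, fun {τ} hτ j s => ?_⟩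
  have hcont : Continuous fun t => cotCoeff j / (2 * π * I) ^ j + trigCoeff τ j t :=
    continuous_const.add (continuous_trigCoeff hτ j)
  obtain ⟨M, hM0, hM⟩ := Continuous.halfHolder hcont
  have h1 := hM.isBigO_truncated hM0 s
  have hI : (∫ t in (0 : ℝ)..1, (cotCoeff j / (2 * π * I) ^ j + trigCoeff τ j t) * (t : ℂ) ^ s) /
      s.factorial = cotCoeff j / (2 * π * I) ^ j / (s + 1).factorial +
        ∑ l ∈ Finset.range s, lambertCoeff τ j l / (s - l).factorial := by
    have h2 := integral_sub_pow 0 1 s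
    simp only [Complex.ofReal_zero, sub_zero, Complex.ofReal_one, one_pow] at h2
    have h3 := continuous_trigCoeff hτ j
    rw [← integral_trigCoeff hτ, ← mul_one_div (cotCoeff j / (2 * π * I) ^ j), ← h2,
      ← intervalIntegral.integral_const_mul, ← intervalIntegral.integral_add
      (Continuous.intervalIntegrable (by fun_prop) _ _)
      (Continuous.intervalIntegrable (by fun_prop) _ _), ← intervalIntegral.integral_div]
    congr 1
    ext t
    ring
  by_cases hj : j = 0
  · rw [ellMZV_of_isBigO hτ (j + 1) s (c := c s + ∫ t in (0 : ℝ)..1,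
      (cotCoeff j / (2 * π * I) ^ j + trigCoeff τ j t) * (t : ℂ) ^ s) (d := d s)
      (f := fun t => (π * Complex.cot (π * t)) + (cotCoeff j / (2 * π * I) ^ j + trigCoeff τ j t))
      (fun t ht => by rw [omega_succ hτ ht, if_pos hj, add_assoc]), add_div, hI, if_pos hj,
      add_assoc]
    refine ((hcd s).add h1).congr' ?_ EventuallyEq.rfl
    filter_upwards [Ioo_mem_nhdsGT (show (0 : ℝ) < 1 / 2 by norm_num)] with ε hε
    have i1 : IntervalIntegrable (fun t : ℝ => (π * Complex.cot (π * t)) * ((t : ℂ) - ε) ^ s)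
        volume ε (1 - ε) := by
      have g1 : IntervalIntegrable (fun t : ℝ => ((π * Real.cot (π * t) : ℝ) : ℂ)) volume ε (1 - ε) := by
        refine intervalIntegrable_ofReal (ContinuousOn.intervalIntegrable ?_)
        rw [Set.uIcc_of_le (by linarith [hε.2])]
        exact continuousOn_cot hε.1
      have g2 := g1.mul_continuousOn (g := fun t : ℝ => ((t : ℂ) - ε) ^ s)
        (Continuous.continuousOn (by fun_prop))
      simpa using g2
    have i2 : IntervalIntegrable (fun t : ℝ => (cotCoeff j / (2 * π * I) ^ j + trigCoeff τ j t) *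
        ((t : ℂ) - ε) ^ s) volume ε (1 - ε) :=
      Continuous.intervalIntegrable (by fun_prop) _ _
    simp only [add_mul _ _ ((_ : ℂ) ^ s)]
    simp only [add_mul] at i2
    rw [intervalIntegral.integral_add i1 i2]
    ring
  · rw [ellMZV_of_isBigO hτ (j + 1) s (c := ∫ t in (0 : ℝ)..1,
      (cotCoeff j / (2 * π * I) ^ j + trigCoeff τ j t) * (t : ℂ) ^ s) (d := 0)
      (f := fun t => (cotCoeff j / (2 * π * I) ^ j + trigCoeff τ j t))
      (fun t ht => by rw [omega_succ hτ ht, if_neg hj, zero_add]), hI, if_neg hj, zero_add]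
    simpa using h1

end EllMZV

end

noncomputable section

namespace EllMZV

open Complex Filter Topology
open scoped Real

/-! ### The values at the cusp -/

lemma norm_lambert_factor_le (j l : ℕ) (p : ℕ × ℕ) :
    ‖(((-1) ^ l + (-1) ^ j) /
      (j.factorial * ((p.1 + 1 : ℕ) * (2 * π * I * (p.1 + 1 : ℕ)) ^ l)) : ℂ)‖ ≤ 2 := by
  have h1 : (1 : ℝ) ≤ (p.1 + 1 : ℕ) := by exact_mod_cast Nat.succ_le_succ (Nat.zero_le p.1)
  have g1 : 1 ≤ ‖(2 * π * I * (p.1 + 1 : ℕ) : ℂ) ^ l‖ := by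
    rw [norm_pow]
    refine one_le_pow₀ ?_
    rw [norm_two_pi_I_mul, Complex.norm_natCast]
    nlinarith [Real.pi_gt_three]
  have g2 : ‖((-1) ^ l + (-1) ^ j : ℂ)‖ ≤ 2 := by
    refine (norm_add_le _ _).trans (le_of_eq ?_)
    rw [norm_pow, norm_pow]; norm_num
  have g3 : (1 : ℝ) ≤ j.factorial := by exact_mod_cast j.factorial_pos
  rw [norm_div, norm_mul, norm_mul, Complex.norm_natCast, Complex.norm_natCast]
  have g4 : 1 ≤ (j.factorial : ℝ) * ((p.1 + 1 : ℕ) * ‖(2 * π * I * (p.1 + 1 : ℕ) : ℂ) ^ l‖) :=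
    one_le_mul_of_one_le_of_one_le g3 (one_le_mul_of_one_le_of_one_le h1 g1)
  exact (div_le_self (norm_nonneg _) g4).trans g2

/-- Every term carries a positive power of `q`, and `q → 0`. Once `|q| < 1/2`, the series at `q =
1/2` dominates. -/
lemma tendsto_lambertCoeff (j l : ℕ) :
    Tendsto (fun τ : ℂ => lambertCoeff τ j l) (comap Complex.im atTop) (𝓝 0) := by
  have hq : Tendsto (fun τ : ℂ => cexp (2 * π * I * τ)) (comap Complex.im atTop) (𝓝 0) := by
    rw [tendsto_zero_iff_norm_tendsto_zero]
    simp only [norm_nome]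
    have hpi := Real.pi_pos
    refine Real.tendsto_exp_neg_atTop_nhds_zero.comp ?_
    exact (tendsto_comap (f := Complex.im)).const_mul_atTop (by positivity)
  have hs := (summable_nome_pow (Q := (1 / 2 : ℝ)) (by
    rw [Complex.norm_real]; norm_num) (a := fun _ => 2) (C := 2) (fun _ => by simp) j).norm
  have h := tendsto_tsum_of_dominated_convergence (𝓕 := comap Complex.im atTop)
    (f := fun (τ : ℂ) (p : ℕ × ℕ) => cexp (2 * π * I * τ) ^ ((p.1 + 1) * (p.2 + 1)) *
    (((p.2 + 1 : ℕ) : ℂ) ^ j * (((-1) ^ l + (-1) ^ j) /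
      (j.factorial * ((p.1 + 1 : ℕ) * (2 * π * I * (p.1 + 1 : ℕ)) ^ l)))))
    (g := fun _ => 0) hs (fun p => ?_) ?_
  · rw [tsum_zero] at h
    simpa [lambertCoeff] using h.neg
  · have h1 := (hq.pow ((p.1 + 1) * (p.2 + 1))).mul_const (((p.2 + 1 : ℕ) : ℂ) ^ j *
      (((-1) ^ l + (-1) ^ j) / (j.factorial * ((p.1 + 1 : ℕ) * (2 * π * I * (p.1 + 1 : ℕ)) ^ l))))
    rwa [zero_pow (by positivity), zero_mul] at h1
  · have h1 : ∀ᶠ τ : ℂ in comap Complex.im atTop, ‖cexp (2 * π * I * τ)‖ < 1 / 2 :=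
      (tendsto_zero_iff_norm_tendsto_zero.1 hq).eventually (gt_mem_nhds (by norm_num))
    filter_upwards [h1] with τ hτ p
    rw [norm_mul, norm_mul, norm_mul, norm_mul, norm_pow (cexp _), norm_pow (((1 / 2 : ℝ)) : ℂ),
      norm_pow (((p.2 + 1 : ℕ)) : ℂ), Complex.norm_real, Complex.norm_ofNat, Real.norm_of_nonneg (by norm_num : (0 : ℝ) ≤ 1 / 2)]
    gcongr
    exact norm_lambert_factor_le j l p

/-- The constant coefficient of `qExpansion` is the value of the cusp function at `q = 0`, which is
defined as a limit along `q → 0`. Hence a limit at `i∞` suffices, with no regularity in `τ` to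
check. -/
lemma ellMZVInf_eq_of_tendsto {l : List ℕ} {a : ℂ}
    (h : Tendsto (fun τ : ℂ => ellMZV l τ) (comap Complex.im atTop) (𝓝 a)) : ellMZVInf l = a := by
  have h1 : ellMZVInf l =
      UpperHalfPlane.cuspFunction 1 (fun τ : UpperHalfPlane => ellMZV l τ) 0 := by
    rw [ellMZVInf, UpperHalfPlane.qExpansion]
    simp
  rw [h1, UpperHalfPlane.cuspFunction, Function.Periodic.cuspFunction_zero_eq_limUnder_nhds_ne]
  refine Tendsto.limUnder_eq ?_
  have h2 : Tendsto (fun τ : ℂ => ((fun τ : UpperHalfPlane => ellMZV l τ) ∘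
      UpperHalfPlane.ofComplex) τ) (comap Complex.im atTop) (𝓝 a) := by
    refine h.congr' ?_
    have : ∀ᶠ τ : ℂ in comap Complex.im atTop, 0 < τ.im :=
      tendsto_comap.eventually (eventually_gt_atTop 0)
    filter_upwards [this] with τ hτ
    rw [Function.comp_apply, UpperHalfPlane.ofComplex_apply_of_im_pos hτ]
  refine (h2.comp (Function.Periodic.invQParam_tendsto one_pos)).congr' ?_
  filter_upwards [self_mem_nhdsWithin] with q hq
  rw [Function.Periodic.cuspFunction_eq_of_nonzero _ _ hq]
  rfl

lemma eventually_im_pos : ∀ᶠ τ : ℂ in comap Complex.im atTop, 0 < τ.im :=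
  tendsto_comap.eventually (eventually_gt_atTop 0)

lemma ellMZVInf_zero_cons (s : ℕ) :
    ellMZVInf (0 :: List.replicate s 0) / (2 * π * I) ^ s = 2 * π * I / (s + 1).factorial := by
  have h2 : (2 * π * I : ℂ) ^ s ≠ 0 := pow_ne_zero _ two_pi_I_ne_zero
  rw [div_eq_iff h2]
  refine ellMZVInf_eq_of_tendsto (tendsto_const_nhds.congr' ?_)
  filter_upwards [eventually_im_pos] with τ hτ
  rw [← ellMZV_zero_cons hτ, div_mul_cancel₀ _ h2]

lemma ellMZVInf_succ_cons {c : ℕ → ℂ} (hc : ∀ {τ : ℂ}, 0 < τ.im → ∀ j s : ℕ,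
    ellMZV ((j + 1) :: List.replicate s 0) τ / (2 * π * I) ^ s =
      (if j = 0 then c s else 0) + cotCoeff j / (2 * π * I) ^ j / (s + 1).factorial +
        ∑ l ∈ Finset.range s, lambertCoeff τ j l / (s - l).factorial) (j s : ℕ) :
    ellMZVInf ((j + 1) :: List.replicate s 0) / (2 * π * I) ^ s =
      (if j = 0 then c s else 0) + cotCoeff j / (2 * π * I) ^ j / (s + 1).factorial := by
  have h2 : (2 * π * I : ℂ) ^ s ≠ 0 := pow_ne_zero _ two_pi_I_ne_zero
  rw [div_eq_iff h2]
  refine ellMZVInf_eq_of_tendsto ?_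
  have h3 : Tendsto (fun τ : ℂ => ((if j = 0 then c s else 0) +
      cotCoeff j / (2 * π * I) ^ j / (s + 1).factorial +
        ∑ l ∈ Finset.range s, lambertCoeff τ j l / (s - l).factorial) * (2 * π * I) ^ s)
      (comap Complex.im atTop) (𝓝 (((if j = 0 then c s else 0) +
      cotCoeff j / (2 * π * I) ^ j / (s + 1).factorial +
        ∑ l ∈ Finset.range s, 0 / ((s - l).factorial : ℂ)) * (2 * π * I) ^ s)) :=
    (tendsto_const_nhds.add (tendsto_finsetSum _ fun l _ =>
      (tendsto_lambertCoeff j l).div_const _)).mul_const _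
  simp only [zero_div, Finset.sum_const_zero, add_zero] at h3
  refine h3.congr' ?_
  filter_upwards [eventually_im_pos] with τ hτ
  rw [← hc hτ, div_mul_cancel₀ _ h2]

end EllMZV

end

/-! ### Power series in two variables inside iterated Laurent series. -/

noncomputable section

namespace EllMZV

open Complex Filter Topology
open scoped Real

lemma coeff_biSeries (f : ℕ → ℕ → ℂ) (e : Fin 2 →₀ ℕ) :
    MvPowerSeries.coeff e (biSeries f) = f (e 0) (e 1) := rfl

lemma single_add_single_apply (e : Fin 2 →₀ ℕ) :
    Finsupp.single 0 (e 0) + Finsupp.single 1 (e 1) = e := by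
  ext i; fin_cases i <;> simp

lemma single_add_single_eq_iff (n m : ℕ) (e : Fin 2 →₀ ℕ) :
    Finsupp.single 0 n + Finsupp.single 1 m = e ↔ n = e 0 ∧ m = e 1 := by
  constructor
  · rintro rfl; simp
  · rintro ⟨rfl, rfl⟩; exact single_add_single_apply e

lemma sum_antidiagonal_fin_two {M : Type*} [AddCommMonoid M] (e : Fin 2 →₀ ℕ)
    (F : (Fin 2 →₀ ℕ) × (Fin 2 →₀ ℕ) → M) :
    ∑ p ∈ Finset.HasAntidiagonal.antidiagonal e, F p =
      ∑ p ∈ Finset.HasAntidiagonal.antidiagonal (e 0), ∑ r ∈ Finset.HasAntidiagonal.antidiagonal (e 1),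
        F (Finsupp.single 0 p.1 + Finsupp.single 1 r.1,
          Finsupp.single 0 p.2 + Finsupp.single 1 r.2) := by
  rw [← Finset.sum_product']
  refine Finset.sum_nbij' (fun x => ((x.1 0, x.2 0), (x.1 1, x.2 1)))
    (fun y => (Finsupp.single 0 y.1.1 + Finsupp.single 1 y.2.1,
      Finsupp.single 0 y.1.2 + Finsupp.single 1 y.2.2)) ?_ ?_ ?_ ?_ ?_
  · intro x hx
    rw [Finset.HasAntidiagonal.mem_antidiagonal] at hx
    simp [← hx]
  · intro y hy
    simp only [Finset.mem_product, Finset.HasAntidiagonal.mem_antidiagonal] at hy ⊢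
    ext i
    fin_cases i
    · simpa using hy.1
    · simpa using hy.2
  · intro x _
    simp [single_add_single_apply]
  · intro y _
    simp
  · intro x _
    simp [single_add_single_apply]

lemma biSeries_mul (f g : ℕ → ℕ → ℂ) :
    biSeries f * biSeries g = biSeries fun i j => ∑ p ∈ Finset.HasAntidiagonal.antidiagonal i,
      ∑ r ∈ Finset.HasAntidiagonal.antidiagonal j, f p.1 r.1 * g p.2 r.2 := by
  ext e
  rw [MvPowerSeries.coeff_mul, sum_antidiagonal_fin_two, coeff_biSeries]
  simp [coeff_biSeries]

/-- A power series in two variables as a power series in `Y` over power series in `X`. -/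
def iterSeries (P : MvPowerSeries (Fin 2) ℂ) : PowerSeries (PowerSeries ℂ) :=
  PowerSeries.mk fun j => PowerSeries.mk fun i =>
    MvPowerSeries.coeff (Finsupp.single 0 i + Finsupp.single 1 j) P

/-- `iterSeries` as a ring homomorphism. -/
def iterSeriesHom : MvPowerSeries (Fin 2) ℂ →+* PowerSeries (PowerSeries ℂ) where
  toFun := iterSeries
  map_zero' := by ext; simp [iterSeries]
  map_one' := by
    ext j i
    simp only [iterSeries, PowerSeries.coeff_mk, MvPowerSeries.coeff_one, PowerSeries.coeff_one]
    have : (Finsupp.single (0 : Fin 2) i + Finsupp.single 1 j = 0) ↔ j = 0 ∧ i = 0 := by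
      rw [add_eq_zero, Finsupp.single_eq_zero, Finsupp.single_eq_zero, and_comm]
    by_cases hj : j = 0
    · simp [hj, PowerSeries.coeff_one]
    · simp [this, hj]
  map_add' P Q := by ext; simp [iterSeries]
  map_mul' P Q := by
    ext j i
    rw [PowerSeries.coeff_mul, map_sum]
    simp only [iterSeries, PowerSeries.coeff_mk, PowerSeries.coeff_mul]
    rw [MvPowerSeries.coeff_mul, sum_antidiagonal_fin_two, Finset.sum_comm]
    simp

/-- The embedding `toLaurent` as a ring homomorphism. -/
def toLaurentHom : MvPowerSeries (Fin 2) ℂ →+* Laurent2 :=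
  (HahnSeries.ofPowerSeries ℤ (LaurentSeries ℂ)).comp
    ((PowerSeries.map (HahnSeries.ofPowerSeries ℤ ℂ)).comp iterSeriesHom)

lemma toLaurentHom_apply (P : MvPowerSeries (Fin 2) ℂ) : toLaurentHom P = toLaurent P := by
  change HahnSeries.ofPowerSeries ℤ (LaurentSeries ℂ) _ = HahnSeries.ofPowerSeries ℤ _ _
  congr 1

lemma coeff_toLaurent (P : MvPowerSeries (Fin 2) ℂ) (i j : ℤ) :
    ((toLaurent P).coeff j).coeff i = if 0 ≤ i ∧ 0 ≤ j then
      MvPowerSeries.coeff (Finsupp.single 0 i.toNat + Finsupp.single 1 j.toNat) P else 0 := by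
  rw [toLaurent, PowerSeries.coeff_coe]
  by_cases hj : j < 0
  · rw [if_pos hj, if_neg (by omega)]; rfl
  · rw [if_neg hj, PowerSeries.coeff_mk, PowerSeries.coeff_coe]
    by_cases hi : i < 0
    · rw [if_pos hi, if_neg (by omega)]
    · rw [if_neg hi, if_pos (by omega), PowerSeries.coeff_mk]
      congr 3 <;> congr 1 <;> omega

lemma toLaurent_injective : Function.Injective toLaurent := by
  intro P Q h
  ext e
  have := congrArg (fun S : Laurent2 => (S.coeff (e 1 : ℤ)).coeff (e 0 : ℤ)) h
  simpa [coeff_toLaurent, single_add_single_apply] using this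

lemma coeff_laplaceInv_rePart (S : Laurent2) (i j : ℤ) :
    ((laplaceInv (rePart S)).coeff j).coeff i =
      if 0 ≤ i + j then ((i + j).toNat.factorial : ℂ) * (((S.coeff j).coeff i).re : ℂ) else 0 :=
  rfl

lemma laplaceInv_rePart_sub (S T : Laurent2) :
    laplaceInv (rePart (S - T)) = laplaceInv (rePart S) - laplaceInv (rePart T) := by
  ext j i
  rw [HahnSeries.coeff_sub, HahnSeries.coeff_sub]
  simp only [coeff_laplaceInv_rePart, HahnSeries.coeff_sub]
  split_ifs
  · rw [Complex.sub_re]; push_cast; ring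
  · simp

lemma laplaceInv_rePart_add (S T : Laurent2) :
    laplaceInv (rePart (S + T)) = laplaceInv (rePart S) + laplaceInv (rePart T) := by
  ext j i
  rw [HahnSeries.coeff_add, HahnSeries.coeff_add]
  simp only [coeff_laplaceInv_rePart, HahnSeries.coeff_add]
  split_ifs
  · rw [Complex.add_re]; push_cast; ring
  · simp

/-- The action of `L⁻¹ ∘ Re` on power series. -/
def laplaceRe (P : MvPowerSeries (Fin 2) ℂ) : MvPowerSeries (Fin 2) ℂ :=
  fun e => ((e 0 + e 1).factorial : ℂ) * ((MvPowerSeries.coeff e P).re : ℂ)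

lemma coeff_laplaceRe (P : MvPowerSeries (Fin 2) ℂ) (e : Fin 2 →₀ ℕ) :
    MvPowerSeries.coeff e (laplaceRe P) =
      ((e 0 + e 1).factorial : ℂ) * ((MvPowerSeries.coeff e P).re : ℂ) := rfl

lemma laplaceInv_rePart_toLaurent (P : MvPowerSeries (Fin 2) ℂ) :
    laplaceInv (rePart (toLaurent P)) = toLaurent (laplaceRe P) := by
  ext j i
  rw [coeff_laplaceInv_rePart, coeff_toLaurent, coeff_toLaurent]
  by_cases h : 0 ≤ i ∧ 0 ≤ j
  · rw [if_pos h, if_pos h, if_pos (by omega), coeff_laplaceRe]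
    obtain ⟨n, rfl⟩ := Int.eq_ofNat_of_zero_le h.1
    obtain ⟨m, rfl⟩ := Int.eq_ofNat_of_zero_le h.2
    have h2 : ((n : ℤ) + (m : ℤ)).toNat = n + m := by omega
    simp [h2]
  · rw [if_neg h, if_neg h]
    simp

lemma toLaurent_smul (c : ℂ) (P : MvPowerSeries (Fin 2) ℂ) :
    c • toLaurent P = toLaurent (MvPowerSeries.C c * P) := by
  ext j i
  rw [HahnSeries.coeff_smul, HahnSeries.coeff_smul, coeff_toLaurent, coeff_toLaurent]
  split_ifs <;> simp

lemma coeff_lin (a b : ℂ) (e : Fin 2 →₀ ℕ) : MvPowerSeries.coeff e (lin a b) =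
    if e = Finsupp.single 0 1 then a else if e = Finsupp.single 1 1 then b else 0 := by
  have h01 : (Finsupp.single 0 1 : Fin 2 →₀ ℕ) ≠ Finsupp.single 1 1 := by
    intro h
    simpa using DFunLike.congr_fun h 0
  rw [lin, map_add, MvPowerSeries.coeff_C_mul, MvPowerSeries.coeff_C_mul,
    MvPowerSeries.coeff_X, MvPowerSeries.coeff_X]
  split_ifs with h1 h2 h2
  · exact absurd (h1.symm.trans h2) h01
  all_goals simp

lemma coeff_single_single (m n i j : ℤ) (c : ℂ) :
    ((HahnSeries.single m (HahnSeries.single n c) : Laurent2).coeff j).coeff i =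
      if j = m ∧ i = n then c else 0 := by
  rw [HahnSeries.coeff_single]
  by_cases hj : j = m
  · rw [if_pos hj, HahnSeries.coeff_single]; simp [hj]
  · rw [if_neg hj, if_neg (by tauto)]; rfl

lemma toLaurent_lin (a b : ℂ) : toLaurent (lin a b) =
    HahnSeries.single 0 (HahnSeries.single 1 a) + HahnSeries.single 1 (HahnSeries.single 0 b) := by
  ext j i
  rw [coeff_toLaurent, HahnSeries.coeff_add, HahnSeries.coeff_add, coeff_single_single,
    coeff_single_single, coeff_lin]
  by_cases h : 0 ≤ i ∧ 0 ≤ j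
  · obtain ⟨n, rfl⟩ := Int.eq_ofNat_of_zero_le h.1
    obtain ⟨m, rfl⟩ := Int.eq_ofNat_of_zero_le h.2
    have h1 := single_add_single_eq_iff n m (Finsupp.single 0 1)
    have h2 := single_add_single_eq_iff n m (Finsupp.single 1 1)
    simp only [Finsupp.single_apply] at h1 h2
    simp only [Int.toNat_natCast, h1, h2]
    by_cases hn : n = 1 <;> by_cases hm : m = 0 <;> by_cases hn' : n = 0 <;>
      by_cases hm' : m = 1 <;> simp_all
  · rw [if_neg h, if_neg (by omega), if_neg (by omega), add_zero]

/-- The inverse of `aX + bY` in the field of iterated Laurent series. -/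
def linInv (a b : ℂ) : Laurent2 :=
  HahnSeries.ofPowerSeries ℤ (LaurentSeries ℂ) (PowerSeries.mk fun k =>
    HahnSeries.single (-1 - k : ℤ) ((-b) ^ k / a ^ (k + 1)))

lemma coeff_linInv (a b : ℂ) (i j : ℤ) : ((linInv a b).coeff j).coeff i =
    if 0 ≤ j ∧ i = -1 - j then (-b) ^ j.toNat / a ^ (j.toNat + 1) else 0 := by
  rw [linInv, PowerSeries.coeff_coe]
  by_cases hj : j < 0
  · rw [if_pos hj, if_neg (by omega)]; rfl
  · obtain ⟨n, rfl⟩ := Int.eq_ofNat_of_zero_le (not_lt.1 hj)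
    rw [if_neg hj, PowerSeries.coeff_mk, HahnSeries.coeff_single]
    simp

/-- In `ℂ((X))((Y))` the inverse is the geometric series in `Y/X`; the product telescopes to its
first term. -/
lemma toLaurent_lin_mul_linInv {a : ℂ} (ha : a ≠ 0) (b : ℂ) :
    toLaurent (lin a b) * linInv a b = 1 := by
  ext j i
  rw [toLaurent_lin, show ∀ A B C : Laurent2, (A + B) * C = A * C + B * C from
    fun A B C => by ring, HahnSeries.coeff_add, HahnSeries.coeff_add,
    HahnSeries.coeff_single_mul, HahnSeries.coeff_single_mul, HahnSeries.coeff_single_mul,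
    HahnSeries.coeff_single_mul, coeff_linInv, coeff_linInv]
  have h1 : ((1 : Laurent2).coeff j).coeff i = if j = 0 ∧ i = 0 then 1 else 0 :=
    coeff_single_single 0 0 i j 1
  rw [h1]
  rcases lt_trichotomy j 0 with hj | rfl | hj
  · rw [if_neg (by omega), if_neg (by omega), if_neg (by omega)]; simp
  · rw [if_neg (show ¬ (0 ≤ (0 : ℤ) - 1 ∧ i - 0 = -1 - (0 - 1)) by omega)]
    by_cases hi : i = 0
    · subst hi; simp [ha]
    · rw [if_neg (by omega), if_neg (by omega)]; simp
  · obtain ⟨n, rfl⟩ : ∃ n : ℕ, j = (n : ℤ) + 1 := ⟨(j - 1).toNat, by omega⟩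
    rw [if_neg (show ¬ ((n : ℤ) + 1 = 0 ∧ i = 0) by omega)]
    by_cases hi : i = -1 - (n : ℤ)
    · rw [if_pos (by omega), if_pos (by omega),
        show ((n : ℤ) + 1 - 0).toNat = n + 1 by omega, show ((n : ℤ) + 1 - 1).toNat = n by omega]
      field_simp
      ring
    · rw [if_neg (by omega), if_neg (by omega)]; simp

lemma toLaurent_C (c : ℂ) :
    toLaurent (MvPowerSeries.C c) = HahnSeries.single 0 (HahnSeries.single 0 c) := by
  ext j i
  rw [coeff_toLaurent, coeff_single_single, MvPowerSeries.coeff_C]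
  by_cases h : 0 ≤ i ∧ 0 ≤ j
  · obtain ⟨n, rfl⟩ := Int.eq_ofNat_of_zero_le h.1
    obtain ⟨m, rfl⟩ := Int.eq_ofNat_of_zero_le h.2
    simp [and_comm]
  · rw [if_neg h, if_neg (by omega)]

lemma toLaurent_lin_zero_mul {v : ℂ} (hv : v ≠ 0) :
    toLaurent (lin 0 v) * (HahnSeries.single (-1) (HahnSeries.single 0 v⁻¹) : Laurent2) = 1 := by
  rw [toLaurent_lin]
  have : (HahnSeries.single 0 (HahnSeries.single 1 (0 : ℂ)) : Laurent2) = 0 := by simp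
  rw [this, show ∀ A B : Laurent2, (0 + A) * B = A * B from fun A B => by ring,
    HahnSeries.single_mul_single, HahnSeries.single_mul_single, mul_inv_cancel₀ hv]
  rfl

lemma toLaurent_lin_ne_zero {a : ℂ} (ha : a ≠ 0) (b : ℂ) : toLaurent (lin a b) ≠ 0 :=
  left_ne_zero_of_mul_eq_one (M₀ := Laurent2) (toLaurent_lin_mul_linInv ha b)

lemma toLaurent_lin_zero_ne_zero {v : ℂ} (hv : v ≠ 0) : toLaurent (lin 0 v) ≠ 0 :=
  left_ne_zero_of_mul_eq_one (M₀ := Laurent2) (toLaurent_lin_zero_mul hv)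

lemma div_mul_eq_of_mul_eq_one {K : Type*} [Field K] {c u v u' v' : K} (hu : u * u' = 1)
    (hv : v * v' = 1) : c / (u * v) = c * v' * u' := by
  have h1 := left_ne_zero_of_mul_eq_one hu
  have h2 := left_ne_zero_of_mul_eq_one hv
  rw [eq_inv_of_mul_eq_one_right hu, eq_inv_of_mul_eq_one_right hv]
  field_simp

/-- The series `1 / (UV)`, for linear forms `U = aX + bY` and `V = vY`, is homogeneous of
degree `-2` and thus killed by `L⁻¹`. -/
lemma laplaceInv_rePart_div_lin_mul_lin {a v : ℂ} (ha : a ≠ 0) (hv : v ≠ 0) (b c : ℂ) :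
    laplaceInv (rePart (toLaurent (MvPowerSeries.C c) /
      (toLaurent (lin a b) * toLaurent (lin 0 v)))) = 0 := by
  rw [div_mul_eq_of_mul_eq_one (K := Laurent2) (toLaurent_lin_mul_linInv ha b)
    (toLaurent_lin_zero_mul hv), toLaurent_C]
  rw [HahnSeries.single_mul_single, HahnSeries.single_mul_single]
  ext j i
  rw [coeff_laplaceInv_rePart, HahnSeries.coeff_single_mul, HahnSeries.coeff_single_mul,
    coeff_linInv]
  -- Each of the two inverses is homogeneous of degree `-1`, so no coefficient with `i + j ≥ 0`
  -- occurs.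
  by_cases h : 0 ≤ i + j
  · rw [if_pos h, if_neg (by omega)]; simp
  · rw [if_neg h]; rfl

end EllMZV

end

/-! ### The functional equation of the generating series and the difference of the two quotients. -/

noncomputable section

namespace EllMZV

open Complex Filter Topology
open scoped Real

lemma X_mul_biSeries_zero (f : ℕ → ℕ → ℂ) :
    MvPowerSeries.X 0 * biSeries f = biSeries fun i j => if i = 0 then 0 else f (i - 1) j := by
  ext e
  rw [MvPowerSeries.X, MvPowerSeries.coeff_monomial_mul, coeff_biSeries, coeff_biSeries]
  by_cases h : e 0 = 0 <;> simp [h]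

lemma X_mul_biSeries_one (f : ℕ → ℕ → ℂ) :
    MvPowerSeries.X 1 * biSeries f = biSeries fun i j => if j = 0 then 0 else f i (j - 1) := by
  ext e
  rw [MvPowerSeries.X, MvPowerSeries.coeff_monomial_mul, coeff_biSeries, coeff_biSeries]
  by_cases h : e 1 = 0 <;> simp [h]

lemma hasSubst_of_constantCoeff {U : MvPowerSeries (Fin 2) ℂ}
    (hU : MvPowerSeries.constantCoeff U = 0) : PowerSeries.HasSubst U :=
  PowerSeries.HasSubst.of_constantCoeff_zero hU

lemma hasSubst_pair {U V : MvPowerSeries (Fin 2) ℂ}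
    (hU : MvPowerSeries.constantCoeff U = 0) (hV : MvPowerSeries.constantCoeff V = 0) :
    MvPowerSeries.HasSubst ![U, V] :=
  MvPowerSeries.hasSubst_of_constantCoeff_zero fun s => by fin_cases s <;> assumption

lemma coeff_subst_X (s : Fin 2) (k : ℕ → ℂ) (e : Fin 2 →₀ ℕ) :
    MvPowerSeries.coeff e (PowerSeries.subst (MvPowerSeries.X s : MvPowerSeries (Fin 2) ℂ)
      (PowerSeries.mk k)) = if e = Finsupp.single s (e s) then k (e s) else 0 := by
  rw [PowerSeries.coeff_subst (hasSubst_of_constantCoeff (MvPowerSeries.constantCoeff_X s)),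
    finsum_eq_single _ (e s)]
  · simp [MvPowerSeries.coeff_X_pow]
  · intro n hn
    rw [MvPowerSeries.coeff_X_pow, if_neg, smul_zero]
    rintro rfl
    simp at hn

lemma subst_X_zero (k : ℕ → ℂ) :
    PowerSeries.subst (MvPowerSeries.X 0 : MvPowerSeries (Fin 2) ℂ) (PowerSeries.mk k) =
      biSeries fun i j => if j = 0 then k i else 0 := by
  ext e
  have h : e = Finsupp.single 0 (e 0) ↔ e 1 = 0 := by
    rw [DFunLike.ext_iff, Fin.forall_fin_two]; simp
  rw [coeff_subst_X, coeff_biSeries]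
  simp only [h]

lemma subst_X_one (k : ℕ → ℂ) :
    PowerSeries.subst (MvPowerSeries.X 1 : MvPowerSeries (Fin 2) ℂ) (PowerSeries.mk k) =
      biSeries fun i j => if i = 0 then k j else 0 := by
  ext e
  have h : e = Finsupp.single 1 (e 1) ↔ e 0 = 0 := by
    rw [DFunLike.ext_iff, Fin.forall_fin_two]; simp
  rw [coeff_subst_X, coeff_biSeries]
  simp only [h]

/-- Coefficients that depend only on `i + j` telescope along antidiagonals, leaving the pure powers
of `X` and of `Y`. -/
lemma X_sub_X_mul_biSeries (k : ℕ → ℂ) :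
    (MvPowerSeries.X 0 - MvPowerSeries.X 1) * biSeries (fun i j => k (i + j + 1)) =
      PowerSeries.subst (MvPowerSeries.X 0 : MvPowerSeries (Fin 2) ℂ) (PowerSeries.mk k) -
      PowerSeries.subst (MvPowerSeries.X 1 : MvPowerSeries (Fin 2) ℂ) (PowerSeries.mk k) := by
  rw [sub_mul, X_mul_biSeries_zero, X_mul_biSeries_one, subst_X_zero, subst_X_one]
  ext e
  rw [map_sub, map_sub, coeff_biSeries, coeff_biSeries, coeff_biSeries, coeff_biSeries]
  rcases e 0 with _ | i <;> rcases e 1 with _ | j <;> simp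
  rw [show i + (j + 1) + 1 = i + 1 + j + 1 by ring, sub_self]

lemma subst_subst_X {U V : MvPowerSeries (Fin 2) ℂ}
    (hU : MvPowerSeries.constantCoeff U = 0) (hV : MvPowerSeries.constantCoeff V = 0)
    (s : Fin 2) (f : PowerSeries ℂ) :
    MvPowerSeries.subst ![U, V] (PowerSeries.subst
      (MvPowerSeries.X s : MvPowerSeries (Fin 2) ℂ) f) = PowerSeries.subst (![U, V] s) f := by
  have h := hasSubst_pair hU hV
  rw [PowerSeries.subst, MvPowerSeries.subst_comp_subst_apply
    (hasSubst_of_constantCoeff (MvPowerSeries.constantCoeff_X s)).const h,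
    MvPowerSeries.subst_X h]
  rfl

/-- The divided difference `(k(U) - k(V)) / (U - V)` of a power series `k`. -/
lemma sub_mul_subst_biSeries {U V : MvPowerSeries (Fin 2) ℂ}
    (hU : MvPowerSeries.constantCoeff U = 0) (hV : MvPowerSeries.constantCoeff V = 0)
    (k : ℕ → ℂ) :
    (U - V) * MvPowerSeries.subst ![U, V] (biSeries fun i j => k (i + j + 1)) =
      PowerSeries.subst U (PowerSeries.mk k) - PowerSeries.subst V (PowerSeries.mk k) := by
  have h := hasSubst_pair hU hV
  have := congrArg (MvPowerSeries.subst ![U, V]) (X_sub_X_mul_biSeries k)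
  rwa [MvPowerSeries.subst_mul h, MvPowerSeries.subst_sub h, MvPowerSeries.subst_sub h,
    subst_subst_X hU hV, subst_subst_X hU hV, MvPowerSeries.subst_X h, MvPowerSeries.subst_X h]
    at this

/-- The coefficients of `e^Y - 1`. -/
def expSubOneCoeff (j : ℕ) : ℂ := if j = 0 then 0 else 1 / (j.factorial : ℂ)

lemma subst_X_one_exp :
    PowerSeries.subst (MvPowerSeries.X 1 : MvPowerSeries (Fin 2) ℂ) (PowerSeries.exp ℂ) - 1 =
      biSeries fun i j => if i = 0 then expSubOneCoeff j else 0 := by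
  have h : PowerSeries.exp ℂ = PowerSeries.mk fun n => 1 / (n.factorial : ℂ) := by
    ext n; simp [PowerSeries.coeff_exp]
  rw [h, subst_X_one]
  ext e
  rw [map_sub, coeff_biSeries, coeff_biSeries, MvPowerSeries.coeff_one]
  have h0 : e = 0 ↔ e 0 = 0 ∧ e 1 = 0 := by
    rw [DFunLike.ext_iff, Fin.forall_fin_two]; simp
  simp only [h0, expSubOneCoeff]
  by_cases h1 : e 0 = 0 <;> by_cases h2 : e 1 = 0 <;> simp [h1, h2]

/-- The functional equation in `X, Y` that the generating series of depth one satisfies. -/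
lemma X_mul_biSeries_eq {w : ℂ} {b : ℕ → ℕ → ℂ} {c k : ℕ → ℂ} {B : ℕ → ℕ → ℂ}
    (h0 : ∀ s, b 0 s = w / ((s + 1).factorial : ℂ))
    (h1 : ∀ j s, b (j + 1) s = (if j = 0 then c s else 0) + k j / ((s + 1).factorial : ℂ) +
      ∑ l ∈ Finset.range s, B j l / ((s - l).factorial : ℂ)) :
    MvPowerSeries.X 1 * biSeries b =
      MvPowerSeries.C w * (PowerSeries.subst (MvPowerSeries.X 1 : MvPowerSeries (Fin 2) ℂ)
        (PowerSeries.exp ℂ) - 1) +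
      MvPowerSeries.X 0 * (MvPowerSeries.X 1 * PowerSeries.subst
          (MvPowerSeries.X 1 : MvPowerSeries (Fin 2) ℂ) (PowerSeries.mk c) +
        PowerSeries.subst (MvPowerSeries.X 0 : MvPowerSeries (Fin 2) ℂ) (PowerSeries.mk k) *
          (PowerSeries.subst (MvPowerSeries.X 1 : MvPowerSeries (Fin 2) ℂ)
            (PowerSeries.exp ℂ) - 1) +
        MvPowerSeries.X 1 * (biSeries B *
          (PowerSeries.subst (MvPowerSeries.X 1 : MvPowerSeries (Fin 2) ℂ)
            (PowerSeries.exp ℂ) - 1))) := by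
  have hadd : ∀ f g : ℕ → ℕ → ℂ, biSeries f + biSeries g = biSeries fun i j => f i j + g i j :=
    fun f g => rfl
  rw [subst_X_one_exp, subst_X_one, subst_X_zero, biSeries_mul, biSeries_mul,
    X_mul_biSeries_one, X_mul_biSeries_one, X_mul_biSeries_one, hadd, hadd, X_mul_biSeries_zero]
  ext e
  rw [map_add, MvPowerSeries.coeff_C_mul, coeff_biSeries, coeff_biSeries, coeff_biSeries]
  -- A series in `X` alone times a series in `Y` alone: a single term of the convolution survives.
  have hK : ∀ i j, ∑ p ∈ Finset.HasAntidiagonal.antidiagonal i,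
      ∑ r ∈ Finset.HasAntidiagonal.antidiagonal j, (if r.1 = 0 then k p.1 else 0) *
        (if p.2 = 0 then expSubOneCoeff r.2 else 0) = k i * expSubOneCoeff j := by
    intro i j
    rw [Finset.sum_eq_single (i, 0), Finset.sum_eq_single (0, j)]
    · simp
    · rintro ⟨x, y⟩ hx hne
      have hx' := Finset.HasAntidiagonal.mem_antidiagonal.1 hx
      rw [if_neg, zero_mul]
      rintro rfl; simp_all
    · simp
    · rintro ⟨x, y⟩ hx hne
      have hx' := Finset.HasAntidiagonal.mem_antidiagonal.1 hx
      refine Finset.sum_eq_zero fun r _ => ?_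
      rw [if_neg (c := y = 0), mul_zero]
      rintro rfl; simp_all
    · simp
  have hB : ∀ i j, ∑ p ∈ Finset.HasAntidiagonal.antidiagonal i,
      ∑ r ∈ Finset.HasAntidiagonal.antidiagonal j, B p.1 r.1 *
        (if p.2 = 0 then expSubOneCoeff r.2 else 0) =
        ∑ l ∈ Finset.range j, B i l / ((j - l).factorial : ℂ) := by
    intro i j
    rw [Finset.sum_eq_single (i, 0)]
    · rw [Finset.Nat.sum_antidiagonal_eq_sum_range_succ_mk, Finset.sum_range_succ]
      simp only [Nat.sub_self, if_true, expSubOneCoeff, mul_zero, add_zero]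
      refine Finset.sum_congr rfl fun l hl => ?_
      rw [if_neg (by have := Finset.mem_range.1 hl; omega)]
      ring
    · rintro ⟨x, y⟩ hx hne
      have hx' := Finset.HasAntidiagonal.mem_antidiagonal.1 hx
      refine Finset.sum_eq_zero fun r _ => ?_
      rw [if_neg (c := y = 0), mul_zero]
      rintro rfl; simp_all
    · simp
  simp only [hK, hB]
  rcases e 0 with _ | i <;> rcases e 1 with _ | j
  · simp [expSubOneCoeff]
  · simp [expSubOneCoeff, h0]; ring
  · simp [expSubOneCoeff]
  · simp [expSubOneCoeff, h1]; ring

lemma div_div_eq_of_mul_eq {K : Type*} [Field K] {P U V w E c k B : K} (hU : U ≠ 0) (hV : V ≠ 0)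
    (hE : E ≠ 0) (h : V * P = w * E + U * (V * c + k * E + V * (B * E))) :
    P / U / E = w / (U * V) + (c / E + k / V + B) := by
  field_simp
  linear_combination h

/-- The quotient of the generating series by `e^V - 1`. -/
lemma genSeries_div_expSubOne {a : List ℕ → ℂ} {w : ℂ} {c k : ℕ → ℂ} {B : ℕ → ℕ → ℂ}
    (h0 : ∀ s, a (0 :: List.replicate s 0) / (2 * π * I) ^ s = w / ((s + 1).factorial : ℂ))
    (h1 : ∀ j s, a ((j + 1) :: List.replicate s 0) / (2 * π * I) ^ s =
      (if j = 0 then c s else 0) + k j / ((s + 1).factorial : ℂ) +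
      ∑ l ∈ Finset.range s, B j l / ((s - l).factorial : ℂ))
    {U V : MvPowerSeries (Fin 2) ℂ} (hU : MvPowerSeries.constantCoeff U = 0)
    (hV : MvPowerSeries.constantCoeff V = 0) (hU0 : toLaurent U ≠ 0) (hV0 : toLaurent V ≠ 0)
    (hE : expSubOne V ≠ 0) :
    genSeries a U V / expSubOne V =
      toLaurent (MvPowerSeries.C w) / (toLaurent U * toLaurent V) +
      (toLaurent (PowerSeries.subst V (PowerSeries.mk c)) / expSubOne V +
        toLaurent (PowerSeries.subst U (PowerSeries.mk k)) / toLaurent V +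
        toLaurent (MvPowerSeries.subst ![U, V] (biSeries B))) := by
  have h := hasSubst_pair hU hV
  have key := congrArg (MvPowerSeries.subst ![U, V]) (X_mul_biSeries_eq
    (b := fun n s => a (n :: List.replicate s 0) / (2 * π * I) ^ s) h0 h1)
  have hone : MvPowerSeries.subst ![U, V] (1 : MvPowerSeries (Fin 2) ℂ) =
      (1 : MvPowerSeries (Fin 2) ℂ) := by
    rw [← MvPowerSeries.coe_substAlgHom h, map_one]
  simp only [MvPowerSeries.subst_mul h, MvPowerSeries.subst_add h, MvPowerSeries.subst_sub h,
    MvPowerSeries.subst_X h, subst_subst_X hU hV, MvPowerSeries.subst_C, hone] at key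
  have key2 := congrArg toLaurentHom key
  simp only [map_mul, map_add, toLaurentHom_apply] at key2
  exact div_div_eq_of_mul_eq (K := Laurent2) hU0 hV0 hE key2

lemma constantCoeff_lin (a b : ℂ) : MvPowerSeries.constantCoeff (lin a b) = 0 := by
  simp [lin]

lemma expSubOne_lin_ne_zero {v : ℂ} (hv : v ≠ 0) : expSubOne (lin 0 v) ≠ 0 := by
  intro h
  have h2 := toLaurent_injective (h.trans (by rw [← toLaurentHom_apply, map_zero] :
    (0 : Laurent2) = toLaurent 0))
  have h3 := congrArg (MvPowerSeries.coeff (Finsupp.single 1 1)) h2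
  rw [map_sub, PowerSeries.coeff_subst (hasSubst_of_constantCoeff (constantCoeff_lin 0 v)),
    finsum_eq_single _ 1, MvPowerSeries.coeff_one, pow_one, coeff_lin] at h3
  · simp [PowerSeries.coeff_exp, Finsupp.single_left_inj, hv] at h3
  · intro n hn
    have : lin 0 v = MvPowerSeries.C v * MvPowerSeries.X 1 := by simp [lin]
    rw [this, mul_pow, ← map_pow, MvPowerSeries.coeff_C_mul, MvPowerSeries.coeff_X_pow, if_neg]
    · simp
    · intro h
      exact hn (by simpa using (DFunLike.congr_fun h 1).symm)

/-- The terms `c / E` are common to both quotients and cancel, and the hypothesis makes the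
difference of the `k`-terms divisible by `V`. This is where the unknown regularization constants
disappear. -/
lemma quotient_sub_eq {K : Type*} [Field K] {w U₁ U₂ V c E k₁ k₂ M B t : K} (hV : V ≠ 0)
    (h : k₁ - k₂ = -t * V * M) :
    (w / (U₁ * V) + (c / E + k₁ / V + 0)) - (w / (U₂ * V) + (c / E + k₂ / V + B)) =
      w / (U₁ * V) - w / (U₂ * V) + (-t * M - B) := by
  have : k₁ / V - k₂ / V = -t * M := by
    rw [← sub_div, h]; field_simp
  linear_combination this

/-- The part of non-negative degree of the difference of the quotients
`𝒜^∞(2πiX, -2πiY) / (e^{-2πiY} - 1)` and `𝒜(2πi(X - τY), -2πiY; τ) / (e^{-2πiY} - 1)`. -/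
def quotientDiff (τ : ℂ) : MvPowerSeries (Fin 2) ℂ :=
  -MvPowerSeries.C τ * MvPowerSeries.subst
      ![lin (2 * π * I) 0, lin (2 * π * I) (-(2 * π * I * τ))]
      (biSeries fun i j => cotCoeff (i + j + 1) / (2 * π * I) ^ (i + j + 1)) -
    MvPowerSeries.subst ![lin (2 * π * I) (-(2 * π * I * τ)), lin 0 (-2 * π * I)]
      (biSeries (lambertCoeff τ))

lemma genAInf_sub_genA (τ : UpperHalfPlane) :
    genAInf (lin (2 * π * I) 0) (lin 0 (-2 * π * I)) / expSubOne (lin 0 (-2 * π * I)) -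
      genA (lin (2 * π * I) (-(2 * π * I * (τ : ℂ)))) (lin 0 (-2 * π * I)) τ /
        expSubOne (lin 0 (-2 * π * I)) =
      toLaurent (MvPowerSeries.C (2 * π * I)) /
          (toLaurent (lin (2 * π * I) 0) * toLaurent (lin 0 (-2 * π * I))) -
        toLaurent (MvPowerSeries.C (2 * π * I)) /
          (toLaurent (lin (2 * π * I) (-(2 * π * I * (τ : ℂ)))) *
            toLaurent (lin 0 (-2 * π * I))) +
      toLaurent (quotientDiff τ) := by
  have hw : (2 * π * I : ℂ) ≠ 0 := Complex.two_pi_I_ne_zero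
  have hv : (-2 * π * I : ℂ) ≠ 0 := by
    rw [neg_mul, neg_mul]; exact neg_ne_zero.2 hw
  obtain ⟨c, hc⟩ := exists_ellMZV_succ_cons
  have hV0 := toLaurent_lin_zero_ne_zero hv
  have hE := expSubOne_lin_ne_zero hv
  have hinf : ∀ j s : ℕ, ellMZVInf ((j + 1) :: List.replicate s 0) / (2 * π * I) ^ s =
      (if j = 0 then c s else 0) + cotCoeff j / (2 * π * I) ^ j / ((s + 1).factorial : ℂ) +
      ∑ l ∈ Finset.range s, (0 : ℂ) / ((s - l).factorial : ℂ) := by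
    intro j s
    rw [ellMZVInf_succ_cons hc]; simp
  have e1 := genSeries_div_expSubOne (a := ellMZVInf) (w := 2 * π * I) (c := c)
    (k := fun j => cotCoeff j / (2 * π * I) ^ j) (B := fun _ _ => 0) ellMZVInf_zero_cons hinf
    (constantCoeff_lin (2 * π * I) 0) (constantCoeff_lin 0 (-2 * π * I))
    (toLaurent_lin_ne_zero hw 0) hV0 hE
  have e2 := genSeries_div_expSubOne (a := fun l => ellMZV l τ) (w := 2 * π * I) (c := c)
    (k := fun j => cotCoeff j / (2 * π * I) ^ j) (B := lambertCoeff τ)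
    (ellMZV_zero_cons τ.im_pos) (fun j s => hc τ.im_pos j s)
    (constantCoeff_lin (2 * π * I) (-(2 * π * I * (τ : ℂ)))) (constantCoeff_lin 0 (-2 * π * I))
    (toLaurent_lin_ne_zero hw _) hV0 hE
  have hB0 : toLaurent (MvPowerSeries.subst ![lin (2 * π * I) 0, lin 0 (-2 * π * I)]
      (biSeries fun _ _ => 0)) = 0 := by
    have h := hasSubst_pair (constantCoeff_lin (2 * π * I) 0) (constantCoeff_lin 0 (-2 * π * I))
    rw [show (biSeries fun _ _ => 0) = 0 from rfl, ← MvPowerSeries.coe_substAlgHom h, map_zero,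
      ← toLaurentHom_apply, map_zero]
  have hk := sub_mul_subst_biSeries (constantCoeff_lin (2 * π * I) 0)
    (constantCoeff_lin (2 * π * I) (-(2 * π * I * (τ : ℂ))))
    (fun j => cotCoeff j / (2 * π * I) ^ j)
  -- The shift `X ↦ X - τY` changes the first argument by a multiple of `V = -2πiY`, so the divided
  -- difference absorbs the denominator `V`.
  have hUU : lin (2 * π * I) 0 - lin (2 * π * I) (-(2 * π * I * (τ : ℂ))) =
      -MvPowerSeries.C (τ : ℂ) * lin 0 (-2 * π * I) := by
    simp only [lin, map_neg, map_mul, map_zero]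
    ring
  rw [hUU] at hk
  have hk' := congrArg toLaurentHom hk.symm
  simp only [map_mul, map_sub, map_neg, toLaurentHom_apply] at hk'
  rw [genAInf, genA, e1, e2, hB0, quotientDiff]
  have := quotient_sub_eq (K := Laurent2) (w := toLaurent (MvPowerSeries.C (2 * π * I)))
    (U₁ := toLaurent (lin (2 * π * I) 0))
    (U₂ := toLaurent (lin (2 * π * I) (-(2 * π * I * (τ : ℂ)))))
    (c := toLaurent (PowerSeries.subst (lin 0 (-2 * π * I)) (PowerSeries.mk c)))
    (E := expSubOne (lin 0 (-2 * π * I))) (B := toLaurent (MvPowerSeries.subst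
      ![lin (2 * π * I) (-(2 * π * I * (τ : ℂ))), lin 0 (-2 * π * I)]
      (biSeries (lambertCoeff τ)))) hV0 hk'
  rw [this]
  congr 1
  simp only [← toLaurentHom_apply, map_mul, map_sub, map_neg]

lemma laplaceInv_rePart_genAInf_sub (τ : UpperHalfPlane) :
    laplaceInv (rePart (genAInf (lin (2 * π * I) 0) (lin 0 (-2 * π * I)) /
      expSubOne (lin 0 (-2 * π * I)))) =
    laplaceInv (rePart (genA (lin (2 * π * I) (-(2 * π * I * (τ : ℂ)))) (lin 0 (-2 * π * I)) τ /
        expSubOne (lin 0 (-2 * π * I)))) + toLaurent (laplaceRe (quotientDiff τ)) := by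
  have hw : (2 * π * I : ℂ) ≠ 0 := Complex.two_pi_I_ne_zero
  have hv : (-2 * π * I : ℂ) ≠ 0 := by
    rw [neg_mul, neg_mul]; exact neg_ne_zero.2 hw
  have h := congrArg (fun S => laplaceInv (rePart S)) (genAInf_sub_genA τ)
  simp only [laplaceInv_rePart_sub, laplaceInv_rePart_add,
    laplaceInv_rePart_div_lin_mul_lin hw hv, laplaceInv_rePart_toLaurent] at h
  have gen : ∀ {K : Type} [Field K] {A B C : K}, A - B = 0 - 0 + C → A = B + C := by
    intro K _ A B C h
    linear_combination h
  exact gen (K := Laurent2) h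

/-- The comparison of power series to which the identity of Laurent series reduces. -/
lemma toLaurent_eq_of_eq {R A E Z : MvPowerSeries (Fin 2) ℂ} {S T : Laurent2}
    (h : S = T + toLaurent A) (hR : R = MvPowerSeries.C (1 / 2) * A + E + Z) :
    toLaurent R = (1 / 2 : ℂ) • S + toLaurent E - (1 / 2 : ℂ) • T + toLaurent Z := by
  have hs : (1 / 2 : ℂ) • (T + toLaurent A) = (1 / 2 : ℂ) • T + (1 / 2 : ℂ) • toLaurent A := by
    ext j i
    simp only [HahnSeries.coeff_smul, HahnSeries.coeff_add, smul_add]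
  rw [hR, h, hs, toLaurent_smul]
  simp only [← toLaurentHom_apply, map_add]
  have gen : ∀ A B C D : Laurent2, A + B + C = D + A + B - D + C := by
    intro A B C D; ring
  exact gen _ _ _ _

end EllMZV

end

/-! ### Homogeneous components as polynomials in one real variable. -/

noncomputable section

namespace EllMZV

open Complex Filter Topology
open scoped Real

/-- The homogeneous component of degree `d` of a series, evaluated at `(x, 1)`. -/
def formEval (P : MvPowerSeries (Fin 2) ℂ) (d : ℕ) (x : ℂ) : ℂ :=
  ∑ p ∈ Finset.HasAntidiagonal.antidiagonal d,
    MvPowerSeries.coeff (Finsupp.single 0 p.1 + Finsupp.single 1 p.2) P * x ^ p.1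

/-- A binary form is determined by its values at `(x, 1)` for infinitely many `x`. Real `x` suffice,
and for those the coefficientwise real part becomes the real part of the value. -/
lemma eq_of_formEval_eq {P Q : MvPowerSeries (Fin 2) ℂ}
    (h : ∀ (d : ℕ) (x : ℝ), formEval P d x = formEval Q d x) : P = Q := by
  have key : ∀ (R : MvPowerSeries (Fin 2) ℂ) (d : ℕ) (x : ℂ), formEval R d x =
      (∑ n ∈ Finset.range (d + 1), Polynomial.monomial n
        (MvPowerSeries.coeff (Finsupp.single 0 n + Finsupp.single 1 (d - n)) R)).eval x := by
    intro R d x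
    rw [formEval, Finset.Nat.sum_antidiagonal_eq_sum_range_succ_mk, Polynomial.eval_finsetSum]
    simp [Polynomial.eval_monomial]
  ext e
  have hp := Polynomial.eq_of_infinite_eval_eq
    (∑ n ∈ Finset.range (e 0 + e 1 + 1), Polynomial.monomial n
        (MvPowerSeries.coeff (Finsupp.single 0 n + Finsupp.single 1 (e 0 + e 1 - n)) P))
    (∑ n ∈ Finset.range (e 0 + e 1 + 1), Polynomial.monomial n
        (MvPowerSeries.coeff (Finsupp.single 0 n + Finsupp.single 1 (e 0 + e 1 - n)) Q))
    ((Set.infinite_range_of_injective Complex.ofReal_injective).mono (by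
      rintro _ ⟨x, rfl⟩
      simp only [Set.mem_ofPred_eq, ← key, h]))
  have hc := congrArg (fun p => Polynomial.coeff p (e 0)) hp
  simpa [Polynomial.finsetSum_coeff, Polynomial.coeff_monomial, single_add_single_apply] using hc

lemma formEval_add (P Q : MvPowerSeries (Fin 2) ℂ) (d : ℕ) (x : ℂ) :
    formEval (P + Q) d x = formEval P d x + formEval Q d x := by
  simp [formEval, add_mul, Finset.sum_add_distrib]

lemma formEval_sub (P Q : MvPowerSeries (Fin 2) ℂ) (d : ℕ) (x : ℂ) :
    formEval (P - Q) d x = formEval P d x - formEval Q d x := by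
  simp [formEval, sub_mul, Finset.sum_sub_distrib]

lemma formEval_C_mul (c : ℂ) (P : MvPowerSeries (Fin 2) ℂ) (d : ℕ) (x : ℂ) :
    formEval (MvPowerSeries.C c * P) d x = c * formEval P d x := by
  simp [formEval, Finset.mul_sum, mul_assoc]

lemma formEval_laplaceRe (P : MvPowerSeries (Fin 2) ℂ) (d : ℕ) (x : ℝ) :
    formEval (laplaceRe P) d x = (d.factorial : ℂ) * ((formEval P d x).re : ℂ) := by
  rw [formEval, formEval, Complex.re_sum, Complex.ofReal_sum, Finset.mul_sum]
  refine Finset.sum_congr rfl fun p hp => ?_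
  rw [Finset.HasAntidiagonal.mem_antidiagonal] at hp
  rw [coeff_laplaceRe, ← Complex.ofReal_pow, Complex.re_mul_ofReal]
  simp [hp, mul_assoc]

/-- The linear form `aX + bY` as a polynomial. -/
def linPoly (a b : ℂ) : MvPolynomial (Fin 2) ℂ :=
  MvPolynomial.C a * MvPolynomial.X 0 + MvPolynomial.C b * MvPolynomial.X 1

lemma coe_linPoly (a b : ℂ) : (linPoly a b : MvPowerSeries (Fin 2) ℂ) = lin a b := by
  simp [linPoly, lin]

lemma isHomogeneous_linPoly (a b : ℂ) : (linPoly a b).IsHomogeneous 1 :=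
  ((MvPolynomial.isHomogeneous_X _ _).C_mul _).add ((MvPolynomial.isHomogeneous_X _ _).C_mul _)

lemma isHomogeneous_linPoly_pow_mul (a b a' b' : ℂ) (m n : ℕ) :
    (linPoly a b ^ m * linPoly a' b' ^ n).IsHomogeneous (m + n) := by
  simpa using ((isHomogeneous_linPoly a b).pow m).mul ((isHomogeneous_linPoly a' b').pow n)

lemma coe_linPoly_pow_mul (a b a' b' : ℂ) (m n : ℕ) :
    ((linPoly a b ^ m * linPoly a' b' ^ n : MvPolynomial (Fin 2) ℂ) : MvPowerSeries (Fin 2) ℂ) =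
      lin a b ^ m * lin a' b' ^ n := by
  simp [coe_linPoly]

lemma coeff_lin_pow_mul_eq_zero (a b a' b' : ℂ) {m n : ℕ} {e : Fin 2 →₀ ℕ}
    (h : m + n ≠ e 0 + e 1) :
    MvPowerSeries.coeff e (lin a b ^ m * lin a' b' ^ n) = 0 := by
  rw [← coe_linPoly_pow_mul, MvPolynomial.coeff_coe]
  refine (isHomogeneous_linPoly_pow_mul a b a' b' m n).coeff_eq_zero ?_
  rw [Finsupp.degree_eq_sum]
  simpa using h.symm

lemma formEval_coe {p : MvPolynomial (Fin 2) ℂ} {d : ℕ} (hp : p.IsHomogeneous d) (x : ℂ) :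
    formEval p d x = MvPolynomial.eval ![x, 1] p := by
  rw [MvPolynomial.eval_eq', formEval]
  refine (Finset.sum_bij_ne_zero (fun e _ _ => (e 0, e 1)) ?_ ?_ ?_ ?_).symm
  · intro e he _
    rw [Finset.HasAntidiagonal.mem_antidiagonal]
    have := hp (MvPolynomial.mem_support_iff.1 he)
    rw [Finsupp.weight_apply] at this
    simpa [Finsupp.sum_fintype] using this
  · intro e _ _ e' _ _ h
    simp only [Prod.mk.injEq] at h
    ext i; fin_cases i
    exacts [h.1, h.2]
  · intro r hr h0
    refine ⟨Finsupp.single 0 r.1 + Finsupp.single 1 r.2, ?_, ?_, ?_⟩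
    · rw [MvPolynomial.mem_support_iff, ← MvPolynomial.coeff_coe]
      exact left_ne_zero_of_mul h0
    · simpa [MvPolynomial.coeff_coe] using h0
    · simp
  · intro e _ _
    simp [single_add_single_apply]

lemma formEval_lin_pow_mul (a b a' b' : ℂ) {m n d : ℕ} (h : m + n = d) (x : ℂ) :
    formEval (lin a b ^ m * lin a' b' ^ n) d x = (a * x + b) ^ m * (a' * x + b') ^ n := by
  subst h
  rw [← coe_linPoly_pow_mul, formEval_coe (isHomogeneous_linPoly_pow_mul a b a' b' m n)]
  simp [linPoly]

/-- Products of linear forms are homogeneous, so only pairs of total degree `e 0 + e 1` contribute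
and the substitution becomes a finite sum. -/
lemma coeff_subst_lin (a b a' b' : ℂ) (f : ℕ → ℕ → ℂ) (e : Fin 2 →₀ ℕ) :
    MvPowerSeries.coeff e (MvPowerSeries.subst ![lin a b, lin a' b'] (biSeries f)) =
      ∑ p ∈ Finset.HasAntidiagonal.antidiagonal (e 0 + e 1),
        f p.1 p.2 * MvPowerSeries.coeff e (lin a b ^ p.1 * lin a' b' ^ p.2) := by
  have hd : ∀ d : Fin 2 →₀ ℕ, (d.prod fun s n => (![lin a b, lin a' b'] : Fin 2 → _) s ^ n) =
      lin a b ^ d 0 * lin a' b' ^ d 1 := by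
    intro d
    rw [Finsupp.prod_fintype _ _ (by simp)]
    simp
  rw [MvPowerSeries.coeff_subst (hasSubst_pair (constantCoeff_lin a b) (constantCoeff_lin a' b'))]
  simp only [hd, coeff_biSeries, smul_eq_mul]
  rw [finsum_eq_sum_of_support_subset (s := (Finset.HasAntidiagonal.antidiagonal (e 0 + e 1)).image
    fun p => (Finsupp.single 0 p.1 + Finsupp.single 1 p.2 : Fin 2 →₀ ℕ))]
  · rw [Finset.sum_image]
    · simp
    · intro p _ q _ h
      have h0 := DFunLike.congr_fun h 0
      have h1 := DFunLike.congr_fun h 1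
      simp at h0 h1
      exact Prod.ext h0 h1
  · intro d hd
    have h1 := right_ne_zero_of_mul (Function.mem_support.1 hd)
    have h2 : d 0 + d 1 = e 0 + e 1 := by
      by_contra h
      exact h1 (coeff_lin_pow_mul_eq_zero _ _ _ _ h)
    rw [Finset.coe_image]
    exact ⟨(d 0, d 1), by simpa using h2, single_add_single_apply d⟩

lemma formEval_eq_of_coeff {P : MvPowerSeries (Fin 2) ℂ} {d : ℕ} {a b a' b' : ℂ} {f : ℕ → ℕ → ℂ}
    (h : ∀ e : Fin 2 →₀ ℕ, e 0 + e 1 = d → MvPowerSeries.coeff e P =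
      ∑ p ∈ Finset.HasAntidiagonal.antidiagonal d,
        f p.1 p.2 * MvPowerSeries.coeff e (lin a b ^ p.1 * lin a' b' ^ p.2)) (x : ℂ) :
    formEval P d x = ∑ p ∈ Finset.HasAntidiagonal.antidiagonal d,
      f p.1 p.2 * ((a * x + b) ^ p.1 * (a' * x + b') ^ p.2) := by
  have h1 : formEval P d x = ∑ p ∈ Finset.HasAntidiagonal.antidiagonal d,
      f p.1 p.2 * formEval (lin a b ^ p.1 * lin a' b' ^ p.2) d x := by
    simp only [formEval, Finset.mul_sum]
    rw [Finset.sum_comm]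
    refine Finset.sum_congr rfl fun r hr => ?_
    rw [Finset.HasAntidiagonal.mem_antidiagonal] at hr
    rw [h _ (by simpa using hr), Finset.sum_mul]
    exact Finset.sum_congr rfl fun p _ => by ring
  rw [h1]
  refine Finset.sum_congr rfl fun p hp => ?_
  rw [formEval_lin_pow_mul _ _ _ _ (Finset.HasAntidiagonal.mem_antidiagonal.1 hp)]

lemma formEval_subst_lin (a b a' b' : ℂ) (f : ℕ → ℕ → ℂ) (d : ℕ) (x : ℂ) :
    formEval (MvPowerSeries.subst ![lin a b, lin a' b'] (biSeries f)) d x =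
      ∑ p ∈ Finset.HasAntidiagonal.antidiagonal d,
        f p.1 p.2 * ((a * x + b) ^ p.1 * (a' * x + b') ^ p.2) :=
  formEval_eq_of_coeff (fun e he => by rw [coeff_subst_lin, he]) x

lemma formEval_eisR (τ : UpperHalfPlane) (d : ℕ) (x : ℂ) : formEval (eisR τ) d x =
    if 2 ≤ d then ((τ.im / (4 * π) : ℝ) : ℂ) * ((d.factorial : ℂ) *
      ∑ p ∈ Finset.HasAntidiagonal.antidiagonal d, latticeSum (p.1 + 1) (p.2 + 1) τ *
        ((x - τ) ^ p.1 * (x - (starRingEnd ℂ) (τ : ℂ)) ^ p.2)) else 0 := by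
  rw [formEval_eq_of_coeff (P := eisR τ) (d := d) (a := 1) (b := -(τ : ℂ)) (a' := 1)
    (b' := -(starRingEnd ℂ) (τ : ℂ)) (f := fun i j => if 2 ≤ d then ((τ.im / (4 * π) : ℝ) : ℂ) *
      ((d.factorial : ℂ) * latticeSum (i + 1) (j + 1) τ) else 0)]
  · split_ifs with hd
    · rw [Finset.mul_sum, Finset.mul_sum]
      exact Finset.sum_congr rfl fun p _ => by ring
    · simp
  · intro e he
    change (if 4 ≤ e 0 + e 1 + 2 then _ else 0) = _
    rw [he]
    by_cases hd : 2 ≤ d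
    · rw [if_pos (by omega)]
      simp only [if_pos hd]
      rw [Finset.mul_sum]
      refine Finset.sum_congr rfl fun p hp => ?_
      rw [Finset.HasAntidiagonal.mem_antidiagonal.1 hp]
      ring
    · rw [if_neg (by omega)]
      simp [hd]

lemma formEval_C (c : ℂ) (d : ℕ) (x : ℂ) :
    formEval (MvPowerSeries.C c) d x = if d = 0 then c else 0 := by
  rw [formEval]
  by_cases hd : d = 0
  · subst hd; simp
  · rw [if_neg hd]
    refine Finset.sum_eq_zero fun p hp => ?_
    rw [Finset.HasAntidiagonal.mem_antidiagonal] at hp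
    rw [MvPowerSeries.coeff_C, if_neg, zero_mul]
    rw [single_add_single_eq_iff]
    rintro ⟨h1, h2⟩
    simp at h1 h2
    omega

lemma formEval_oddZetaSeries (d : ℕ) (x : ℂ) : formEval oddZetaSeries d x =
    if 2 ≤ d ∧ Even d then (d.factorial : ℂ) / 2 * riemannZeta ((d : ℂ) + 1) else 0 := by
  rw [formEval, Finset.sum_eq_single (0, d)]
  · simp [oddZetaSeries, coeff_biSeries]
  · rintro ⟨i, j⟩ hp hne
    rw [Finset.HasAntidiagonal.mem_antidiagonal] at hp
    rw [oddZetaSeries, coeff_biSeries, if_neg, zero_mul]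
    rintro ⟨h, -⟩
    simp at h hp
    subst h
    simp_all
  · simp

lemma formEval_quotientDiff (τ : ℂ) (d : ℕ) (x : ℂ) : formEval (quotientDiff τ) d x =
    -τ * ∑ p ∈ Finset.HasAntidiagonal.antidiagonal d, cotCoeff (d + 1) / (2 * π * I) ^ (d + 1) *
      ((2 * π * I * x) ^ p.1 * (2 * π * I * (x - τ)) ^ p.2) -
    ∑ p ∈ Finset.HasAntidiagonal.antidiagonal d, lambertCoeff τ p.1 p.2 *
      ((2 * π * I * (x - τ)) ^ p.1 * (-2 * π * I) ^ p.2) := by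
  rw [quotientDiff, formEval_sub, ← map_neg, formEval_C_mul, formEval_subst_lin,
    formEval_subst_lin]
  congr 1
  · congr 1
    refine Finset.sum_congr rfl fun p hp => ?_
    rw [Finset.HasAntidiagonal.mem_antidiagonal.1 hp]
    ring
  · exact Finset.sum_congr rfl fun p _ => by ring

end EllMZV

end

/-! ### Parity and real parts of the components of `quotientDiff`. -/

noncomputable section

namespace EllMZV

open Complex Filter Topology
open scoped Real

/-- The sum `∑_{n ≥ 1} n^{-s}` as a real number. -/
def zetaSum (s : ℕ) : ℝ := ∑' n : ℕ, 1 / ((n + 1 : ℕ) : ℝ) ^ s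

lemma cotCoeff_of_odd {j : ℕ} (hj : Odd j) : cotCoeff j = ((-2 * zetaSum (j + 1) : ℝ) : ℂ) := by
  rw [cotCoeff_eq_tsum, zetaSum, ← tsum_mul_left, Complex.ofReal_tsum]
  refine tsum_congr fun n => ?_
  rw [hj.neg_one_pow]
  push_cast
  ring

/-- The sum of `((2πikρ)^i / i!) m^{-j-1} q^{mk}` over `i + j = d` and `m, k ≥ 1`. -/
def lambertForm (τ ρ : ℂ) (d : ℕ) : ℂ :=
  ∑ p ∈ Finset.HasAntidiagonal.antidiagonal d, ∑' r : ℕ × ℕ,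
    cexp (2 * π * I * τ) ^ ((r.1 + 1) * (r.2 + 1)) *
      ((2 * π * I * ρ * (r.2 + 1 : ℕ)) ^ p.1 / p.1.factorial / ((r.1 + 1 : ℕ) : ℂ) ^ (p.2 + 1))

lemma sum_lambertCoeff_of_odd (τ ρ : ℂ) {d : ℕ} (hd : Odd d) :
    ∑ p ∈ Finset.HasAntidiagonal.antidiagonal d, lambertCoeff τ p.1 p.2 *
      ((2 * π * I * ρ) ^ p.1 * (-2 * π * I) ^ p.2) = 0 := by
  refine Finset.sum_eq_zero fun p hp => ?_
  rw [Finset.HasAntidiagonal.mem_antidiagonal] at hp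
  have h : ((-1 : ℂ) ^ p.2 + (-1) ^ p.1) = 0 := by
    rcases Nat.even_or_odd p.1 with h1 | h1
    · have h2 : Odd p.2 := by
        by_contra h2; rw [Nat.not_odd_iff_even] at h2
        exact Nat.not_odd_iff_even.2 (hp ▸ h1.add h2) hd
      rw [h1.neg_one_pow, h2.neg_one_pow]; ring
    · have h2 : Even p.2 := by
        by_contra h2; rw [Nat.not_even_iff_odd] at h2
        exact Nat.not_odd_iff_even.2 (hp ▸ h1.add_odd h2) hd
      rw [h1.neg_one_pow, h2.neg_one_pow]; ring
  simp [lambertCoeff, h]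

lemma sum_lambertCoeff_of_even (τ ρ : ℂ) {d : ℕ} (hd : Even d) :
    ∑ p ∈ Finset.HasAntidiagonal.antidiagonal d, lambertCoeff τ p.1 p.2 *
      ((2 * π * I * ρ) ^ p.1 * (-2 * π * I) ^ p.2) = -(2 * lambertForm τ ρ d) := by
  rw [lambertForm, Finset.mul_sum, ← Finset.sum_neg_distrib]
  refine Finset.sum_congr rfl fun p hp => ?_
  rw [Finset.HasAntidiagonal.mem_antidiagonal] at hp
  have h : ((-1 : ℂ) ^ p.2 + (-1) ^ p.1) = 2 * (-1) ^ p.2 := by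
    have : (-1 : ℂ) ^ p.1 = (-1) ^ p.2 := by
      have h3 : (-1 : ℂ) ^ p.1 * (-1) ^ p.2 = 1 := by rw [← pow_add, hp, hd.neg_one_pow]
      have h4 : (-1 : ℂ) ^ p.2 * (-1) ^ p.2 = 1 := by
        rw [← mul_pow]; norm_num
      calc (-1 : ℂ) ^ p.1 = (-1 : ℂ) ^ p.1 * ((-1 : ℂ) ^ p.2 * (-1) ^ p.2) := by rw [h4, mul_one]
        _ = _ := by rw [← mul_assoc, h3, one_mul]
    rw [this]; ring
  rw [lambertCoeff, h, neg_mul, ← tsum_mul_right, ← tsum_mul_left]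
  congr 1
  refine tsum_congr fun r => ?_
  have hw : (2 * π * I : ℂ) ≠ 0 := Complex.two_pi_I_ne_zero
  have hm : ((r.1 + 1 : ℕ) : ℂ) ≠ 0 := Nat.cast_ne_zero.2 (Nat.succ_ne_zero _)
  have hf : (p.1.factorial : ℂ) ≠ 0 := Nat.cast_ne_zero.2 p.1.factorial_ne_zero
  have hs : (-2 * π * I : ℂ) ^ p.2 = (-1) ^ p.2 * (2 * π * I) ^ p.2 := by
    rw [← mul_pow]; ring
  have h4 : (-1 : ℂ) ^ p.2 * (-1) ^ p.2 = 1 := by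
    rw [← mul_pow]; norm_num
  rw [hs]
  generalize cexp (2 * π * I * τ) ^ ((r.1 + 1) * (r.2 + 1)) = Q
  generalize (2 * π * I : ℂ) = w at hw ⊢
  generalize ((r.1 + 1 : ℕ) : ℂ) = m at hm ⊢
  generalize ((r.2 + 1 : ℕ) : ℂ) = k
  generalize (p.1.factorial : ℂ) = F at hf ⊢
  generalize (-1 : ℂ) ^ p.2 = s at h4 ⊢
  calc Q * (k ^ p.1 * (2 * s / (F * (m * (w * m) ^ p.2)))) * ((w * ρ) ^ p.1 * (s * w ^ p.2))
      = (s * s) * (2 * (Q * ((w * ρ * k) ^ p.1 / F / m ^ (p.2 + 1)))) := by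
        simp only [mul_pow]
        field_simp
        ring
    _ = _ := by rw [h4, one_mul]

lemma sum_pow_mul_pow_antidiagonal (x y : ℂ) (d : ℕ) :
    (x - y) * ∑ p ∈ Finset.HasAntidiagonal.antidiagonal d, x ^ p.1 * y ^ p.2 =
      x ^ (d + 1) - y ^ (d + 1) := by
  rw [Finset.Nat.sum_antidiagonal_eq_sum_range_succ_mk]
  exact (Commute.all x y).mul_geom_sum₂ (d + 1)

/-- The prefactor `τ = x - (x - τ)` closes the geometric sum of the divided difference into a
difference of two powers. -/
lemma formEval_quotientDiff' (τ x : ℂ) (d : ℕ) : formEval (quotientDiff τ) d x =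
    -(cotCoeff (d + 1) / (2 * π * I)) * (x ^ (d + 1) - (x - τ) ^ (d + 1)) -
    ∑ p ∈ Finset.HasAntidiagonal.antidiagonal d, lambertCoeff τ p.1 p.2 *
      ((2 * π * I * (x - τ)) ^ p.1 * (-2 * π * I) ^ p.2) := by
  rw [formEval_quotientDiff, ← sum_pow_mul_pow_antidiagonal x (x - τ) d, sub_sub_cancel,
    Finset.mul_sum, Finset.mul_sum, Finset.mul_sum]
  congr 1
  refine Finset.sum_congr rfl fun p hp => ?_
  rw [Finset.HasAntidiagonal.mem_antidiagonal] at hp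
  have hw : (2 * π * I : ℂ) ≠ 0 := Complex.two_pi_I_ne_zero
  generalize (2 * π * I : ℂ) = w at hw ⊢
  rw [← hp]
  simp only [mul_pow]
  field_simp
  ring

lemma formEval_quotientDiff_of_odd (τ x : ℂ) {d : ℕ} (hd : Odd d) :
    formEval (quotientDiff τ) d x = 0 := by
  rw [formEval_quotientDiff', sum_lambertCoeff_of_odd _ _ hd, cotCoeff, if_neg]
  · simp
  · rw [Nat.not_odd_iff_even]; exact hd.add_odd odd_one

/-- After division by `2πi` the real number `x^{d+1}` contributes only to the imaginary part, so
just `Im (x - τ)^{d+1}` remains of the cotangent term. -/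
lemma re_formEval_quotientDiff_of_even (τ : ℂ) (x : ℝ) {d : ℕ} (hd : Even d) :
    (formEval (quotientDiff τ) d x).re =
      -(zetaSum (d + 2) * ((x - τ) ^ (d + 1)).im / π) + 2 * (lambertForm τ (x - τ) d).re := by
  rw [formEval_quotientDiff', sum_lambertCoeff_of_even _ _ hd, cotCoeff_of_odd hd.add_one]
  have h : -(((-2 * zetaSum (d + 1 + 1) : ℝ) : ℂ) / (2 * π * I)) *
      ((x : ℂ) ^ (d + 1) - (x - τ) ^ (d + 1)) = ((zetaSum (d + 2) / π : ℝ) : ℂ) *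
      (-I * (((x ^ (d + 1) : ℝ) : ℂ) - (x - τ) ^ (d + 1))) := by
    have hpi : (π : ℂ) ≠ 0 := Complex.ofReal_ne_zero.2 Real.pi_ne_zero
    push_cast
    field_simp
    rw [I_sq]
    ring
  rw [h, sub_neg_eq_add, add_re, Complex.re_ofReal_mul]
  have h2 : (2 * lambertForm τ (x - τ) d).re = 2 * (lambertForm τ (x - τ) d).re := by
    simp
  rw [h2]
  simp only [neg_mul, neg_re, mul_re, I_re, I_im, sub_im, Complex.ofReal_im]
  ring

end EllMZV

end

/-! ### Lipschitz formulas and partial fractions. -/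

noncomputable section

namespace EllMZV

open Complex Filter Topology
open scoped Real

/-- The right-hand side of the Lipschitz formula for `∑_n (z + n)^{-k-1}`. -/
def lipschitzSum (z : ℂ) (k : ℕ) : ℂ :=
  (-2 * π * I) ^ (k + 1) / k.factorial *
    ∑' n : ℕ, ((n + 1 : ℕ) : ℂ) ^ k * cexp (2 * π * I * z) ^ (n + 1)

lemma hasSum_lipschitz (z : UpperHalfPlane) {k : ℕ} (hk : 1 ≤ k) :
    HasSum (fun n : ℤ => 1 / ((z : ℂ) + n) ^ (k + 1)) (lipschitzSum z k) := by
  have hs : Summable fun n : ℤ => 1 / ((z : ℂ) + n) ^ (k + 1) := by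
    have := EisensteinSeries.linear_right_summable (z : ℂ) 1 (k := (k + 1 : ℕ)) (by omega)
    refine this.congr fun n => ?_
    rw [zpow_natCast, one_div, Int.cast_one, one_mul]
  have h := EisensteinSeries.qExpansion_identity_pnat hk z
  rw [tsum_pnat_eq_tsum_succ (f := fun n : ℕ => (n : ℂ) ^ k * cexp (2 * π * I * z) ^ n)] at h
  rw [lipschitzSum, ← h]
  exact hs.hasSum

/-- The series `∑ 1/(z + n)` is not absolutely convergent, but `Im 1/(z + n) = -Im z / |z + n|²` is
summable; only imaginary parts are needed. -/
lemma summable_im_inv (z : UpperHalfPlane) :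
    Summable fun n : ℤ => (1 / ((z : ℂ) + n)).im := by
  have := (EisensteinSeries.linear_right_summable (z : ℂ) 1 (k := 2) le_rfl).norm
  refine Summable.of_norm ((this.mul_left z.im).congr fun n => ?_)
  rw [one_div, Complex.inv_im, norm_div, norm_inv, Int.cast_one, one_mul, norm_neg, norm_zpow,
    Complex.normSq_eq_norm_sq]
  simp [abs_of_pos z.im_pos, div_eq_mul_inv]

/-- Pairing `n` with `-n` gives the partial fractions of `π cot πz = -πi - 2πi ∑_{n≥1} e^{2πinz}`.
Its constant term is the `-π` that eventually produces the odd zeta values. -/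
lemma hasSum_im_inv (z : UpperHalfPlane) :
    HasSum (fun n : ℤ => (1 / ((z : ℂ) + n)).im) ((lipschitzSum z 0).im - π) := by
  have hs := summable_im_inv z
  have h1 : Summable fun n : ℕ => (1 / ((z : ℂ) + ((n + 1 : ℤ) : ℤ))).im :=
    hs.comp_injective (i := fun n : ℕ => (n + 1 : ℤ)) fun a b h => by simpa using h
  have h2 : Summable fun n : ℕ => (1 / ((z : ℂ) + ((-(n + 1 : ℤ)) : ℤ))).im :=
    hs.comp_injective (i := fun n : ℕ => -(n + 1 : ℤ)) fun a b h => by simpa using h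
  have h3 := Complex.hasSum_im (summable_cotTerm
    (UpperHalfPlane.coe_mem_integerComplement z)).hasSum
  have h4 := (h1.hasSum.add h2.hasSum).unique (h3.congr_fun fun n => by
    simp only [cotTerm, add_im]; push_cast; rw [add_comm, ← sub_eq_add_neg])
  have h5 := HasSum.of_add_one_of_neg_add_one (f := fun n : ℤ => (1 / ((z : ℂ) + n)).im)
    h1.hasSum h2.hasSum
  have hQ : ‖cexp (2 * π * I * z)‖ < 1 := norm_nome_lt_one z.im_pos
  have h6 : (lipschitzSum z 0).im - π =
      (1 / (z : ℂ)).im + (∑' n, cotTerm z n).im := by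
    have e1 := cot_series_rep' (UpperHalfPlane.coe_mem_integerComplement z)
    have e2 := pi_mul_cot_pi_q_exp z
    rw [(summable_geometric_of_norm_lt_one hQ).tsum_eq_zero_add] at e2
    have e3 : (1 / (z : ℂ)) + (∑' n, cotTerm z n) = lipschitzSum z 0 - π * I := by
      have : ∑' n, cotTerm z n = π * cot (π * z) - 1 / z := e1.symm
      rw [this, e2, lipschitzSum]
      simp
      ring
    rw [← Complex.add_im, e3]
    simp
  rw [h6, ← h4]
  convert h5 using 1
  simp
  ring

lemma hasSum_im_div_pow (z : UpperHalfPlane) (ρ : ℂ) (k : ℕ) :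
    HasSum (fun n : ℤ => (ρ ^ k / ((z : ℂ) + n) ^ (k + 1)).im)
      ((ρ ^ k * lipschitzSum z k).im - if k = 0 then π else 0) := by
  rcases Nat.eq_zero_or_pos k with rfl | hk
  · simpa using hasSum_im_inv z
  · rw [if_neg hk.ne', sub_zero]
    refine (Complex.hasSum_im ((hasSum_lipschitz z hk).mul_left (ρ ^ k))).congr_fun fun n => ?_
    rw [mul_one_div]

/-- The sum `∑_{i+j=d} r^i s^j A^{i+1} B^{j+1}`. -/
def latticeForm (r s A B : ℂ) (d : ℕ) : ℂ :=
  ∑ p ∈ Finset.HasAntidiagonal.antidiagonal d, r ^ p.1 * s ^ p.2 * (A ^ (p.1 + 1) * B ^ (p.2 + 1))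

lemma latticeForm_zero (r s A B : ℂ) : latticeForm r s A B 0 = A * B := by
  simp [latticeForm]

lemma latticeForm_succ (r s A B : ℂ) (d : ℕ) :
    latticeForm r s A B (d + 1) =
      r * A * latticeForm r s A B d + s ^ (d + 1) * (A * B ^ (d + 2)) := by
  rw [latticeForm, Finset.Nat.sum_antidiagonal_succ, latticeForm, Finset.mul_sum, add_comm]
  congr 1
  · refine Finset.sum_congr rfl fun p _ => ?_
    ring
  · simp

/-- The hypothesis trades a mixed product `AB` for `A - B`. Thus a form in degree `d + 1` is
expressed through unmixed powers and the form in degree `d`; solving for the former, divided by `m`,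
gives the partial fraction decomposition. -/
lemma latticeForm_recurrence {r s A B m : ℂ} (h : m * (r - s) * (A * B) = A - B) (d : ℕ) :
    (r - s) * (m * latticeForm r s A B (d + 1) + latticeForm r s A B d) =
      r ^ (d + 1) * A ^ (d + 2) - s ^ (d + 1) * B ^ (d + 2) := by
  induction d with
  | zero =>
    rw [latticeForm_succ, latticeForm_zero]
    linear_combination (r * A + s * B) * h
  | succ d ih =>
    have e1 := latticeForm_succ r s A B (d + 1)
    have e2 := latticeForm_succ r s A B d
    linear_combination (exp := 1) r * A * ih + s ^ (d + 2) * B ^ (d + 2) * h +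
      (r - s) * m * e1 + (r - s) * e2

lemma latticeForm_eq_sum {r s A B m : ℂ} (hm : m ≠ 0) (hrs : r ≠ s)
    (h : m * (r - s) * (A * B) = A - B) (d : ℕ) :
    latticeForm r s A B d = ∑ p ∈ Finset.HasAntidiagonal.antidiagonal d,
      (-1) ^ p.2 / m ^ (p.2 + 1) *
        ((r ^ p.1 * A ^ (p.1 + 1) - s ^ p.1 * B ^ (p.1 + 1)) / (r - s)) := by
  have hrs' : r - s ≠ 0 := sub_ne_zero.2 hrs
  induction d with
  | zero =>
    rw [latticeForm_zero, Finset.Nat.antidiagonal_zero, Finset.sum_singleton]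
    field_simp
    linear_combination h
  | succ d ih =>
    have h' := latticeForm_recurrence h d
    rw [Finset.Nat.sum_antidiagonal_succ']
    have e : ∑ p ∈ Finset.HasAntidiagonal.antidiagonal d, (-1) ^ (p.2 + 1) / m ^ (p.2 + 1 + 1) *
        ((r ^ p.1 * A ^ (p.1 + 1) - s ^ p.1 * B ^ (p.1 + 1)) / (r - s)) =
        -(latticeForm r s A B d / m) := by
      rw [ih, Finset.sum_div, ← Finset.sum_neg_distrib]
      refine Finset.sum_congr rfl fun p _ => ?_
      rw [pow_succ (-1 : ℂ), pow_succ m (p.2 + 1)]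
      field_simp
    simp only [] at e ⊢
    rw [e, ← h']
    field_simp
    ring

end EllMZV

end

/-! ### The lattice sum over one row. -/

noncomputable section

namespace EllMZV

open Complex Filter Topology
open scoped Real

/-- The contribution of the lattice point `mτ + n` to the form of degree `d`. -/
def latticeTerm (τ : ℂ) (x : ℝ) (d : ℕ) (p : ℤ × ℤ) : ℂ :=
  latticeForm (x - τ) (x - (starRingEnd ℂ) τ) (p.1 * τ + p.2)⁻¹
    (p.1 * (starRingEnd ℂ) τ + p.2)⁻¹ d

/-- The two factors are powers of conjugate numbers, so the absolute value is that of the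
holomorphic Eisenstein summand of weight `i + j`. -/
lemma summable_lattice (τ : UpperHalfPlane) {i j : ℕ} (h : 3 ≤ i + j) :
    Summable fun p : ℤ × ℤ => ((p.1 * τ + p.2 : ℂ)⁻¹) ^ i *
      ((p.1 * (starRingEnd ℂ) (τ : ℂ) + p.2 : ℂ)⁻¹) ^ j := by
  refine Summable.of_norm ((summable_prod_eisSummand h τ).norm.congr fun p => ?_)
  have hc : (p.1 * (starRingEnd ℂ) (τ : ℂ) + p.2 : ℂ) = (starRingEnd ℂ) (p.1 * τ + p.2 : ℂ) := by
    simp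
  rw [hc, norm_mul, norm_pow, norm_pow, norm_inv, norm_inv, RCLike.norm_conj, ← pow_add,
    EisensteinSeries.eisSummand, norm_zpow, zpow_neg, inv_pow, zpow_natCast]
  simp

lemma summable_latticeTerm (τ : UpperHalfPlane) (x : ℝ) {d : ℕ} (hd : 1 ≤ d) :
    Summable (latticeTerm τ x d) := by
  refine summable_sum (s := Finset.HasAntidiagonal.antidiagonal d) fun q hq => ?_
  rw [Finset.HasAntidiagonal.mem_antidiagonal] at hq
  exact (summable_lattice τ (by omega)).mul_left _

/-- The origin may be included: inverses of `0` are `0`, and both exponents are positive. -/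
lemma latticeSum_eq_tsum (τ : UpperHalfPlane) (i j : ℕ) :
    latticeSum (i + 1) (j + 1) τ = ∑' p : ℤ × ℤ, ((p.1 * τ + p.2 : ℂ)⁻¹) ^ (i + 1) *
      ((p.1 * (starRingEnd ℂ) (τ : ℂ) + p.2 : ℂ)⁻¹) ^ (j + 1) := by
  rw [latticeSum]
  have := tsum_subtype_eq_of_support_subset (s := {p : ℤ × ℤ | p ≠ (0, 0)})
    (f := fun p : ℤ × ℤ => ((p.1 * τ + p.2 : ℂ)⁻¹) ^ (i + 1) *
      ((p.1 * (starRingEnd ℂ) (τ : ℂ) + p.2 : ℂ)⁻¹) ^ (j + 1)) (by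
    rintro p hp rfl
    simp at hp)
  rw [← this]
  refine tsum_congr fun p => ?_
  rw [one_div, mul_inv, inv_pow, inv_pow]

lemma sum_latticeSum_eq_tsum (τ : UpperHalfPlane) (x : ℝ) {d : ℕ} (hd : 1 ≤ d) :
    ∑ p ∈ Finset.HasAntidiagonal.antidiagonal d, latticeSum (p.1 + 1) (p.2 + 1) τ *
        ((x - τ) ^ p.1 * (x - (starRingEnd ℂ) (τ : ℂ)) ^ p.2) =
      ∑' p : ℤ × ℤ, latticeTerm τ x d p := by
  have : ∀ q ∈ Finset.HasAntidiagonal.antidiagonal d, Summable fun p : ℤ × ℤ =>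
      ((x : ℂ) - τ) ^ q.1 * (x - (starRingEnd ℂ) (τ : ℂ)) ^ q.2 *
      (((p.1 * τ + p.2 : ℂ)⁻¹) ^ (q.1 + 1) *
        ((p.1 * (starRingEnd ℂ) (τ : ℂ) + p.2 : ℂ)⁻¹) ^ (q.2 + 1)) := fun q hq => by
    rw [Finset.HasAntidiagonal.mem_antidiagonal] at hq
    exact (summable_lattice τ (by omega)).mul_left _
  simp only [latticeTerm, latticeForm]
  rw [Summable.tsum_finsetSum this]
  refine Finset.sum_congr rfl fun q _ => ?_
  rw [latticeSum_eq_tsum, tsum_mul_left, mul_comm]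

lemma latticeTerm_neg (τ : ℂ) (x : ℝ) (d : ℕ) (p : ℤ × ℤ) :
    latticeTerm τ x d (-p) = (-1) ^ d * latticeTerm τ x d p := by
  have h1 : ((-p).1 * τ + (-p).2 : ℂ)⁻¹ = -(p.1 * τ + p.2 : ℂ)⁻¹ := by
    rw [← inv_neg]; congr 1; push_cast [Prod.fst_neg, Prod.snd_neg]; ring
  have h2 : ((-p).1 * (starRingEnd ℂ) τ + (-p).2 : ℂ)⁻¹ =
      -(p.1 * (starRingEnd ℂ) τ + p.2 : ℂ)⁻¹ := by
    rw [← inv_neg]; congr 1; push_cast [Prod.fst_neg, Prod.snd_neg]; ring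
  rw [latticeTerm, h1, h2, latticeTerm, latticeForm, latticeForm, Finset.mul_sum]
  refine Finset.sum_congr rfl fun q hq => ?_
  rw [Finset.HasAntidiagonal.mem_antidiagonal] at hq
  rw [neg_pow _ (q.1 + 1), neg_pow _ (q.2 + 1), ← hq]
  ring

lemma tsum_latticeTerm_of_odd (τ : ℂ) (x : ℝ) {d : ℕ} (hd : Odd d) :
    ∑' p : ℤ × ℤ, latticeTerm τ x d p = 0 := by
  have h := (Equiv.neg (ℤ × ℤ)).tsum_eq (latticeTerm τ x d)
  simp only [Equiv.neg_apply, latticeTerm_neg, hd.neg_one_pow, neg_mul, one_mul, tsum_neg] at h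
  exact self_eq_neg.1 h.symm

lemma sub_conj_div (z ρ : ℂ) :
    (z - (starRingEnd ℂ) z) / (ρ - (starRingEnd ℂ) ρ) = ((z.im / ρ.im : ℝ) : ℂ) := by
  rw [Complex.sub_conj, Complex.sub_conj]
  push_cast
  rw [show (2 : ℂ) * z.im * I / (2 * ρ.im * I) = (2 * I) * z.im / ((2 * I) * ρ.im) by ring,
    mul_div_mul_left]
  simp

/-- With `A`, `B` the inverses of `mτ + n` and its conjugate and `r = x - τ`, `s = x - τ̄`, one has
`A - B = m(r - s)AB`. The unmixed powers are then conjugate, so each partial fraction is a quotient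
of imaginary parts, and `Im (x - τ) = -Im τ` gives the sign. -/
lemma latticeTerm_eq_sum (τ : UpperHalfPlane) (x : ℝ) (d : ℕ) {m : ℤ} (hm : m ≠ 0) (n : ℤ) :
    latticeTerm τ x d (m, n) = ((∑ p ∈ Finset.HasAntidiagonal.antidiagonal d,
      -((-1) ^ p.2 / (m : ℝ) ^ (p.2 + 1) / τ.im) *
        (((x : ℂ) - τ) ^ p.1 / ((m : ℂ) * τ + n) ^ (p.1 + 1)).im : ℝ) : ℂ) := by
  have hm' : (m : ℂ) ≠ 0 := Int.cast_ne_zero.2 hm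
  have ha : (m * τ + n : ℂ) ≠ 0 := by
    intro h
    have := congrArg Complex.im h
    simp [hm, τ.im_ne_zero] at this
  have hb : (m * (starRingEnd ℂ) (τ : ℂ) + n : ℂ) ≠ 0 := by
    intro h
    have := congrArg Complex.im h
    simp [hm, τ.im_ne_zero] at this
  have hs : ((x : ℂ) - (starRingEnd ℂ) (τ : ℂ)) = (starRingEnd ℂ) ((x : ℂ) - τ) := by simp
  have him : ((x : ℂ) - τ).im = -τ.im := by simp
  rw [latticeTerm, latticeForm_eq_sum (m := (m : ℂ)) hm']
  · push_cast
    refine Finset.sum_congr rfl fun p _ => ?_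
    have e : ((x : ℂ) - (starRingEnd ℂ) (τ : ℂ)) ^ p.1 *
        ((m * (starRingEnd ℂ) (τ : ℂ) + n : ℂ)⁻¹) ^ (p.1 + 1) =
        (starRingEnd ℂ) (((x : ℂ) - τ) ^ p.1 * ((m * τ + n : ℂ)⁻¹) ^ (p.1 + 1)) := by
      simp
    rw [e, hs, sub_conj_div, him, inv_pow, ← div_eq_mul_inv]
    push_cast
    ring
  · intro h
    have := congrArg Complex.im h
    simp at this
    have := τ.im_pos
    linarith
  · field_simp
    ring

lemma pow_mul_lipschitzSum (ρ τ : ℂ) {m : ℕ} (k l : ℕ) :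
    ρ ^ k * lipschitzSum (((m + 1 : ℕ) : ℂ) * τ) k =
      (((-1) ^ (k + 1) * ((m + 1 : ℕ) : ℝ) ^ (l + 1) : ℝ) : ℂ) * (2 * π * I *
        ∑' n : ℕ, cexp (2 * π * I * τ) ^ ((m + 1) * (n + 1)) *
          ((2 * π * I * ρ * (n + 1 : ℕ)) ^ k / k.factorial / ((m + 1 : ℕ) : ℂ) ^ (l + 1))) := by
  have hM : ((m + 1 : ℕ) : ℂ) ≠ 0 := Nat.cast_ne_zero.2 (Nat.succ_ne_zero m)
  have hf : (k.factorial : ℂ) ≠ 0 := Nat.cast_ne_zero.2 k.factorial_ne_zero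
  rw [lipschitzSum, ← tsum_mul_left, ← tsum_mul_left, ← tsum_mul_left, ← tsum_mul_left]
  refine tsum_congr fun n => ?_
  have hQ : cexp (2 * π * I * (((m + 1 : ℕ) : ℂ) * τ)) ^ (n + 1) =
      cexp (2 * π * I * τ) ^ ((m + 1) * (n + 1)) := by
    rw [pow_mul, ← Complex.exp_nat_mul _ (m + 1)]
    congr 2
    ring
  have hw : (-2 * π * I : ℂ) ^ (k + 1) = (-1) ^ (k + 1) * (2 * π * I) ^ (k + 1) := by
    rw [← mul_pow]; ring
  rw [hQ, hw, Complex.ofReal_mul, Complex.ofReal_pow, Complex.ofReal_pow, Complex.ofReal_natCast]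
  generalize cexp (2 * π * I * τ) ^ ((m + 1) * (n + 1)) = Q
  generalize (2 * π * I : ℂ) = w
  generalize ((m + 1 : ℕ) : ℂ) = M at hM ⊢
  simp only [mul_pow]
  push_cast
  field_simp
  ring

lemma hasSum_latticeTerm_row (τ : UpperHalfPlane) (x : ℝ) {d : ℕ} (hd : Even d) (m : ℕ) :
    HasSum (fun n : ℤ => latticeTerm τ x d ((m + 1 : ℕ), n))
      ((2 * π / τ.im * (∑ p ∈ Finset.HasAntidiagonal.antidiagonal d, ∑' k : ℕ,
          cexp (2 * π * I * τ) ^ ((m + 1) * (k + 1)) *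
          ((2 * π * I * (x - τ) * (k + 1 : ℕ)) ^ p.1 / p.1.factorial /
            ((m + 1 : ℕ) : ℂ) ^ (p.2 + 1))).re +
        π / τ.im * (1 / ((m + 1 : ℕ) : ℝ) ^ (d + 1)) : ℝ) : ℂ) := by
  have hm : ((m + 1 : ℕ) : ℤ) ≠ 0 := by omega
  simp only [latticeTerm_eq_sum τ x d hm]
  rw [Complex.hasSum_ofReal]
  set z : UpperHalfPlane := ⟨((m + 1 : ℕ) : ℂ) * τ, by
    have := τ.im_pos
    simp only [Complex.mul_im, Complex.natCast_re, Complex.natCast_im, zero_mul, add_zero]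
    positivity⟩ with hz
  have hzc : (z : ℂ) = ((m + 1 : ℕ) : ℂ) * τ := rfl
  have h := hasSum_sum (s := Finset.HasAntidiagonal.antidiagonal d) fun p (_ : p ∈ _) =>
    (hasSum_im_div_pow z ((x : ℂ) - τ) p.1).mul_left
      (-((-1) ^ p.2 / (((m + 1 : ℕ) : ℤ) : ℝ) ^ (p.2 + 1) / τ.im))
  rw [hzc] at h
  have hval : ∑ p ∈ Finset.HasAntidiagonal.antidiagonal d,
      -((-1) ^ p.2 / (((m + 1 : ℕ) : ℤ) : ℝ) ^ (p.2 + 1) / τ.im) *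
      ((((x : ℂ) - τ) ^ p.1 * lipschitzSum (((m + 1 : ℕ) : ℂ) * τ) p.1).im -
        if p.1 = 0 then π else 0) =
      2 * π / τ.im * (∑ p ∈ Finset.HasAntidiagonal.antidiagonal d, ∑' k : ℕ,
          cexp (2 * π * I * τ) ^ ((m + 1) * (k + 1)) *
          ((2 * π * I * (x - τ) * (k + 1 : ℕ)) ^ p.1 / p.1.factorial /
            ((m + 1 : ℕ) : ℂ) ^ (p.2 + 1))).re +
        π / τ.im * (1 / ((m + 1 : ℕ) : ℝ) ^ (d + 1)) := by
    rw [Complex.re_sum, Finset.mul_sum]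
    rw [Finset.sum_congr rfl fun p _ => mul_sub _ _ _, Finset.sum_sub_distrib]
    rw [sub_eq_add_neg, ← Finset.sum_neg_distrib]
    congr 1
    · refine Finset.sum_congr rfl fun p hp => ?_
      rw [Finset.HasAntidiagonal.mem_antidiagonal] at hp
      rw [pow_mul_lipschitzSum (m := m) (x - τ) τ p.1 p.2]
      have hM : ((m + 1 : ℕ) : ℝ) ≠ 0 := Nat.cast_ne_zero.2 (Nat.succ_ne_zero m)
      -- The sign of the partial fraction and the sign in the Lipschitz formula multiply to the
      -- constant `-1` because `d` is even.
      have hs : (-1 : ℝ) ^ p.2 * (-1) ^ (p.1 + 1) = -1 := by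
        rw [← pow_add, show p.2 + (p.1 + 1) = d + 1 by omega, pow_succ, hd.neg_one_pow]; ring
      rw [Complex.im_ofReal_mul, Int.cast_natCast]
      have hy := τ.im_ne_zero
      generalize (∑' k : ℕ, cexp (2 * π * I * τ) ^ ((m + 1) * (k + 1)) *
        ((2 * π * I * (x - τ) * (k + 1 : ℕ)) ^ p.1 / p.1.factorial /
          ((m + 1 : ℕ) : ℂ) ^ (p.2 + 1))) = T
      have hT : (2 * π * I * T).im = 2 * π * T.re := by
        simp [Complex.mul_im, Complex.mul_re]
      rw [hT]
      generalize ((m + 1 : ℕ) : ℝ) = M at hM ⊢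
      field_simp
      linear_combination (-T.re) * hs
    -- Only the weight-one term carries the correction `π`; it leaves `m^{-(d+1)}`, which sums to
    -- `ζ(d+1)` over the rows.
    · rw [Finset.sum_eq_single (0, d)]
      · rw [hd.neg_one_pow]
        push_cast
        ring
      · rintro ⟨i, j⟩ hp hne
        rw [Finset.HasAntidiagonal.mem_antidiagonal] at hp
        rw [if_neg, mul_zero, neg_zero]
        rintro rfl
        simp_all
      · simp
  rw [← hval]
  refine h.congr_fun fun n => ?_
  push_cast
  rfl

end EllMZV

end

/-! ### Summation over the rows and comparison in positive degree. -/

noncomputable section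

namespace EllMZV

open Complex Filter Topology
open scoped Real

lemma summable_zetaSum {s : ℕ} (hs : 2 ≤ s) : Summable fun n : ℕ => 1 / ((n + 1 : ℕ) : ℝ) ^ s :=
  (summable_nat_add_iff 1).2 (Real.summable_one_div_nat_pow.2 (by omega))

lemma riemannZeta_eq_zetaSum {s : ℕ} (hs : 1 ≤ s) :
    riemannZeta ((s : ℂ) + 1) = (zetaSum (s + 1) : ℂ) := by
  have h := zeta_nat_eq_tsum_of_gt_one (k := s + 1) (by omega)
  push_cast at h
  rw [h, zetaSum, Complex.ofReal_tsum]
  have hs' : Summable fun n : ℕ => 1 / (n : ℂ) ^ (s + 1) := by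
    have := (Real.summable_one_div_nat_pow (p := s + 1)).2 (by omega)
    refine Summable.of_norm (this.congr fun n => ?_)
    simp
  rw [hs'.tsum_eq_zero_add]
  simp

lemma summable_lambertForm_term (τ : UpperHalfPlane) (ρ : ℂ) (i l : ℕ) :
    Summable fun r : ℕ × ℕ => cexp (2 * π * I * τ) ^ ((r.1 + 1) * (r.2 + 1)) *
      ((2 * π * I * ρ * (r.2 + 1 : ℕ)) ^ i / i.factorial / ((r.1 + 1 : ℕ) : ℂ) ^ (l + 1)) := by
  have h := summable_nome_pow (norm_nome_lt_one τ.im_pos)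
    (a := fun r : ℕ × ℕ => 1 / ((r.1 + 1 : ℕ) : ℂ) ^ (l + 1)) (C := 1) (fun r => by
      rw [norm_div, norm_pow, norm_one, Complex.norm_natCast]
      refine div_le_one_of_le₀ (one_le_pow₀ ?_) (by positivity)
      norm_cast; omega) i
  refine (h.mul_left ((2 * π * I * ρ) ^ i / i.factorial)).congr fun r => ?_
  rw [mul_pow _ ((r.2 + 1 : ℕ) : ℂ)]
  ring

lemma hasSum_lambertForm (τ : UpperHalfPlane) (ρ : ℂ) (d : ℕ) :
    HasSum (fun m : ℕ => ∑ p ∈ Finset.HasAntidiagonal.antidiagonal d, ∑' k : ℕ,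
      cexp (2 * π * I * τ) ^ ((m + 1) * (k + 1)) *
        ((2 * π * I * ρ * (k + 1 : ℕ)) ^ p.1 / p.1.factorial /
          ((m + 1 : ℕ) : ℂ) ^ (p.2 + 1))) (lambertForm τ ρ d) := by
  refine hasSum_sum fun p _ => ?_
  have h := summable_lambertForm_term τ ρ p.1 p.2
  exact h.hasSum.prod_fiberwise fun m => (h.prod_factor m).hasSum

lemma even_tsum_latticeTerm (τ : ℂ) (x : ℝ) {d : ℕ} (hd : Even d) :
    Function.Even fun m : ℤ => ∑' n : ℤ, latticeTerm τ x d (m, n) := by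
  intro m
  beta_reduce
  rw [← (Equiv.neg ℤ).tsum_eq]
  refine tsum_congr fun n => ?_
  have := latticeTerm_neg τ x d (m, n)
  rwa [hd.neg_one_pow, one_mul] at this

/-- In the row `m = 0` the two inverses coincide, so `n^{-(d+2)}` factors out of a geometric sum in
`x - τ` and its conjugate, which is a quotient of imaginary parts. -/
lemma tsum_latticeTerm_zero (τ : UpperHalfPlane) (x : ℝ) {d : ℕ} (hd : Even d) :
    ∑' n : ℤ, latticeTerm τ x d (0, n) =
      ((-(2 * zetaSum (d + 2) * (((x : ℂ) - τ) ^ (d + 1)).im / τ.im) : ℝ) : ℂ) := by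
  have hs : ((x : ℂ) - (starRingEnd ℂ) (τ : ℂ)) = (starRingEnd ℂ) ((x : ℂ) - τ) := by simp
  have him : ((x : ℂ) - τ).im = -τ.im := by simp
  have hne : ((x : ℂ) - τ) - (starRingEnd ℂ) ((x : ℂ) - τ) ≠ 0 := by
    rw [Complex.sub_conj, him]
    simp [τ.im_ne_zero]
  have hform : ∑ p ∈ Finset.HasAntidiagonal.antidiagonal d,
      ((x : ℂ) - τ) ^ p.1 * ((starRingEnd ℂ) ((x : ℂ) - τ)) ^ p.2 =
      ((-((((x : ℂ) - τ) ^ (d + 1)).im / τ.im) : ℝ) : ℂ) := by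
    have h := sum_pow_mul_pow_antidiagonal ((x : ℂ) - τ) ((starRingEnd ℂ) ((x : ℂ) - τ)) d
    rw [← map_pow, mul_comm, ← eq_div_iff hne, sub_conj_div, him, div_neg] at h
    exact h
  have hterm : ∀ n : ℤ, latticeTerm τ x d (0, n) =
      ((-((((x : ℂ) - τ) ^ (d + 1)).im / τ.im) : ℝ) : ℂ) * ((n : ℂ)⁻¹) ^ (d + 2) := by
    intro n
    rw [latticeTerm, latticeForm, ← hform, Finset.sum_mul]
    refine Finset.sum_congr rfl fun p hp => ?_
    rw [Finset.HasAntidiagonal.mem_antidiagonal] at hp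
    rw [hs]
    simp only [Int.cast_zero, zero_mul, zero_add]
    rw [← pow_add, show p.1 + 1 + (p.2 + 1) = d + 2 by omega]
  have hsum : Summable fun n : ℤ => ((n : ℂ)⁻¹) ^ (d + 2) := by
    have := EisensteinSeries.linear_right_summable 0 0 (k := (d + 2 : ℕ)) (by omega)
    refine this.congr fun n => ?_
    rw [zpow_natCast]
    simp
  have heven : Function.Even fun n : ℤ => ((n : ℂ)⁻¹) ^ (d + 2) := by
    intro n
    simp only [Int.cast_neg, inv_neg]
    exact (hd.add even_two).neg_pow _
  simp only [hterm]
  rw [tsum_mul_left, tsum_int_eq_zero_add_two_mul_tsum_pnat heven hsum,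
    tsum_pnat_eq_tsum_succ (f := fun n : ℕ => (((n : ℤ) : ℂ)⁻¹) ^ (d + 2))]
  have hz : ∑' n : ℕ, ((((n + 1 : ℕ) : ℤ) : ℂ)⁻¹) ^ (d + 2) = (zetaSum (d + 2) : ℂ) := by
    rw [zetaSum, Complex.ofReal_tsum]
    refine tsum_congr fun n => ?_
    push_cast
    rw [inv_pow, one_div]
  rw [hz]
  simp
  ring

/-- Rows `m` and `-m` agree in even degree, so the total is the row `m = 0` plus twice the positive
rows. The bound `d ≥ 2` gives absolute convergence of the lattice sum and of `ζ(d+1)`. -/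
lemma tsum_latticeTerm_of_even (τ : UpperHalfPlane) (x : ℝ) {d : ℕ} (hd : Even d) (hd2 : 2 ≤ d) :
    ∑' p : ℤ × ℤ, latticeTerm τ x d p =
      ((-(2 * zetaSum (d + 2) * (((x : ℂ) - τ) ^ (d + 1)).im / τ.im) +
        2 * (2 * π / τ.im * (lambertForm τ (x - τ) d).re + π / τ.im * zetaSum (d + 1)) : ℝ) : ℂ) := by
  have hs := summable_latticeTerm τ x (d := d) (by omega)
  have hsum : Summable fun m : ℤ => ∑' n : ℤ, latticeTerm τ x d (m, n) := hs.prod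
  rw [hs.tsum_prod, tsum_int_eq_zero_add_two_mul_tsum_pnat (even_tsum_latticeTerm τ x hd) hsum,
    tsum_latticeTerm_zero τ x hd,
    tsum_pnat_eq_tsum_succ (f := fun m : ℕ => ∑' n : ℤ, latticeTerm τ x d ((m : ℤ), n))]
  have h1 := Complex.hasSum_re (hasSum_lambertForm τ (x - τ) d)
  have h2 := (h1.mul_left (2 * π / τ.im)).add
    ((summable_zetaSum (s := d + 1) (by omega)).hasSum.mul_left (π / τ.im))
  have h3 := (Complex.hasSum_ofReal.2 h2).tsum_eq
  have h4 : ∑' m : ℕ, ∑' n : ℤ, latticeTerm τ x d (((m + 1 : ℕ) : ℤ), n) = _ :=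
    (tsum_congr fun m => (hasSum_latticeTerm_row τ x hd m).tsum_eq).trans h3
  rw [h4, zetaSum, zetaSum]
  push_cast
  ring

/-- The homogeneous components of positive degree of the identity. -/
lemma formEval_eisR_eq (τ : UpperHalfPlane) (x : ℝ) {d : ℕ} (hd : 1 ≤ d) :
    formEval (eisR τ) d x = 1 / 2 * ((d.factorial : ℂ) *
        ((formEval (quotientDiff τ) d x).re : ℂ)) + formEval oddZetaSeries d x := by
  rw [formEval_eisR, formEval_oddZetaSeries]
  rcases Nat.even_or_odd d with he | ho
  · have hd2 : 2 ≤ d := by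
      rcases he with ⟨k, hk⟩; omega
    rw [if_pos hd2, if_pos ⟨hd2, he⟩, sum_latticeSum_eq_tsum τ x hd,
      tsum_latticeTerm_of_even τ x he hd2, re_formEval_quotientDiff_of_even _ _ he,
      riemannZeta_eq_zetaSum hd]
    have hy : (τ.im : ℂ) ≠ 0 := Complex.ofReal_ne_zero.2 τ.im_ne_zero
    have hpi : (π : ℂ) ≠ 0 := Complex.ofReal_ne_zero.2 Real.pi_ne_zero
    push_cast
    field_simp
    ring
  · rw [if_neg (c := 2 ≤ d ∧ Even d) (fun h => Nat.not_even_iff_odd.2 ho h.2),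
      formEval_quotientDiff_of_odd _ _ ho, sum_latticeSum_eq_tsum τ x hd,
      tsum_latticeTerm_of_odd _ _ ho]
    simp

end EllMZV

end

/-! ### Degree zero: the Dedekind eta function. -/

noncomputable section

namespace EllMZV

open Complex Filter Topology
open scoped Real

lemma zetaSum_two : zetaSum 2 = π ^ 2 / 6 := by
  have h := hasSum_zeta_two
  rw [← h.tsum_eq, h.summable.tsum_eq_zero_add, zetaSum]
  simp

lemma lambertForm_zero (τ ρ : ℂ) : lambertForm τ ρ 0 = ∑' r : ℕ × ℕ,
    cexp (2 * π * I * τ) ^ ((r.1 + 1) * (r.2 + 1)) * (1 / ((r.1 + 1 : ℕ) : ℂ)) := by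
  simp [lambertForm]

/-- The Taylor series of `log (1 - q^k)` is `-∑_m q^{mk} / m`; summing over `k` gives minus the
degree-zero Lambert series, in which `ρ` does not occur. -/
lemma hasSum_log_one_sub_nome (τ : UpperHalfPlane) (ρ : ℂ) :
    HasSum (fun k : ℕ => Complex.log (1 - cexp (2 * π * I * τ) ^ (k + 1)))
      (-lambertForm τ ρ 0) := by
  have hs := summable_lambertForm_term τ ρ 0 0
  simp only [pow_zero, Nat.factorial_zero, Nat.cast_one, div_one, zero_add, pow_one] at hs
  rw [lambertForm_zero, ← (Equiv.prodComm ℕ ℕ).tsum_eq, ← neg_neg (fun k : ℕ => Complex.log _)]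
  refine HasSum.neg (hs.prod_symm.hasSum.prod_fiberwise fun k => ?_)
  have hQ : ‖cexp (2 * π * I * τ) ^ (k + 1)‖ < 1 := by
    rw [norm_pow]
    exact pow_lt_one₀ (norm_nonneg _) (norm_nome_lt_one τ.im_pos) (by omega)
  refine (hasSum_taylorSeries_neg_log' hQ).congr_fun fun m => ?_
  simp only [Prod.swap_prod_mk]
  rw [← pow_mul, mul_comm (k + 1) (m + 1)]
  push_cast
  ring

lemma log_norm_eta (τ : UpperHalfPlane) (ρ : ℂ) :
    Real.log ‖ModularForm.eta (τ : ℂ)‖ = -(π * τ.im / 12) - (lambertForm τ ρ 0).re := by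
  have h := hasSum_log_one_sub_nome τ ρ
  have hprod : ∏' n, (1 - ModularForm.eta_q n (τ : ℂ)) = cexp (-lambertForm τ ρ 0) := by
    rw [← h.tsum_eq, Complex.cexp_tsum_eq_tprod _ h.summable]
    · exact tprod_congr fun n => by rw [ModularForm.eta_q_eq_pow]
    · intro n
      rw [← ModularForm.eta_q_eq_pow]
      exact ModularForm.one_sub_eta_q_ne_zero n τ.im_pos
  rw [ModularForm.eta, hprod, Function.Periodic.qParam, ← Complex.exp_add, Complex.norm_exp,
    Real.log_exp]
  simp
  ring

/-- The homogeneous component of degree `0` of the identity. -/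
lemma re_formEval_quotientDiff_zero (τ : UpperHalfPlane) (x : ℝ) :
    1 / 2 * (formEval (quotientDiff τ) 0 x).re + Real.log ‖ModularForm.eta (τ : ℂ)‖ = 0 := by
  -- Half of the term with `ζ(2) = π²/6` is `π Im τ / 12`, which cancels the logarithm of the factor
  -- `|q^{1/24}|` of `η`; the Lambert series cancel as well.
  rw [re_formEval_quotientDiff_of_even _ _ Even.zero, zetaSum_two, log_norm_eta τ (x - τ)]
  simp
  field_simp
  ring

lemma eisR_eq (τ : UpperHalfPlane) : eisR τ =
    MvPowerSeries.C (1 / 2) * laplaceRe (quotientDiff τ) +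
      MvPowerSeries.C ((Real.log ‖ModularForm.eta (τ : ℂ)‖ : ℝ) : ℂ) + oddZetaSeries := by
  refine eq_of_formEval_eq fun d x => ?_
  rw [formEval_add, formEval_add, formEval_C_mul, formEval_laplaceRe, formEval_C]
  rcases Nat.eq_zero_or_pos d with rfl | hd
  · have h := congrArg (fun t : ℝ => (t : ℂ)) (re_formEval_quotientDiff_zero τ x)
    rw [formEval_eisR, formEval_oddZetaSeries]
    push_cast at h
    simp at h ⊢
    rw [h]
  · rw [formEval_eisR_eq τ x hd, if_neg hd.ne', add_zero]

end EllMZV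

end

theorem mainTheorem11 (τ : UpperHalfPlane) :
    EllMZV.toLaurent (EllMZV.eisR τ) =
      (1 / 2 : ℂ) • EllMZV.laplaceInv (EllMZV.rePart
        (EllMZV.genAInf (EllMZV.lin (2 * Real.pi * Complex.I) 0)
            (EllMZV.lin 0 (-2 * Real.pi * Complex.I)) /
          EllMZV.expSubOne (EllMZV.lin 0 (-2 * Real.pi * Complex.I))))
      + EllMZV.toLaurent
          (MvPowerSeries.C ((Real.log ‖ModularForm.eta (τ : ℂ)‖ : ℝ) : ℂ))
      - (1 / 2 : ℂ) • EllMZV.laplaceInv (EllMZV.rePart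
        (EllMZV.genA
            (EllMZV.lin (2 * Real.pi * Complex.I) (-(2 * Real.pi * Complex.I * (τ : ℂ))))
            (EllMZV.lin 0 (-2 * Real.pi * Complex.I)) τ /
          EllMZV.expSubOne (EllMZV.lin 0 (-2 * Real.pi * Complex.I))))
      + EllMZV.toLaurent EllMZV.oddZetaSeries := by
  exact EllMZV.toLaurent_eq_of_eq (EllMZV.laplaceInv_rePart_genAInf_sub τ) (EllMZV.eisR_eq τ)
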